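/- Conventions. $C^*$-algebras are complex and need not be unital; ideals are closed and two-sided. A projection $p\neq 0$ of a $C^*$-algebra $\mathcal B$ is minimal if $p\mathcal Bp=\mathbb Cp$, and $\mathcal I^{At}(\mathcal B)$ denotes the $C^*$-subalgebra of $\mathcal B$ generated by its minimal projections. A $C^*$-algebra $\mathcal A$ is scattered if $\mathcal I^{At}(\mathcal B)\neq\{0\}$ for every nonzero $C^*$-subalgebra $\mathcal B\subseteq\mathcal A$. The Cantor–Bendixson sequence of a scattered $\mathcal A$ is the sequence of ideals $(\mathcal I_\alpha)_{\alpha\le ht(\mathcal A)}$, indexed by the ordinals up to some ordinal $ht(\mathcal A)$ (the height of $\mathcal A$), which is strictly increasing, continuous (i.e. $\mathcal I_\lambda=\overline{\bigcup_{\alpha<\lambda}\mathcal I_\alpha}$ for limit $\lambda\le ht(\mathcal A)$) and satisfies $\mathcal I_0=\{0\}$, $\mathcal I_{ht(\mathcal A)}=\mathcal A$ and $\mathcal I^{At}(\mathcal A/\mathcal I_\alpha)=\{a+\mathcal I_\alpha : a\in\mathcal I_{\alpha+1}\}$ for all $\alpha<ht(\mathcal A)$; such a height and sequence exist and are unique.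 $\mathcal K(\ell_2)$ is the algebra of compact operators on $\ell_2=\ell_2(\mathbb N)$, $\mathcal A\otimes\mathcal K(\ell_2)$ is the $C^*$-tensor product (unique, since $\mathcal K(\ell_2)$ is nuclear; concretely, the completion of the algebraic tensor product in its largest $C^*$-norm), and for an ideal $\mathcal I$ of $\mathcal A$, $\mathcal I\otimes\mathcal K(\ell_2)$ is regarded as the ideal of $\mathcal A\otimes\mathcal K(\ell_2)$ which is the closed linear span of $\{x\otimes k : x\in\mathcal I,\ k\in\mathcal K(\ell_2)\}$. Proposition. Let $\mathcal A$ be a scattered $C^*$-algebra with Cantor–Bendixson sequence $(\mathcal I_\alpha)_{\alpha\le ht(\mathcal A)}$. Then $\mathcal A\otimes\mathcal K(\ell_2)$ is a scattered $C^*$-algebra, $ht(\mathcal A\otimes\mathcal K(\ell_2))=ht(\mathcal A)$, and its Cantor–Bendixson sequence $(\mathcal J_\alpha)_{\alpha\le ht(\mathcal A)}$ satisfies $\mathcal J_\alpha=\mathcal I_\alpha\otimes\mathcal K(\ell_2)$ for every $\alpha\le ht(\mathcal A)$. In particular, $\mathcal J_{\alpha+1}/\mathcal J_\alpha$ is $*$-isomorphic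 to $(\mathcal I_{\alpha+1}/\mathcal I_\alpha)\otimes\mathcal K(\ell_2)$ for every $\alpha<ht(\mathcal A)$. -/

import Mathlib

open scoped TensorProduct

universe u v

namespace ScatteredCStar

/-! ### Minimal projections and scattered algebras -/

section Atoms

variable {A : Type u} [NonUnitalCStarAlgebra A]

/-- A minimal projection of a C⋆-algebra: a nonzero projection `p` with `pAp = ℂp`. -/
structure IsMinimalProjection (p : A) : Prop where
  isStarProjection : IsStarProjection p
  ne_zero : p ≠ 0
  corner_eq : Set.range (fun a : A => p * a * p) = Set.range (fun c : ℂ => c • p)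

variable (A) in
/-- The C⋆-subalgebra `𝓘ᴬᵗ(A)` generated by the minimal projections of `A`. -/
noncomputable def atomicPart : NonUnitalStarSubalgebra ℂ A :=
  (NonUnitalStarAlgebra.adjoin ℂ {p : A | IsMinimalProjection p}).topologicalClosure

variable (A) in
/-- A C⋆-algebra is scattered if `𝓘ᴬᵗ(B) ≠ 0` for each of its nonzero C⋆-subalgebras `B`. -/
def IsScattered : Prop :=
  ∀ (B : NonUnitalStarSubalgebra ℂ A) [IsClosed (B : Set A)], B ≠ ⊥ → atomicPart B ≠ ⊥

end Atoms

/-! ### Closed ideals and quotients -/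

/-- A closed two-sided ideal of a C⋆-algebra. (Closed two-sided ideals of C⋆-algebras are
automatically self-adjoint linear subspaces; these properties are recorded as fields.) -/
structure ClosedIdeal (A : Type u) [NonUnitalCStarAlgebra A] extends Submodule ℂ A where
  mul_mem_left' : ∀ (a : A) {x : A}, x ∈ carrier → a * x ∈ carrier
  mul_mem_right' : ∀ (a : A) {x : A}, x ∈ carrier → x * a ∈ carrier
  star_mem' : ∀ {x : A}, x ∈ carrier → star x ∈ carrier
  isClosed' : IsClosed carrier

namespace ClosedIdeal

variable {A : Type u} [NonUnitalCStarAlgebra A]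

instance : SetLike (ClosedIdeal A) A where
  coe I := I.carrier
  coe_injective I J h := by
    cases I; cases J; congr; exact SetLike.coe_injective h

instance : NonUnitalSubringClass (ClosedIdeal A) A where
  add_mem {I} := I.add_mem'
  zero_mem I := I.zero_mem'
  neg_mem {I} _ hx := I.toSubmodule.neg_mem hx
  mul_mem {I} _ _ _ hy := I.mul_mem_left' _ hy

instance : SMulMemClass (ClosedIdeal A) ℂ A where
  smul_mem {I} c _ hx := I.smul_mem' c hx

instance : StarMemClass (ClosedIdeal A) A where
  star_mem {I} _ hx := I.star_mem' hx

instance (I : ClosedIdeal A) : IsClosed (I : Set A) := I.isClosed'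

instance (I : ClosedIdeal A) : IsClosed (I.toSubmodule : Set A) := I.isClosed'

/-- The quotient `A / I`, with the quotient norm. -/
def Quotient (I : ClosedIdeal A) : Type u := A ⧸ I.toSubmodule

variable (I : ClosedIdeal A)

noncomputable instance : NormedAddCommGroup I.Quotient :=
  inferInstanceAs (NormedAddCommGroup (A ⧸ I.toSubmodule))

noncomputable instance : NormedSpace ℂ I.Quotient :=
  inferInstanceAs (NormedSpace ℂ (A ⧸ I.toSubmodule))

instance : CompleteSpace I.Quotient :=
  inferInstanceAs (CompleteSpace (A ⧸ I.toSubmodule))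

/-- The quotient map `a ↦ [a]`. -/
def proj : A →ₗ[ℂ] I.Quotient := I.toSubmodule.mkQ

lemma proj_surjective : Function.Surjective I.proj := I.toSubmodule.mkQ_surjective

lemma proj_eq_proj_iff {a b : A} : I.proj a = I.proj b ↔ a - b ∈ I :=
  Submodule.Quotient.eq I.toSubmodule

lemma norm_proj_le (a : A) : ‖I.proj a‖ ≤ ‖a‖ := Submodule.Quotient.norm_mk_le _ a

lemma exists_norm_lt (x : I.Quotient) {ε : ℝ} (hε : 0 < ε) :
    ∃ a, I.proj a = x ∧ ‖a‖ < ‖x‖ + ε :=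
  Submodule.Quotient.norm_mk_lt (S := I.toSubmodule) x hε

noncomputable instance : Mul I.Quotient where
  mul := Quotient.map₂ (sa := I.toSubmodule.quotientRel) (sb := I.toSubmodule.quotientRel)
    (sc := I.toSubmodule.quotientRel) (· * ·) fun a a' h b b' h' => by
      change I.toSubmodule.quotientRel a a' at h
      change I.toSubmodule.quotientRel b b' at h'
      change I.toSubmodule.quotientRel (a * b) (a' * b')
      rw [Submodule.quotientRel_def] at h h' ⊢
      have : a * b - a' * b' = a * (b - b') + (a - a') * b' := by noncomm_ring
      rw [this]
      exact I.add_mem' (I.mul_mem_left' _ h') (I.mul_mem_right' _ h)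

lemma proj_mul (a b : A) : I.proj (a * b) = I.proj a * I.proj b := rfl

noncomputable instance : Star I.Quotient where
  star := Quotient.map (sa := I.toSubmodule.quotientRel) (sb := I.toSubmodule.quotientRel)
    star fun a a' h => by
      change I.toSubmodule.quotientRel a a' at h
      change I.toSubmodule.quotientRel (star a) (star a')
      rw [Submodule.quotientRel_def] at h ⊢
      rw [← star_sub]
      exact I.star_mem' h

lemma proj_star (a : A) : I.proj (star a) = star (I.proj a) := rfl

noncomputable instance : NonUnitalNormedRing I.Quotient where
  __ := (inferInstance : NormedAddCommGroup I.Quotient)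
  left_distrib x y z := by
    obtain ⟨x, rfl⟩ := I.proj_surjective x
    obtain ⟨y, rfl⟩ := I.proj_surjective y
    obtain ⟨z, rfl⟩ := I.proj_surjective z
    simp only [← proj_mul, ← map_add, mul_add]
  right_distrib x y z := by
    obtain ⟨x, rfl⟩ := I.proj_surjective x
    obtain ⟨y, rfl⟩ := I.proj_surjective y
    obtain ⟨z, rfl⟩ := I.proj_surjective z
    simp only [← proj_mul, ← map_add, add_mul]
  zero_mul x := by
    obtain ⟨x, rfl⟩ := I.proj_surjective x
    rw [← map_zero I.proj, ← proj_mul, zero_mul]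
  mul_zero x := by
    obtain ⟨x, rfl⟩ := I.proj_surjective x
    rw [← map_zero I.proj, ← proj_mul, mul_zero]
  mul_assoc x y z := by
    obtain ⟨x, rfl⟩ := I.proj_surjective x
    obtain ⟨y, rfl⟩ := I.proj_surjective y
    obtain ⟨z, rfl⟩ := I.proj_surjective z
    simp only [← proj_mul, mul_assoc]
  norm_mul_le x y := by
    refine ge_of_tendsto (x := nhdsWithin (0 : ℝ) (Set.Ioi 0))
      (f := fun ε : ℝ => (‖x‖ + ε) * (‖y‖ + ε)) ?_ ?_
    · have : Filter.Tendsto (fun ε : ℝ => (‖x‖ + ε) * (‖y‖ + ε)) (nhds 0)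
          (nhds ((‖x‖ + 0) * (‖y‖ + 0))) := by
        apply Continuous.tendsto; fun_prop
      simp only [add_zero] at this
      exact this.mono_left nhdsWithin_le_nhds
    · filter_upwards [self_mem_nhdsWithin] with ε hε
      obtain ⟨a, rfl, ha⟩ := I.exists_norm_lt x hε
      obtain ⟨b, rfl, hb⟩ := I.exists_norm_lt y hε
      rw [← proj_mul]
      refine (I.norm_proj_le _).trans ((norm_mul_le a b).trans ?_)
      exact mul_le_mul ha.le hb.le (norm_nonneg _) ((norm_nonneg a).trans ha.le)

noncomputable instance : StarRing I.Quotient where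
  star_involutive x := by
    obtain ⟨x, rfl⟩ := I.proj_surjective x
    simp only [← proj_star, star_star]
  star_mul x y := by
    obtain ⟨x, rfl⟩ := I.proj_surjective x
    obtain ⟨y, rfl⟩ := I.proj_surjective y
    simp only [← proj_star, ← proj_mul, star_mul]
  star_add x y := by
    obtain ⟨x, rfl⟩ := I.proj_surjective x
    obtain ⟨y, rfl⟩ := I.proj_surjective y
    simp only [← proj_star, ← map_add, star_add]

instance : IsScalarTower ℂ I.Quotient I.Quotient where
  smul_assoc c x y := by
    obtain ⟨x, rfl⟩ := I.proj_surjective x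
    obtain ⟨y, rfl⟩ := I.proj_surjective y
    simp only [smul_eq_mul, ← proj_mul, ← map_smul, smul_mul_assoc]

instance : SMulCommClass ℂ I.Quotient I.Quotient where
  smul_comm c x y := by
    obtain ⟨x, rfl⟩ := I.proj_surjective x
    obtain ⟨y, rfl⟩ := I.proj_surjective y
    simp only [smul_eq_mul, ← proj_mul, ← map_smul, mul_smul_comm]

instance : StarModule ℂ I.Quotient where
  star_smul c x := by
    obtain ⟨x, rfl⟩ := I.proj_surjective x
    simp only [← proj_star, ← map_smul, star_smul]

open Filter Topology in
/-- The key estimate for the C⋆-identity in the quotient. -/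
lemma norm_proj_mul_self_le (a b : A) (hb : b ∈ I) :
    ‖I.proj a‖ * ‖I.proj a‖ ≤ ‖star a * a + b‖ := by
  let _ := CStarAlgebra.spectralOrder I
  have _ := CStarAlgebra.spectralOrderedRing I
  let _ := CStarAlgebra.spectralOrder (Unitization ℂ A)
  have _ := CStarAlgebra.spectralOrderedRing (Unitization ℂ A)
  have hl := CStarAlgebra.increasingApproximateUnit I
  have hne : (CStarAlgebra.approximateUnit I).NeBot := hl.neBot
  set b' : I := ⟨b, hb⟩ with hb'
  have ht : Tendsto (fun e : I => ‖star a * a + b‖ + ‖b' - e * b'‖)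
      (CStarAlgebra.approximateUnit I) (𝓝 (‖star a * a + b‖ + ‖b' - b'‖)) :=
    tendsto_const_nhds.add ((tendsto_const_nhds.sub (hl.tendsto_mul_right b')).norm)
  rw [sub_self, norm_zero, add_zero] at ht
  refine ge_of_tendsto ht ?_
  filter_upwards [hl.eventually_nonneg, hl.eventually_norm] with e he₀ he₁
  have hstar : star (e : A) = e := congrArg Subtype.val (IsSelfAdjoint.of_nonneg he₀).star_eq
  obtain ⟨c, hc⟩ := CStarAlgebra.nonneg_iff_eq_star_mul_self.mp he₀
  let E : Unitization ℂ A := ((e : A) : Unitization ℂ A)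
  let B : Unitization ℂ A := ((b : A) : Unitization ℂ A)
  let a' : Unitization ℂ A := ((a : A) : Unitization ℂ A)
  have hE₀ : 0 ≤ E := by
    have : E = star (((c : A) : Unitization ℂ A)) * ((c : A) : Unitization ℂ A) := by
      simp only [E, hc]
      rw [← Unitization.inr_star, ← Unitization.inr_mul]
      rfl
    rw [this]
    exact star_mul_self_nonneg _
  have hE₁ : ‖E‖ ≤ 1 := by
    simp only [E]
    rw [Unitization.norm_inr]
    exact he₁
  have hE : 1 - E ∈ Set.Icc 0 1 :=
    Set.sub_mem_Icc_zero_iff_right.mpr (CStarAlgebra.mem_Icc_iff_norm_le_one.mpr ⟨hE₀, hE₁⟩)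
  have hE' : ‖1 - E‖ ≤ 1 := (CStarAlgebra.mem_Icc_iff_norm_le_one.mp hE).2
  have hEs : star (1 - E) = 1 - E := (IsSelfAdjoint.of_nonneg hE.1).star_eq
  have h1 : ‖I.proj a‖ ≤ ‖a' * (1 - E)‖ := by
    have : I.proj a = I.proj (a - a * e) := by
      rw [proj_eq_proj_iff]
      rw [sub_sub_cancel]
      exact I.mul_mem_left' a e.2
    rw [this]
    refine (I.norm_proj_le _).trans_eq ?_
    rw [← Unitization.norm_inr (𝕜 := ℂ)]
    congr 1
    simp [a', E, mul_sub]
  have h2 : ‖(1 - E) * B‖ = ‖b' - e * b'‖ := by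
    have : (1 - E) * B = ((b - e * b : A) : Unitization ℂ A) := by
      simp [E, B, sub_mul]
    rw [this, Unitization.norm_inr]
    rfl
  have h3 : ‖star a' * a' + B‖ = ‖star a * a + b‖ := by
    have : star a' * a' + B = ((star a * a + b : A) : Unitization ℂ A) := by
      simp [a', B]
    rw [this, Unitization.norm_inr]
  have h4 : star (a' * (1 - E)) * (a' * (1 - E)) =
      (1 - E) * (star a' * a' + B) * (1 - E) - (1 - E) * B * (1 - E) := by
    rw [star_mul, hEs]
    noncomm_ring
  calc ‖I.proj a‖ * ‖I.proj a‖ ≤ ‖a' * (1 - E)‖ * ‖a' * (1 - E)‖ := by gcongr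
    _ = ‖(1 - E) * (star a' * a' + B) * (1 - E) - (1 - E) * B * (1 - E)‖ := by
      rw [← CStarRing.norm_star_mul_self, h4]
    _ ≤ ‖(1 - E) * (star a' * a' + B) * (1 - E)‖ + ‖(1 - E) * B * (1 - E)‖ := norm_sub_le _ _
    _ ≤ 1 * ‖star a' * a' + B‖ * 1 + ‖(1 - E) * B‖ * 1 := by
      gcongr
      · refine (norm_mul_le _ _).trans ?_
        gcongr
        refine (norm_mul_le _ _).trans ?_
        gcongr
      · refine (norm_mul_le _ _).trans ?_
        gcongr
    _ = ‖star a * a + b‖ + ‖b' - e * b'‖ := by rw [h2, h3, one_mul, mul_one, mul_one]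

instance : CStarRing I.Quotient where
  norm_mul_self_le x := by
    obtain ⟨a, rfl⟩ := I.proj_surjective x
    refine le_of_forall_pos_le_add fun ε hε => ?_
    obtain ⟨d, hd, hlt⟩ := I.exists_norm_lt (star (I.proj a) * I.proj a) hε
    rw [← proj_star, ← proj_mul, proj_eq_proj_iff] at hd
    have := I.norm_proj_mul_self_le a _ hd
    rw [add_sub_cancel] at this
    exact this.trans hlt.le

noncomputable instance : NonUnitalCStarAlgebra I.Quotient where

/-- For ideals `I`, `J` of `A`, the ideal `I ∩ J` of the C⋆-algebra `J`. -/
def restrict (I J : ClosedIdeal A) : ClosedIdeal J where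
  carrier := {x : J | (x : A) ∈ I}
  add_mem' hx hy := add_mem (S := ClosedIdeal A) hx hy
  zero_mem' := zero_mem (S := ClosedIdeal A) I
  smul_mem' c _ hx := I.smul_mem' c hx
  mul_mem_left' a _ hx := I.mul_mem_left' a hx
  mul_mem_right' a _ hx := I.mul_mem_right' a hx
  star_mem' hx := I.star_mem' hx
  isClosed' := I.isClosed'.preimage continuous_subtype_val

/-- The C⋆-algebra `J / I` for ideals `I ⊆ J` of `A` (in general, this is `J / (I ∩ J)`). -/
abbrev Subquotient (J I : ClosedIdeal A) : Type u := (I.restrict J).Quotient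

end ClosedIdeal

/-! ### The algebra of compact operators -/

section Compact

variable {H : Type u} [NormedAddCommGroup H] [InnerProductSpace ℂ H] [CompleteSpace H]

lemma isCompactOperator_star {T : H →L[ℂ] H} (hT : IsCompactOperator T) :
    IsCompactOperator (star T : H →L[ℂ] H) := by
  have hTT : IsCompactOperator (T * star T : H →L[ℂ] H) := hT.comp_clm (star T : H →L[ℂ] H)
  refine (isCompactOperator_iff_isCompact_closure_image_closedBall
    ((star T : H →L[ℂ] H) : H →ₗ[ℂ] H) zero_lt_one).mpr ?_
  refine TotallyBounded.isCompact_of_isClosed (TotallyBounded.closure ?_) isClosed_closure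
  have hK : TotallyBounded ((T * star T : H →L[ℂ] H) '' Metric.closedBall 0 1) :=
    ((hTT.isCompact_closure_image_closedBall
      (f := ((T * star T : H →L[ℂ] H) : H →ₗ[ℂ] H)) 1).totallyBounded).subset subset_closure
  rw [Metric.totallyBounded_iff] at hK ⊢
  intro ε hε
  have hδ : 0 < ε ^ 2 / 4 := by positivity
  obtain ⟨t, hts, ht, hcov⟩ := totallyBounded_iff_subset.mp
    (Metric.totallyBounded_iff.mpr hK) _ (Metric.dist_mem_uniformity hδ)
  have hts' : ∀ y, ∃ x, y ∈ t → x ∈ Metric.closedBall (0 : H) 1 ∧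
      (T * star T : H →L[ℂ] H) x = y := fun y => by
    by_cases hy : y ∈ t
    · obtain ⟨x, hx, hxy⟩ := hts hy
      exact ⟨x, fun _ => ⟨hx, hxy⟩⟩
    · exact ⟨0, fun h => absurd h hy⟩
  choose g hg using hts'
  refine ⟨(fun y => (star T : H →L[ℂ] H) (g y)) '' t, ht.image _, ?_⟩
  rintro _ ⟨x, hx, rfl⟩
  have := hcov ⟨x, hx, rfl⟩
  simp only [Set.mem_iUnion, Set.mem_ofPred_eq] at this ⊢
  obtain ⟨y, hy, hxy⟩ := this
  refine ⟨_, ⟨y, hy, rfl⟩, ?_⟩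
  obtain ⟨hgy, hgy'⟩ := hg y hy
  rw [Metric.mem_ball, dist_eq_norm]
  change ‖(star T : H →L[ℂ] H) x - (star T : H →L[ℂ] H) (g y)‖ < ε
  rw [← map_sub]
  set z := x - g y with hz
  have hz2 : ‖z‖ ≤ 2 := by
    rw [mem_closedBall_zero_iff] at hx hgy
    exact (norm_sub_le _ _).trans (by linarith)
  have hTz : ‖(T * star T : H →L[ℂ] H) z‖ < ε ^ 2 / 4 := by
    rw [hz, map_sub, hgy', ← dist_eq_norm]
    exact hxy
  have hin : ‖(star T : H →L[ℂ] H) z‖ ^ 2 ≤ ‖(T * star T : H →L[ℂ] H) z‖ * ‖z‖ := by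
    have h1 : inner ℂ ((T * star T : H →L[ℂ] H) z) z =
        inner ℂ ((star T : H →L[ℂ] H) z) ((star T : H →L[ℂ] H) z) := by
      rw [ContinuousLinearMap.star_eq_adjoint]
      exact (ContinuousLinearMap.adjoint_inner_right T _ _).symm
    have h2 := norm_inner_le_norm (𝕜 := ℂ) ((T * star T : H →L[ℂ] H) z) z
    rw [h1, inner_self_eq_norm_sq_to_K, norm_pow, RCLike.norm_ofReal, abs_norm] at h2
    exact h2
  have : ‖(star T : H →L[ℂ] H) z‖ ^ 2 < ε ^ 2 := by nlinarith [norm_nonneg z]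
  exact lt_of_pow_lt_pow_left₀ 2 hε.le this

variable (H) in
/-- The C⋆-algebra `𝓚(H)` of compact operators on the Hilbert space `H`. -/
noncomputable def compactOperators : NonUnitalStarSubalgebra ℂ (H →L[ℂ] H) where
  carrier := {T | IsCompactOperator T}
  add_mem' hS hT := IsCompactOperator.add hS hT
  zero_mem' := isCompactOperator_zero
  mul_mem' {_ T} hS _ := IsCompactOperator.comp_clm hS T
  smul_mem' c _ hT := IsCompactOperator.smul hT c
  star_mem' hT := isCompactOperator_star hT

instance : IsClosed (compactOperators H : Set (H →L[ℂ] H)) :=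
  isClosed_setOfPred_isCompactOperator

end Compact

/-- The C⋆-algebra `𝓚(ℓ₂)`, where `ℓ₂ = ℓ₂(ℕ)` is the complex sequence space. -/
abbrev KEllTwo : Type := compactOperators (lp (fun _ : ℕ => ℂ) 2)

/-! ### The C⋆-tensor product -/

section Tensor

variable (A : Type u) (B : Type v) [NonUnitalCStarAlgebra A] [NonUnitalCStarAlgebra B]

/-- The C⋆-seminorms on the algebraic tensor product of two C⋆-algebras. (The inequality
`p (a ⊗ b) ≤ ‖a‖ ‖b‖` is automatic for C⋆-seminorms; it is recorded as a field.) -/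
structure CStarSeminorm extends Seminorm ℂ (A ⊗[ℂ] B) where
  mul_le' : ∀ x y, toFun (x * y) ≤ toFun x * toFun y
  star_mul_self' : ∀ x, toFun (star x * x) = toFun x * toFun x
  tmul_le' : ∀ a b, toFun (a ⊗ₜ[ℂ] b) ≤ ‖a‖ * ‖b‖

variable {A B}

noncomputable instance : Inhabited (CStarSeminorm A B) where
  default := { (0 : Seminorm ℂ (A ⊗[ℂ] B)) with
    mul_le' := fun _ _ => by change (0 : ℝ) ≤ 0 * 0; simp
    star_mul_self' := fun _ => by change (0 : ℝ) = 0 * 0; simp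
    tmul_le' := fun a b => by change (0 : ℝ) ≤ _; positivity }

lemma CStarSeminorm.bddAbove (x : A ⊗[ℂ] B) :
    BddAbove (Set.range fun p : CStarSeminorm A B => p.toSeminorm x) := by
  induction x with
  | zero => exact ⟨0, by rintro _ ⟨p, rfl⟩; simp⟩
  | tmul a b => exact ⟨‖a‖ * ‖b‖, by rintro _ ⟨p, rfl⟩; exact p.tmul_le' a b⟩
  | add x y hx hy =>
    obtain ⟨c, hc⟩ := hx
    obtain ⟨d, hd⟩ := hy
    refine ⟨c + d, ?_⟩
    rintro _ ⟨p, rfl⟩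
    exact (map_add_le_add p.toSeminorm x y).trans (add_le_add (hc ⟨p, rfl⟩) (hd ⟨p, rfl⟩))

/-- The largest C⋆-seminorm on the algebraic tensor product. -/
noncomputable def maxNorm (x : A ⊗[ℂ] B) : ℝ := ⨆ p : CStarSeminorm A B, p.toSeminorm x

lemma CStarSeminorm.le_maxNorm (p : CStarSeminorm A B) (x : A ⊗[ℂ] B) :
    p.toSeminorm x ≤ maxNorm x :=
  le_ciSup (CStarSeminorm.bddAbove x) p

lemma maxNorm_nonneg (x : A ⊗[ℂ] B) : 0 ≤ maxNorm x :=
  Real.iSup_nonneg fun p => apply_nonneg p.toSeminorm x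

lemma maxNorm_add_le (x y : A ⊗[ℂ] B) : maxNorm (x + y) ≤ maxNorm x + maxNorm y :=
  ciSup_le fun p => (map_add_le_add p.toSeminorm x y).trans
    (add_le_add (p.le_maxNorm x) (p.le_maxNorm y))

lemma maxNorm_mul_le (x y : A ⊗[ℂ] B) : maxNorm (x * y) ≤ maxNorm x * maxNorm y :=
  ciSup_le fun p => (p.mul_le' x y).trans
    (mul_le_mul (p.le_maxNorm x) (p.le_maxNorm y) (apply_nonneg p.toSeminorm y)
      (maxNorm_nonneg x))

lemma maxNorm_smul (c : ℂ) (x : A ⊗[ℂ] B) : maxNorm (c • x) = ‖c‖ * maxNorm x := by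
  simp only [maxNorm, map_smul_eq_mul]
  exact (Real.mul_iSup_of_nonneg (norm_nonneg c) _).symm

lemma maxNorm_sq_le (x : A ⊗[ℂ] B) : maxNorm x * maxNorm x ≤ maxNorm (star x * x) := by
  rw [← sq]
  refine (Real.le_sqrt (maxNorm_nonneg x) (maxNorm_nonneg _)).mp ?_
  refine ciSup_le fun p => (Real.le_sqrt (apply_nonneg _ _) (maxNorm_nonneg _)).mpr ?_
  rw [sq]
  exact (p.star_mul_self' x).symm.le.trans (p.le_maxNorm _)

variable (A B)

/-- The algebraic tensor product, equipped with its largest C⋆-seminorm. -/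
def AlgTensor : Type max u v := A ⊗[ℂ] B

namespace AlgTensor

instance : AddCommGroup (AlgTensor A B) := inferInstanceAs (AddCommGroup (A ⊗[ℂ] B))

instance : Module ℂ (AlgTensor A B) := inferInstanceAs (Module ℂ (A ⊗[ℂ] B))

noncomputable instance : NonUnitalRing (AlgTensor A B) :=
  inferInstanceAs (NonUnitalRing (A ⊗[ℂ] B))

noncomputable instance : StarRing (AlgTensor A B) :=
  inferInstanceAs (StarRing (A ⊗[ℂ] B))

instance : StarModule ℂ (AlgTensor A B) := inferInstanceAs (StarModule ℂ (A ⊗[ℂ] B))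

instance : IsScalarTower ℂ (AlgTensor A B) (AlgTensor A B) :=
  inferInstanceAs (IsScalarTower ℂ (A ⊗[ℂ] B) (A ⊗[ℂ] B))

instance : SMulCommClass ℂ (AlgTensor A B) (AlgTensor A B) :=
  inferInstanceAs (SMulCommClass ℂ (A ⊗[ℂ] B) (A ⊗[ℂ] B))

noncomputable instance : SeminormedAddCommGroup (AlgTensor A B) :=
  AddGroupSeminorm.toSeminormedAddCommGroup
    { toFun := fun x => maxNorm (A := A) (B := B) x
      map_zero' := by
        have := maxNorm_smul (A := A) (B := B) 0 0
        rwa [norm_zero, zero_mul, zero_smul] at this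
      add_le' := maxNorm_add_le
      neg' := fun x => by
        have := maxNorm_smul (A := A) (B := B) (-1) x
        rw [norm_neg, norm_one, one_mul] at this
        exact (congrArg maxNorm (neg_one_smul ℂ (x : A ⊗[ℂ] B))).symm.trans this }

lemma norm_def (x : AlgTensor A B) : ‖x‖ = maxNorm (A := A) (B := B) x := rfl

noncomputable instance : NormedSpace ℂ (AlgTensor A B) where
  norm_smul_le c x := (maxNorm_smul (A := A) (B := B) c x).le

noncomputable instance : NonUnitalSeminormedRing (AlgTensor A B) where
  __ := (inferInstance : NonUnitalRing (AlgTensor A B))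
  __ := (inferInstance : SeminormedAddCommGroup (AlgTensor A B))
  norm_mul_le := maxNorm_mul_le (A := A) (B := B)

lemma norm_sq_le (x : AlgTensor A B) : ‖x‖ * ‖x‖ ≤ ‖star x * x‖ :=
  maxNorm_sq_le (A := A) (B := B) x

instance : NormedStarGroup (AlgTensor A B) where
  norm_star_le x := by
    by_contra! h
    have h1 := norm_sq_le A B (star x)
    rw [star_star] at h1
    have h2 := norm_mul_le x (star x)
    nlinarith [norm_nonneg x]

end AlgTensor

/-- The C⋆-tensor product `A ⊗ B`: the completion of the algebraic tensor product in its largest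
C⋆-norm. -/
def CStarTensor : Type max u v := UniformSpace.Completion (AlgTensor A B)

namespace CStarTensor

open UniformSpace UniformSpace.Completion

noncomputable instance : NormedAddCommGroup (CStarTensor A B) :=
  inferInstanceAs (NormedAddCommGroup (Completion (AlgTensor A B)))

noncomputable instance : NormedSpace ℂ (CStarTensor A B) :=
  inferInstanceAs (NormedSpace ℂ (Completion (AlgTensor A B)))

instance : CompleteSpace (CStarTensor A B) :=
  inferInstanceAs (CompleteSpace (Completion (AlgTensor A B)))

variable {A B}

/-- The canonical map of the algebraic tensor product into its completion. -/
noncomputable def ofAlg : AlgTensor A B →L[ℂ] CStarTensor A B :=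
  toComplL (𝕜 := ℂ) (E := AlgTensor A B)

lemma norm_ofAlg (x : AlgTensor A B) : ‖ofAlg x‖ = ‖x‖ := norm_coe x

lemma isDenseInducing_ofAlg : IsDenseInducing (ofAlg : AlgTensor A B → CStarTensor A B) :=
  isDenseInducing_coe

lemma denseRange_ofAlg : DenseRange (ofAlg : AlgTensor A B → CStarTensor A B) :=
  denseRange_coe

/-- The multiplication of `A ⊗ B`, extended by continuity from the algebraic tensor product. -/
@[irreducible]
noncomputable def mulAux (x y : CStarTensor A B) : CStarTensor A B :=
  (isDenseInducing_ofAlg.prodMap isDenseInducing_ofAlg).extend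
    (fun p : AlgTensor A B × AlgTensor A B => ofAlg (p.1 * p.2)) (x, y)

noncomputable instance : Mul (CStarTensor A B) where
  mul := mulAux

lemma ofAlg_mul (x y : AlgTensor A B) : ofAlg (x * y) = ofAlg x * ofAlg y := by
  change _ = mulAux (ofAlg x) (ofAlg y)
  rw [mulAux]
  exact ((isDenseInducing_ofAlg.prodMap isDenseInducing_ofAlg).extend_eq
    (ofAlg.continuous.comp continuous_mul) (x, y)).symm

instance : ContinuousMul (CStarTensor A B) where
  continuous_mul := by
    let m : AlgTensor A B →+ AlgTensor A B →+ CStarTensor A B :=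
      (AddMonoidHom.mul : AlgTensor A B →+ AlgTensor A B →+ AlgTensor A B).compr₂
        (ofAlg : AlgTensor A B →L[ℂ] CStarTensor A B).toLinearMap.toAddMonoidHom
    have : Continuous fun p : AlgTensor A B × AlgTensor A B => m p.1 p.2 :=
      ofAlg.continuous.comp continuous_mul
    have di : IsDenseInducing (toCompl : AlgTensor A B → Completion (AlgTensor A B)) :=
      isDenseInducing_coe
    change Continuous fun p : CStarTensor A B × CStarTensor A B => mulAux p.1 p.2
    simp only [mulAux]
    exact (di.extend_Z_bilin di this :)

/-- The involution of `A ⊗ B`, extended by continuity from the algebraic tensor product. -/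
@[irreducible]
noncomputable def starAux : CStarTensor A B → CStarTensor A B :=
  Completion.map (star : AlgTensor A B → AlgTensor A B)

noncomputable instance : Star (CStarTensor A B) where
  star := starAux

lemma ofAlg_star (x : AlgTensor A B) : ofAlg (star x) = star (ofAlg x) := by
  change _ = starAux (ofAlg x)
  rw [starAux]
  exact (Completion.map_coe (starₗᵢ ℂ (E := AlgTensor A B)).isometry.uniformContinuous x).symm

instance : ContinuousStar (CStarTensor A B) where
  continuous_star := by
    change Continuous (starAux (A := A) (B := B))
    unfold starAux
    exact Completion.continuous_map

lemma induction_on {p : CStarTensor A B → Prop} (x : CStarTensor A B)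
    (hp : IsClosed {x | p x}) (ih : ∀ x : AlgTensor A B, p (ofAlg x)) : p x :=
  Completion.induction_on x hp ih

lemma continuous_mul_right_aux (y : CStarTensor A B) :
    Continuous fun x : CStarTensor A B => x * y := continuous_mul_const y

lemma continuous_mul_left_aux (x : CStarTensor A B) :
    Continuous fun y : CStarTensor A B => x * y := continuous_const_mul x

lemma left_distrib_aux (x y z : CStarTensor A B) : x * (y + z) = x * y + x * z := by
  induction x using induction_on with
  | hp =>
    exact isClosed_eq (by exact continuous_mul_right_aux (A := A) (B := B) _)
      (by exact (continuous_mul_right_aux (A := A) (B := B) _).add (continuous_mul_right_aux (A := A) (B := B) _))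
  | ih x =>
  induction y using induction_on with
  | hp =>
    exact isClosed_eq (by exact (continuous_mul_left_aux (A := A) (B := B) _).comp (continuous_add_const z))
      (by exact (continuous_mul_left_aux (A := A) (B := B) _).add continuous_const)
  | ih y =>
  induction z using induction_on with
  | hp =>
    exact isClosed_eq (by exact (continuous_mul_left_aux (A := A) (B := B) _).comp (continuous_const_add _))
      (by exact continuous_const.add (continuous_mul_left_aux (A := A) (B := B) _))
  | ih z => simp only [← ofAlg_mul, ← map_add, mul_add]

lemma right_distrib_aux (x y z : CStarTensor A B) : (x + y) * z = x * z + y * z := by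
  induction x using induction_on with
  | hp =>
    exact isClosed_eq (by exact (continuous_mul_right_aux (A := A) (B := B) _).comp (continuous_add_const _))
      (by exact (continuous_mul_right_aux (A := A) (B := B) _).add continuous_const)
  | ih x =>
  induction y using induction_on with
  | hp =>
    exact isClosed_eq (by exact (continuous_mul_right_aux (A := A) (B := B) _).comp (continuous_const_add _))
      (by exact continuous_const.add (continuous_mul_right_aux (A := A) (B := B) _))
  | ih y =>
  induction z using induction_on with
  | hp =>
    exact isClosed_eq (by exact continuous_mul_left_aux (A := A) (B := B) _)
      (by exact (continuous_mul_left_aux (A := A) (B := B) _).add (continuous_mul_left_aux (A := A) (B := B) _))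
  | ih z => simp only [← ofAlg_mul, ← map_add, add_mul]

lemma zero_mul_aux (x : CStarTensor A B) : 0 * x = 0 := by
  induction x using induction_on with
  | hp =>
    exact isClosed_eq (by exact continuous_mul_left_aux (A := A) (B := B) _)
      (by exact continuous_const)
  | ih x => rw [← map_zero ofAlg, ← ofAlg_mul, zero_mul]

lemma mul_zero_aux (x : CStarTensor A B) : x * 0 = 0 := by
  induction x using induction_on with
  | hp =>
    exact isClosed_eq (by exact continuous_mul_right_aux (A := A) (B := B) _)
      (by exact continuous_const)
  | ih x => rw [← map_zero ofAlg, ← ofAlg_mul, mul_zero]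

lemma mul_assoc_aux (x y z : CStarTensor A B) : x * y * z = x * (y * z) := by
  induction x using induction_on with
  | hp =>
    exact isClosed_eq (by exact (continuous_mul_right_aux (A := A) (B := B) z).comp (continuous_mul_right_aux (A := A) (B := B) y))
      (by exact continuous_mul_right_aux (A := A) (B := B) (y * z))
  | ih x =>
  induction y using induction_on with
  | hp =>
    exact isClosed_eq (by exact (continuous_mul_right_aux (A := A) (B := B) z).comp (continuous_mul_left_aux (A := A) (B := B) _))
      (by exact (continuous_mul_left_aux (A := A) (B := B) _).comp (continuous_mul_right_aux (A := A) (B := B) z))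
  | ih y =>
  induction z using induction_on with
  | hp =>
    exact isClosed_eq (by exact continuous_mul_left_aux (A := A) (B := B) _)
      (by exact (continuous_mul_left_aux (A := A) (B := B) _).comp (continuous_mul_left_aux (A := A) (B := B) _))
  | ih z => simp only [← ofAlg_mul, mul_assoc]

noncomputable instance : NonUnitalRing (CStarTensor A B) where
  __ := (inferInstance : AddCommGroup (CStarTensor A B))
  left_distrib := left_distrib_aux
  right_distrib := right_distrib_aux
  zero_mul := zero_mul_aux
  mul_zero := mul_zero_aux
  mul_assoc := mul_assoc_aux

lemma norm_mul_le' (x y : CStarTensor A B) : ‖x * y‖ ≤ ‖x‖ * ‖y‖ := by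
    induction x using induction_on with
    | hp => exact isClosed_le (by fun_prop) (by fun_prop)
    | ih x =>
    induction y using induction_on with
    | hp => exact isClosed_le (by fun_prop) (by fun_prop)
    | ih y =>
      rw [← ofAlg_mul, norm_ofAlg, norm_ofAlg, norm_ofAlg]
      exact norm_mul_le x y

noncomputable instance : NonUnitalNormedRing (CStarTensor A B) where
  __ := (inferInstance : NonUnitalRing (CStarTensor A B))
  __ := (inferInstance : NormedAddCommGroup (CStarTensor A B))
  norm_mul_le := norm_mul_le'

noncomputable instance : StarRing (CStarTensor A B) where
  star_involutive x := by
    induction x using induction_on with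
    | hp => exact isClosed_eq (by fun_prop) (by fun_prop)
    | ih x => rw [← ofAlg_star, ← ofAlg_star, star_star]
  star_mul x y := by
    induction x using induction_on with
    | hp => exact isClosed_eq (by fun_prop) (by fun_prop)
    | ih x =>
    induction y using induction_on with
    | hp => exact isClosed_eq (by fun_prop) (by fun_prop)
    | ih y => simp only [← ofAlg_star, ← ofAlg_mul, star_mul]
  star_add x y := by
    induction x using induction_on with
    | hp => exact isClosed_eq (by fun_prop) (by fun_prop)
    | ih x =>
    induction y using induction_on with
    | hp => exact isClosed_eq (by fun_prop) (by fun_prop)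
    | ih y => simp only [← ofAlg_star, ← map_add, star_add]

instance : CStarRing (CStarTensor A B) where
  norm_mul_self_le x := by
    induction x using induction_on with
    | hp => exact isClosed_le (by fun_prop) (by fun_prop)
    | ih x =>
      rw [← ofAlg_star, ← ofAlg_mul, norm_ofAlg, norm_ofAlg]
      exact AlgTensor.norm_sq_le A B x

lemma continuous_smul_aux (c : ℂ) :
    Continuous fun x : CStarTensor A B => c • x := continuous_const_smul c

instance : IsScalarTower ℂ (CStarTensor A B) (CStarTensor A B) where
  smul_assoc c x y := by
    simp only [smul_eq_mul]
    induction x using induction_on with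
    | hp =>
      exact isClosed_eq (by exact (continuous_mul_right_aux (A := A) (B := B) y).comp (continuous_smul_aux (A := A) (B := B) c))
        (by exact (continuous_smul_aux (A := A) (B := B) c).comp (continuous_mul_right_aux (A := A) (B := B) y))
    | ih x =>
    induction y using induction_on with
    | hp =>
      exact isClosed_eq (by exact continuous_mul_left_aux (A := A) (B := B) _)
        (by exact (continuous_smul_aux (A := A) (B := B) c).comp (continuous_mul_left_aux (A := A) (B := B) _))
    | ih y => simp only [← ofAlg_mul, ← map_smul, smul_mul_assoc]

instance : SMulCommClass ℂ (CStarTensor A B) (CStarTensor A B) where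
  smul_comm c x y := by
    simp only [smul_eq_mul]
    induction x using induction_on with
    | hp =>
      exact isClosed_eq (by exact (continuous_smul_aux (A := A) (B := B) c).comp (continuous_mul_right_aux (A := A) (B := B) y))
        (by exact continuous_mul_right_aux (A := A) (B := B) (c • y))
    | ih x =>
    induction y using induction_on with
    | hp =>
      exact isClosed_eq (by exact (continuous_smul_aux (A := A) (B := B) c).comp (continuous_mul_left_aux (A := A) (B := B) _))
        (by exact (continuous_mul_left_aux (A := A) (B := B) _).comp (continuous_smul_aux (A := A) (B := B) c))
    | ih y => simp only [← ofAlg_mul, ← map_smul, mul_smul_comm]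

instance : StarModule ℂ (CStarTensor A B) where
  star_smul c x := by
    induction x using induction_on with
    | hp =>
      exact isClosed_eq (by exact continuous_star.comp (continuous_smul_aux (A := A) (B := B) c))
        (by exact (continuous_smul_aux (A := A) (B := B) (star c)).comp continuous_star)
    | ih x => simp only [← ofAlg_star, ← map_smul, star_smul]

noncomputable instance : NonUnitalCStarAlgebra (CStarTensor A B) where

/-- The elementary tensor `a ⊗ b` in `A ⊗ B`. -/
noncomputable def tmul (a : A) (b : B) : CStarTensor A B :=
  ofAlg ((a ⊗ₜ[ℂ] b : A ⊗[ℂ] B) : AlgTensor A B)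

lemma tmul_mul_tmul (a a' : A) (b b' : B) :
    tmul a b * tmul a' b' = tmul (a * a') (b * b') := by
  refine (ofAlg_mul (A := A) (B := B) (a ⊗ₜ[ℂ] b : A ⊗[ℂ] B) (a' ⊗ₜ[ℂ] b' : A ⊗[ℂ] B)).symm.trans ?_
  exact congrArg (ofAlg (A := A) (B := B)) (Algebra.TensorProduct.tmul_mul_tmul a a' b b')

lemma star_tmul (a : A) (b : B) : star (tmul a b) = tmul (star a) (star b) := by
  exact (ofAlg_star (A := A) (B := B) (a ⊗ₜ[ℂ] b : A ⊗[ℂ] B)).symm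

lemma dense_span_tmul :
    Dense ((Submodule.span ℂ {x : CStarTensor A B | ∃ (a : A) (b : B), x = tmul a b} :
      Submodule ℂ (CStarTensor A B)) : Set (CStarTensor A B)) := by
  refine denseRange_ofAlg.mono ?_
  rintro _ ⟨x, rfl⟩
  refine TensorProduct.induction_on (motive := fun x : A ⊗[ℂ] B =>
    ofAlg (x : AlgTensor A B) ∈
      Submodule.span ℂ {x : CStarTensor A B | ∃ (a : A) (b : B), x = tmul a b}) x ?_ ?_ ?_
  · exact (map_zero (ofAlg : AlgTensor A B →L[ℂ] CStarTensor A B)).symm ▸ Submodule.zero_mem _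
  · exact fun a b => Submodule.subset_span ⟨a, b, rfl⟩
  · intro x y hx hy
    have := Submodule.add_mem _ hx hy
    exact (map_add (ofAlg : AlgTensor A B →L[ℂ] CStarTensor A B) x y).symm ▸ this

end CStarTensor

open CStarTensor in
/-- For an ideal `I` of `A`, the ideal `I ⊗ B` of `A ⊗ B`: the closed linear span of the elementary
tensors `x ⊗ b` with `x ∈ I` and `b ∈ B`. -/
noncomputable def ClosedIdeal.tensor {A : Type u} [NonUnitalCStarAlgebra A] (I : ClosedIdeal A)
    (B : Type v) [NonUnitalCStarAlgebra B] : ClosedIdeal (CStarTensor A B) where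
  toSubmodule := (Submodule.span ℂ
    {t : CStarTensor A B | ∃ x ∈ I, ∃ b : B, t = tmul x b}).topologicalClosure
  mul_mem_left' a t ht := by
    set N := (Submodule.span ℂ
      {t : CStarTensor A B | ∃ x ∈ I, ∃ b : B, t = tmul x b}).topologicalClosure with hN
    have hNc : IsClosed (N : Set (CStarTensor A B)) := Submodule.isClosed_topologicalClosure _
    have key : N ≤ N.comap (LinearMap.mulLeft ℂ a) := by
      refine Submodule.topologicalClosure_minimal _ (Submodule.span_le.mpr ?_)
        (hNc.preimage (continuous_const_mul a))
      rintro _ ⟨x, hx, b, rfl⟩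
      have h2 : (⊤ : Submodule ℂ (CStarTensor A B)) ≤ N.comap (LinearMap.mulRight ℂ (tmul x b)) := by
        rw [← Submodule.dense_iff_topologicalClosure_eq_top.mp (dense_span_tmul (A := A) (B := B))]
        refine Submodule.topologicalClosure_minimal _ (Submodule.span_le.mpr ?_)
          (hNc.preimage (continuous_mul_const (tmul x b)))
        rintro _ ⟨a', b', rfl⟩
        refine Submodule.le_topologicalClosure _ (Submodule.subset_span ?_)
        exact ⟨a' * x, I.mul_mem_left' a' hx, b' * b, tmul_mul_tmul _ _ _ _⟩
      exact h2 (Submodule.mem_top (x := a))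
    exact key ht
  mul_mem_right' a t ht := by
    set N := (Submodule.span ℂ
      {t : CStarTensor A B | ∃ x ∈ I, ∃ b : B, t = tmul x b}).topologicalClosure with hN
    have hNc : IsClosed (N : Set (CStarTensor A B)) := Submodule.isClosed_topologicalClosure _
    have key : N ≤ N.comap (LinearMap.mulRight ℂ a) := by
      refine Submodule.topologicalClosure_minimal _ (Submodule.span_le.mpr ?_)
        (hNc.preimage (continuous_mul_const a))
      rintro _ ⟨x, hx, b, rfl⟩
      have h2 : (⊤ : Submodule ℂ (CStarTensor A B)) ≤ N.comap (LinearMap.mulLeft ℂ (tmul x b)) := by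
        rw [← Submodule.dense_iff_topologicalClosure_eq_top.mp (dense_span_tmul (A := A) (B := B))]
        refine Submodule.topologicalClosure_minimal _ (Submodule.span_le.mpr ?_)
          (hNc.preimage (continuous_const_mul (tmul x b)))
        rintro _ ⟨a', b', rfl⟩
        refine Submodule.le_topologicalClosure _ (Submodule.subset_span ?_)
        exact ⟨x * a', I.mul_mem_right' a' hx, b * b', tmul_mul_tmul _ _ _ _⟩
      exact h2 (Submodule.mem_top (x := a))
    exact key ht
  star_mem' {t} ht := by
    set S := Submodule.span ℂ {t : CStarTensor A B | ∃ x ∈ I, ∃ b : B, t = tmul x b} with hS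
    have key : ∀ s ∈ S, star s ∈ S := by
      intro s hs
      induction hs using Submodule.span_induction with
      | mem s hs =>
        obtain ⟨x, hx, b, rfl⟩ := hs
        exact Submodule.subset_span ⟨star x, I.star_mem' hx, star b, star_tmul x b⟩
      | zero => rw [star_zero]; exact Submodule.zero_mem _
      | add x y _ _ hx hy => rw [star_add]; exact Submodule.add_mem _ hx hy
      | smul c x _ hx => rw [star_smul]; exact Submodule.smul_mem _ _ hx
    exact map_mem_closure continuous_star ht key
  isClosed' := Submodule.isClosed_topologicalClosure _

end Tensor

/-! ### Cantor–Bendixson sequences -/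

/-- `(I α)_{α ≤ ht}` is the Cantor–Bendixson sequence of `A`, and `ht` its Cantor–Bendixson height:
a strictly increasing continuous sequence of closed ideals from `0` to `A` with
`𝓘ᴬᵗ(A / I α) = {[a] : a ∈ I (α + 1)}` for all `α < ht`. (Only the values `I α` with `α ≤ ht`
matter.) -/
structure IsCantorBendixsonSequence (A : Type u) [NonUnitalCStarAlgebra A] (ht : Ordinal.{u})
    (I : Ordinal.{u} → ClosedIdeal A) : Prop where
  zero : (I 0 : Set A) = {0}
  height : (I ht : Set A) = Set.univ
  strictMono : ∀ α β, α < β → β ≤ ht → (I α : Set A) ⊂ (I β : Set A)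
  limit : ∀ β ≤ ht, Order.IsSuccLimit β → (I β : Set A) = closure (⋃ α < β, (I α : Set A))
  succ : ∀ α < ht,
    (atomicPart (I α).Quotient : Set (I α).Quotient) = (I α).proj '' (I (α + 1) : Set A)

end ScatteredCStar

open ScatteredCStar

/-!
A C⋆-algebra is scattered if and only if none of its self-adjoint elements has the whole interval
`[0, 1]` in its spectrum, and this property visibly passes to quotients. One direction is a
construction: if `A ≠ 0` has no minimal projection, then (unless some spectrum already contains an
interval) every nonzero projection splits, and repeated dyadic splittings add up to a self-adjoint
element with `[0, 1]` in its spectrum. Hence nonzero quotients of a scattered algebra have minimal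
projections, and the Cantor–Bendixson sequence is obtained by transfinite iteration of the derived
ideal. For the converse, the corners `x A y` by finite sums of minimal projections are finite
dimensional, so that no element of the atomic ideal has `[0, 1]` in its spectrum; climbing the
sequence, an algebra with a Cantor–Bendixson sequence is scattered.

Matrix units `e i j` of `𝓚(H)` make `a ↦ a ⊗ e i₀ i₀` an isomorphism of `A` onto a full corner of
`A ⊗ 𝓚(H)`. (It is isometric because compressing to finite matrices over `A` gives, in the limit, a
C⋆-seminorm on the algebraic tensor product which dominates `‖a‖` at `a ⊗ e i j`.) Therefore
`I ↦ I ⊗ 𝓚(H)` is an isomorphism between the lattices of closed ideals. It commutes with quotients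
and with the atomic ideal, hence with the Cantor–Bendixson derivative.
-/

namespace ScatteredCStar

/-! ### Minimal projections and the atomic ideal -/

section MinimalProjection

variable {A : Type u} [NonUnitalCStarAlgebra A] {B : Type v} [NonUnitalCStarAlgebra B]

namespace IsMinimalProjection

variable {p x : A}

lemma mul_self (hp : IsMinimalProjection p) : p * p = p := hp.isStarProjection.isIdempotentElem

lemma star_eq (hp : IsMinimalProjection p) : star p = p := hp.isStarProjection.isSelfAdjoint

lemma exists_mul_mul_eq_smul (hp : IsMinimalProjection p) (a : A) :
    ∃ c : ℂ, p * a * p = c • p := by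
  have hmem : p * a * p ∈ Set.range fun c : ℂ => c • p := hp.corner_eq ▸ ⟨a, rfl⟩
  obtain ⟨c, hc⟩ := hmem
  exact ⟨c, hc.symm⟩

lemma of_exists_smul (hp : IsStarProjection p) (hp₀ : p ≠ 0)
    (h : ∀ a : A, ∃ c : ℂ, p * a * p = c • p) : IsMinimalProjection p where
  isStarProjection := hp
  ne_zero := hp₀
  corner_eq := by
    refine Set.Subset.antisymm ?_ ?_
    · rintro _ ⟨a, rfl⟩
      obtain ⟨c, hc⟩ := h a
      exact ⟨c, hc.symm⟩
    · rintro _ ⟨c, rfl⟩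
      exact ⟨c • p, by simp only [mul_smul_comm, smul_mul_assoc, hp.isIdempotentElem.eq]⟩

lemma smul_injective (hp : IsMinimalProjection p) : Function.Injective fun c : ℂ => c • p :=
  smul_left_injective ℂ hp.ne_zero

lemma mul_star_eq (hp : IsMinimalProjection p) (hx : x * p = x) : p * star x = star x := by
  rw [← hp.star_eq, ← star_mul, hx]

lemma exists_eq_smul (hp : IsMinimalProjection p) {y : A} (hl : p * y = y) (hr : y * p = y) :
    ∃ c : ℂ, y = c • p := by
  obtain ⟨c, hc⟩ := hp.exists_mul_mul_eq_smul y
  exact ⟨c, by rw [← hc, hl, hr]⟩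

lemma exists_star_mul_mul_eq_smul (hp : IsMinimalProjection p) (hx : x * p = x) (b : A) :
    ∃ c : ℂ, star x * b * x = c • p :=
  hp.exists_eq_smul (by rw [← mul_assoc, ← mul_assoc, hp.mul_star_eq hx]) (by rw [mul_assoc, hx])

lemma exists_star_mul_self_eq_smul (hp : IsMinimalProjection p) (hx : x * p = x) (hx₀ : x ≠ 0) :
    ∃ c : ℂ, c ≠ 0 ∧ star c = c ∧ star x * x = c • p := by
  obtain ⟨c, hc⟩ := hp.exists_eq_smul (y := star x * x)
    (by rw [← mul_assoc, hp.mul_star_eq hx]) (by rw [mul_assoc, hx])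
  refine ⟨c, ?_, hp.smul_injective ?_, hc⟩
  · rintro rfl
    rw [zero_smul] at hc
    exact hx₀ ((CStarRing.star_mul_self_eq_zero_iff x).mp hc)
  · calc star c • p = star (c • p) := by rw [star_smul, hp.star_eq]
      _ = c • p := by rw [← hc, star_mul, star_star]

/-- Up to a scalar, `x` is a partial isometry with source projection `p`, so its range projection is
equivalent to `p`. -/
lemma exists_mul_star_self_eq_smul (hp : IsMinimalProjection p) (hx : x * p = x) (hx₀ : x ≠ 0) :
    ∃ (c : ℂ) (q : A), c ≠ 0 ∧ IsMinimalProjection q ∧ x * star x = c • q := by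
  obtain ⟨c, hc₀, hc_star, hc⟩ := hp.exists_star_mul_self_eq_smul hx hx₀
  have hmul (a : A) (d : ℂ) (h : star x * a * x = d • p) :
      x * star x * a * (x * star x) = d • (x * star x) := by
    calc x * star x * a * (x * star x) = x * (star x * a * x) * star x := by noncomm_ring
      _ = d • (x * star x) := by rw [h, mul_smul_comm, smul_mul_assoc, hx]
  have hsq : x * star x * (x * star x) = c • (x * star x) := by
    rw [mul_assoc, ← mul_assoc (star x), hc, smul_mul_assoc, mul_smul_comm, hp.mul_star_eq hx]
  have hxx₀ : x * star x ≠ 0 := mt (CStarRing.mul_star_self_eq_zero_iff x).mp hx₀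
  refine ⟨c, c⁻¹ • (x * star x), hc₀, of_exists_smul ⟨?_, ?_⟩ ?_ fun a => ?_, ?_⟩
  · rw [IsIdempotentElem, smul_mul_smul_comm, hsq, smul_smul, mul_assoc, inv_mul_cancel₀ hc₀,
      mul_one]
  · rw [IsSelfAdjoint, star_smul, star_mul, star_star, star_inv₀, hc_star]
  · exact smul_ne_zero (inv_ne_zero hc₀) hxx₀
  · obtain ⟨d, hd⟩ := hp.exists_star_mul_mul_eq_smul hx a
    refine ⟨c⁻¹ * d, ?_⟩
    rw [smul_mul_assoc, smul_mul_smul_comm, hmul a d hd, smul_smul, smul_smul]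
    ring_nf
  · rw [smul_inv_smul₀ hc₀]

lemma map (hp : IsMinimalProjection p) (e : A ≃⋆ₐ[ℂ] B) : IsMinimalProjection (e p) := by
  refine of_exists_smul ⟨?_, ?_⟩ ((map_ne_zero_iff e e.injective).mpr hp.ne_zero) fun b => ?_
  · rw [IsIdempotentElem, ← map_mul, hp.mul_self]
  · rw [IsSelfAdjoint, ← map_star, hp.star_eq]
  · obtain ⟨a, rfl⟩ := EquivLike.surjective e b
    obtain ⟨c, hc⟩ := hp.exists_mul_mul_eq_smul a
    exact ⟨c, by rw [← map_mul, ← map_mul, hc, map_smul]⟩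

end IsMinimalProjection

variable (A) in
/-- The linear span of the minimal projections. It is an algebraic two-sided ideal whose closure is
the atomic part. -/
def atomSpan : Submodule ℂ A := Submodule.span ℂ {p : A | IsMinimalProjection p}

lemma IsMinimalProjection.mul_star_self_mem_atomSpan {p x : A} (hp : IsMinimalProjection p)
    (hx : x * p = x) : x * star x ∈ atomSpan A := by
  by_cases hx₀ : x = 0
  · rw [hx₀, zero_mul]
    exact zero_mem _
  · obtain ⟨c, q, -, hq, h⟩ := hp.exists_mul_star_self_eq_smul hx hx₀
    exact h ▸ Submodule.smul_mem _ _ (Submodule.subset_span hq)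

open Complex in
lemma mul_star_polarization (x y : A) :
    ∑ k ∈ Finset.range 4, I ^ k • ((x + I ^ k • y) * star (x + I ^ k • y)) =
      (4 : ℂ) • (x * star y) := by
  simp only [Finset.sum_range_succ, Finset.sum_range_zero, star_add, star_smul, star_pow, mul_add,
    add_mul, smul_add, smul_mul_assoc, mul_smul_comm, star_def, conj_I, pow_zero, pow_one, I_sq,
    I_pow_three]
  match_scalars <;> norm_num [mul_assoc, Odd.neg_pow (by decide : Odd 3)]

lemma IsMinimalProjection.mul_mem_atomSpan {p : A} (hp : IsMinimalProjection p) (a : A) :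
    a * p ∈ atomSpan A := by
  have hsquare (c : ℂ) : (a * p + c • p) * star (a * p + c • p) ∈ atomSpan A :=
    hp.mul_star_self_mem_atomSpan (by rw [add_mul, mul_assoc, smul_mul_assoc, hp.mul_self])
  have hsum := sum_mem fun k (_ : k ∈ Finset.range 4) =>
    Submodule.smul_mem _ (Complex.I ^ k) (hsquare (Complex.I ^ k))
  rw [mul_star_polarization, hp.star_eq, mul_assoc, hp.mul_self] at hsum
  exact (Submodule.smul_mem_iff _ (by norm_num)).mp hsum

lemma mul_mem_atomSpan (a : A) {x : A} (hx : x ∈ atomSpan A) : a * x ∈ atomSpan A :=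
  (Submodule.span_le (p := (atomSpan A).comap (LinearMap.mulLeft ℂ a))).mpr
    (fun _ hp => hp.mul_mem_atomSpan a) hx

lemma star_mem_atomSpan {x : A} (hx : x ∈ atomSpan A) : star x ∈ atomSpan A := by
  induction hx using Submodule.span_induction with
  | mem p hp => exact hp.star_eq.symm ▸ Submodule.subset_span hp
  | zero => exact (star_zero A).symm ▸ zero_mem _
  | add x y _ _ hx hy => exact star_add x y ▸ add_mem hx hy
  | smul c x _ hx => exact star_smul c x ▸ Submodule.smul_mem _ _ hx

lemma mem_atomSpan_mul {x : A} (hx : x ∈ atomSpan A) (a : A) : x * a ∈ atomSpan A := by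
  simpa only [star_mul, star_star] using
    star_mem_atomSpan (mul_mem_atomSpan (star a) (star_mem_atomSpan hx))

variable (A) in
/-- The atomic part `𝓘ᴬᵗ(A)` as a closed ideal. It is defined as the closed linear span of the
minimal projections; `coe_atomicPart` identifies it with the C⋆-subalgebra they generate. -/
def atomicIdeal : ClosedIdeal A where
  toSubmodule := (atomSpan A).topologicalClosure
  mul_mem_left' a _ hx :=
    map_mem_closure (continuous_const_mul a) hx fun _ h => mul_mem_atomSpan a h
  mul_mem_right' a _ hx :=
    map_mem_closure (f := (· * a)) (continuous_mul_const a) hx fun _ h => mem_atomSpan_mul h a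
  star_mem' hx := map_mem_closure continuous_star hx fun _ h => star_mem_atomSpan h
  isClosed' := Submodule.isClosed_topologicalClosure _

lemma coe_atomicIdeal : (atomicIdeal A : Set A) = closure (atomSpan A : Set A) := rfl

lemma coe_adjoin_isMinimalProjection :
    (NonUnitalStarAlgebra.adjoin ℂ {p : A | IsMinimalProjection p} : Set A) = atomSpan A := by
  refine Set.Subset.antisymm ?_ ?_
  · let S : NonUnitalStarSubalgebra ℂ A :=
      { atomSpan A with
        mul_mem' := fun {a _} _ hb => mul_mem_atomSpan a hb
        star_mem' := star_mem_atomSpan }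
    exact NonUnitalStarAlgebra.adjoin_le (S := S) fun p hp => Submodule.subset_span hp
  · exact (Submodule.span_le (p := (NonUnitalStarAlgebra.adjoin ℂ
      {p : A | IsMinimalProjection p}).toNonUnitalSubalgebra.toSubmodule)).mpr
        (NonUnitalStarAlgebra.subset_adjoin ℂ _)

lemma coe_atomicPart : (atomicPart A : Set A) = atomicIdeal A := by
  rw [coe_atomicIdeal, ← coe_adjoin_isMinimalProjection]
  rfl

lemma mem_atomicPart {x : A} : x ∈ atomicPart A ↔ x ∈ atomicIdeal A := by
  rw [← SetLike.mem_coe, coe_atomicPart, SetLike.mem_coe]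

lemma IsMinimalProjection.mem_atomicIdeal {p : A} (hp : IsMinimalProjection p) :
    p ∈ atomicIdeal A := subset_closure (Submodule.subset_span hp)

lemma atomicPart_ne_bot_iff : atomicPart A ≠ ⊥ ↔ ∃ p : A, IsMinimalProjection p := by
  refine ⟨fun h => ?_, fun ⟨p, hp⟩ h => ?_⟩
  · by_contra! hne
    refine h (SetLike.coe_injective ?_)
    have hempty : {p : A | IsMinimalProjection p} = ∅ := Set.eq_empty_of_forall_notMem hne
    rw [coe_atomicPart, coe_atomicIdeal, atomSpan, hempty, Submodule.span_empty,
      Submodule.bot_coe, closure_singleton, NonUnitalStarAlgebra.coe_bot]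
  · have hmem := mem_atomicPart.mpr hp.mem_atomicIdeal
    rw [h] at hmem
    exact hp.ne_zero (NonUnitalStarAlgebra.mem_bot.mp hmem)

lemma map_mem_atomicIdeal (e : A ≃⋆ₐ[ℂ] B) {x : A} (hx : x ∈ atomicIdeal A) :
    e x ∈ atomicIdeal B := by
  have he : Continuous e := (NonUnitalStarAlgHom.isometry e e.injective).continuous
  have hspan : atomSpan A ≤ (atomSpan B).comap (e : A →ₗ[ℂ] B) :=
    Submodule.span_le.mpr fun p hp => Submodule.subset_span (hp.map e)
  exact map_mem_closure he hx fun y hy => hspan hy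

lemma map_mem_atomicIdeal_iff (e : A ≃⋆ₐ[ℂ] B) {x : A} :
    e x ∈ atomicIdeal B ↔ x ∈ atomicIdeal A :=
  ⟨fun h => by simpa only [StarAlgEquiv.symm_apply_apply] using map_mem_atomicIdeal e.symm h,
    map_mem_atomicIdeal e⟩

end MinimalProjection

/-! ### Spectra containing an interval -/

section Spectrum

open scoped CStarAlgebra

/-- No self-adjoint element has the unit interval in its spectrum. This property characterizes the
scattered algebras and, unlike the definition of the latter, visibly passes to quotients. -/
def NoIntervalSpectrum (A : Type u) [NonUnitalCStarAlgebra A] : Prop :=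
  ∀ b : A, IsSelfAdjoint b → ¬ Set.Icc (0 : ℝ) 1 ⊆ quasispectrum ℝ b

variable {A : Type u} [NonUnitalCStarAlgebra A] {B : Type v} [NonUnitalCStarAlgebra B]

lemma map_cfcₙ_real (φ : A →⋆ₙₐ[ℂ] B) (f : ℝ → ℝ) {a : A} (ha : IsSelfAdjoint a)
    (hf : ContinuousOn f (quasispectrum ℝ a)) (hf₀ : f 0 = 0) : φ (cfcₙ f a) = cfcₙ f (φ a) :=
  NonUnitalStarAlgHom.map_cfcₙ φ f a hf hf₀ (map_continuous φ) ha (ha.map φ)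

lemma quasispectrum_subset_of_injective (φ : A →⋆ₙₐ[ℂ] B) (hφ : Function.Injective φ) {a : A}
    (ha : IsSelfAdjoint a) : quasispectrum ℝ a ⊆ quasispectrum ℝ (φ a) := by
  intro t ht
  by_contra ht'
  have hclosed : IsClosed (quasispectrum ℝ (φ a)) :=
    (NonUnitalContinuousFunctionalCalculus.isCompact_quasispectrum (R := ℝ) (p := IsSelfAdjoint)
      (φ a)).isClosed
  obtain ⟨f, hf_zero, hf_one, -⟩ := exists_continuous_zero_one_of_isClosed hclosed
    (isClosed_singleton (x := t)) (Set.disjoint_singleton_right.mpr ht')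
  have hf₀ : f 0 = 0 := hf_zero (quasispectrum.zero_mem ℝ (φ a))
  have hfa : cfcₙ f a = 0 := by
    rw [← map_eq_zero_iff φ hφ, map_cfcₙ_real φ f ha f.continuous.continuousOn hf₀,
      cfcₙ_congr (g := fun _ => 0) fun x hx => hf_zero hx, cfcₙ_const_zero]
  have hle := norm_apply_le_norm_cfcₙ (f : ℝ → ℝ) a ht f.continuous.continuousOn hf₀ ha
  rw [hfa, hf_one (Set.mem_singleton t), norm_zero, Pi.one_apply, norm_one] at hle
  exact zero_lt_one.not_ge hle

lemma exists_isSelfAdjoint_map_eq (φ : A →⋆ₙₐ[ℂ] B) (hφ : Function.Surjective φ) {b : B}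
    (hb : IsSelfAdjoint b) : ∃ a : A, IsSelfAdjoint a ∧ φ a = b := by
  obtain ⟨a, rfl⟩ := hφ b
  exact ⟨realPart a, (realPart a).2, by rw [map_realPart, hb.coe_realPart]⟩

lemma NoIntervalSpectrum.of_surjective (hA : NoIntervalSpectrum A) (φ : A →⋆ₙₐ[ℂ] B)
    (hφ : Function.Surjective φ) : NoIntervalSpectrum B := by
  intro b hb h
  obtain ⟨a, ha, rfl⟩ := exists_isSelfAdjoint_map_eq φ hφ hb
  exact hA a ha (h.trans (NonUnitalAlgHom.quasispectrum_apply_subset' (R := ℝ) ℂ φ a))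

lemma exists_quasispectrum_eq_Icc_zero_one {b : A} (hb : IsSelfAdjoint b) {s t : ℝ} (hs : 0 ≤ s)
    (hst : s < t) (h : Set.Icc s t ⊆ quasispectrum ℝ b) :
    ∃ c : A, IsSelfAdjoint c ∧ quasispectrum ℝ c = Set.Icc 0 1 := by
  have hts : 0 < t - s := sub_pos.mpr hst
  let clamp : ℝ → ℝ := fun x => max 0 (min 1 ((x - s) / (t - s)))
  have clamp_zero : clamp 0 = 0 :=
    max_eq_left (min_le_of_right_le (div_nonpos_of_nonpos_of_nonneg (by linarith) hts.le))
  refine ⟨cfcₙ clamp b, cfcₙ_predicate _ b, ?_⟩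
  rw [cfcₙ_map_quasispectrum clamp b (by fun_prop) clamp_zero hb]
  refine Set.Subset.antisymm ?_ ?_
  · rintro _ ⟨x, -, rfl⟩
    exact ⟨le_max_left _ _, max_le zero_le_one (min_le_left _ _)⟩
  · rintro r ⟨hr₀, hr₁⟩
    refine ⟨s + r * (t - s), h ⟨by nlinarith, by nlinarith⟩, ?_⟩
    simp only [clamp]
    rw [add_sub_cancel_left, mul_div_cancel_right₀ r hts.ne', min_eq_right hr₁, max_eq_right hr₀]

lemma NoIntervalSpectrum.not_Icc_subset (hA : NoIntervalSpectrum A) {b : A} (hb : IsSelfAdjoint b)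
    {s t : ℝ} (hs : 0 ≤ s) (hst : s < t) : ¬ Set.Icc s t ⊆ quasispectrum ℝ b := by
  intro h
  obtain ⟨c, hc, hcσ⟩ := exists_quasispectrum_eq_Icc_zero_one hb hs hst h
  exact hA c hc hcσ.superset

lemma eq_zero_of_isIdempotentElem_of_mem_elemental {c p : A} (hc : IsStarNormal c)
    (hσ : IsPreconnected (quasispectrum ℂ c)) (hp : IsIdempotentElem p)
    (hmem : p ∈ NonUnitalStarAlgebra.elemental ℂ c) : p = 0 := by
  by_contra hp₀
  rw [← SetLike.mem_coe, ← range_cfcₙ ℂ hc] at hmem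
  obtain ⟨f, rfl⟩ := hmem
  have hf : ContinuousOn f (quasispectrum ℂ c) := by
    by_contra h
    exact hp₀ (cfcₙ_apply_of_not_continuousOn c h)
  have hf₀ : f 0 = 0 := by
    by_contra h
    exact hp₀ (cfcₙ_apply_of_not_map_zero c h)
  have hmaps : Set.MapsTo f (quasispectrum ℂ c) {0, 1} := by
    have hfσ := cfcₙ_map_quasispectrum f c hf hf₀ hc
    exact fun x hx => hp.quasispectrum_subset ℂ (hfσ ▸ Set.mem_image_of_mem f hx)
  refine hp₀ ((cfcₙ_congr fun x hx => ?_).trans (cfcₙ_const_zero ℂ c))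
  rw [hσ.constant_of_mapsTo (Set.toFinite _).isDiscrete hf hmaps hx (quasispectrum.zero_mem ℂ c),
    hf₀]

lemma IsScattered.noIntervalSpectrum (hA : IsScattered A) : NoIntervalSpectrum A := by
  intro b hb h
  obtain ⟨c, hc, hcσ⟩ := exists_quasispectrum_eq_Icc_zero_one hb le_rfl zero_lt_one h
  have hc₀ : c ≠ 0 := by
    rintro rfl
    have h₁ : (1 : ℝ) ∈ quasispectrum ℝ (0 : A) := hcσ ▸ ⟨zero_le_one, le_rfl⟩
    rw [CFC.quasispectrum_zero_eq] at h₁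
    exact one_ne_zero h₁
  have hconn : IsPreconnected (quasispectrum ℂ c) := by
    rw [← hc.quasispectrumRestricts.algebraMap_image, hcσ]
    exact isPreconnected_Icc.image _ Complex.continuous_ofReal.continuousOn
  have : IsClosed (NonUnitalStarAlgebra.elemental ℂ c : Set A) :=
    NonUnitalStarAlgebra.elemental.isClosed ℂ c
  have hne : NonUnitalStarAlgebra.elemental ℂ c ≠ ⊥ := fun h₀ =>
    hc₀ (NonUnitalStarAlgebra.mem_bot.mp (h₀ ▸ NonUnitalStarAlgebra.elemental.self_mem ℂ c))
  obtain ⟨p, hp⟩ := atomicPart_ne_bot_iff.mp (hA _ hne)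
  exact hp.ne_zero (Subtype.ext (eq_zero_of_isIdempotentElem_of_mem_elemental hc.isStarNormal hconn
    (congrArg Subtype.val hp.mul_self) p.2))

end Spectrum

/-! ### Existence of minimal projections -/

section SpectralProjection

variable {A : Type u} [NonUnitalCStarAlgebra A]

lemma continuousOn_indicator_Ioi {r : ℝ} {s : Set ℝ} (hr : r ∉ s) {g : ℝ → ℝ}
    (hg : ContinuousOn g (Set.Ioi r)) : ContinuousOn ((Set.Ioi r).indicator g) s := by
  intro x hx
  refine ContinuousAt.continuousWithinAt ?_
  rcases lt_or_gt_of_ne (ne_of_mem_of_not_mem hx hr) with hxr | hxr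
  · refine (continuousAt_const (y := (0 : ℝ))).congr ?_
    filter_upwards [Iio_mem_nhds hxr] with z hz
    exact (Set.indicator_of_notMem (Set.notMem_Ioi.mpr (le_of_lt hz)) g).symm
  · refine (hg.continuousAt (Ioi_mem_nhds hxr)).congr ?_
    filter_upwards [Ioi_mem_nhds hxr] with z hz
    exact (Set.indicator_of_mem hz g).symm

/-- The spectral projection of `y` for the part of its spectrum above `r`. The functional calculus
assigns to it the junk value `0` unless `r` lies in a gap of the spectrum. -/
noncomputable def spectralProjection (y : A) (r : ℝ) : A := cfcₙ ((Set.Ioi r).indicator 1) y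

variable {y : A} {r : ℝ}

lemma isStarProjection_spectralProjection (hr : r ∉ quasispectrum ℝ y) (hr₀ : 0 < r) :
    IsStarProjection (spectralProjection y r) := by
  have hχ := continuousOn_indicator_Ioi hr (g := 1) continuousOn_const
  have hχ₀ : (Set.Ioi r).indicator (1 : ℝ → ℝ) 0 = 0 :=
    Set.indicator_of_notMem (Set.notMem_Ioi.mpr hr₀.le) _
  refine ⟨?_, cfcₙ_predicate _ y⟩
  rw [IsIdempotentElem, spectralProjection, ← cfcₙ_mul _ _ y hχ hχ₀ hχ hχ₀]
  refine cfcₙ_congr fun x _ => ?_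
  by_cases hx : x ∈ Set.Ioi r <;> simp [hx]

lemma spectralProjection_ne_zero (hy : IsSelfAdjoint y) (hr : r ∉ quasispectrum ℝ y)
    (hr₀ : 0 < r) {x : ℝ} (hx : x ∈ quasispectrum ℝ y) (hrx : r < x) :
    spectralProjection y r ≠ 0 := by
  intro h
  have hle := norm_apply_le_norm_cfcₙ ((Set.Ioi r).indicator 1) y hx
    (continuousOn_indicator_Ioi hr continuousOn_const)
    (Set.indicator_of_notMem (Set.notMem_Ioi.mpr hr₀.le) _) hy
  rw [← spectralProjection, h, norm_zero, Set.indicator_of_mem (Set.mem_Ioi.mpr hrx),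
    Pi.one_apply, norm_one] at hle
  exact zero_lt_one.not_ge hle

lemma exists_mul_eq_spectralProjection (hy : IsSelfAdjoint y) (hr : r ∉ quasispectrum ℝ y)
    (hr₀ : 0 < r) : ∃ z, y * z = spectralProjection y r := by
  have hinv := continuousOn_indicator_Ioi hr (g := fun x => x⁻¹)
    (continuousOn_inv₀.mono fun x hx => (hr₀.trans hx).ne')
  have hmul := cfcₙ_mul (fun x => x) _ y continuousOn_id rfl hinv (by simp)
  rw [cfcₙ_id' ℝ y hy] at hmul
  refine ⟨_, hmul.symm.trans (cfcₙ_congr fun x _ => ?_)⟩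
  by_cases hx : x ∈ Set.Ioi r
  · rw [Set.indicator_of_mem hx, Set.indicator_of_mem hx, mul_inv_cancel₀ (hr₀.trans hx).ne',
      Pi.one_apply]
  · rw [Set.indicator_of_notMem hx, Set.indicator_of_notMem hx, mul_zero]

lemma norm_mul_spectralProjection_sub_le (hy : IsSelfAdjoint y) (hr : r ∉ quasispectrum ℝ y)
    (hr₀ : 0 < r) (hry : r ≤ ‖y‖) :
    ‖y * spectralProjection y r - ‖y‖ • spectralProjection y r‖ ≤ ‖y‖ - r := by
  set χ : ℝ → ℝ := (Set.Ioi r).indicator 1 with hχ_def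
  have hχ : ContinuousOn χ (quasispectrum ℝ y) := continuousOn_indicator_Ioi hr continuousOn_const
  have hχ₀ : χ 0 = 0 := Set.indicator_of_notMem (Set.notMem_Ioi.mpr hr₀.le) _
  have hcfc : cfcₙ (fun x => x * χ x - ‖y‖ * χ x) y =
      y * spectralProjection y r - ‖y‖ • spectralProjection y r := by
    rw [cfcₙ_sub (fun x => x * χ x) (fun x => ‖y‖ * χ x) y (continuousOn_id.mul hχ) (zero_mul _)
      (continuousOn_const.mul hχ) (by rw [hχ₀, mul_zero]), cfcₙ_const_mul _ χ y hχ hχ₀,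
      cfcₙ_mul (fun x => x) χ y continuousOn_id rfl hχ hχ₀, cfcₙ_id' ℝ y hy, spectralProjection]
  rw [← hcfc]
  refine norm_cfcₙ_le fun x hx => ?_
  by_cases hxr : x ∈ Set.Ioi r
  · have hxy : |x| ≤ ‖y‖ := by
      simpa only [cfcₙ_id' ℝ y hy, Real.norm_eq_abs] using
        norm_apply_le_norm_cfcₙ (fun x : ℝ => x) y hx continuousOn_id rfl hy
    rw [hχ_def, Set.indicator_of_mem hxr, Pi.one_apply, mul_one, mul_one, Real.norm_eq_abs,
      abs_sub_comm, abs_of_nonneg (sub_nonneg.mpr ((le_abs_self x).trans hxy))]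
    exact sub_le_sub_left (le_of_lt hxr) _
  · rw [hχ_def, Set.indicator_of_notMem hxr, mul_zero, mul_zero, sub_zero, norm_zero]
    exact sub_nonneg.mpr hry

end SpectralProjection

section Projections

variable {A : Type u} [NonUnitalCStarAlgebra A]

lemma norm_eq_one_of_isStarProjection {p : A} (hp : IsStarProjection p) (hp₀ : p ≠ 0) :
    ‖p‖ = 1 := by
  have hsq := CStarRing.norm_star_mul_self (x := p)
  rw [hp.isSelfAdjoint.star_eq, hp.isIdempotentElem.eq] at hsq
  exact (mul_eq_left₀ (norm_ne_zero_iff.mpr hp₀)).mp hsq.symm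

section Order

variable [PartialOrder A] [StarOrderedRing A]

lemma norm_mem_quasispectrum {y : A} (hy : 0 ≤ y) : ‖y‖ ∈ quasispectrum ℝ y := by
  rw [Unitization.quasispectrum_eq_spectrum_inr' ℝ ℂ, ← Unitization.norm_inr (𝕜 := ℂ) y]
  exact CStarAlgebra.norm_mem_spectrum_of_nonneg (Unitization.inr_nonneg_iff.mpr hy)

lemma NoIntervalSpectrum.exists_notMem_quasispectrum (hA : NoIntervalSpectrum A) {y : A}
    (hy : 0 ≤ y) (hy₀ : y ≠ 0) {ε : ℝ} (hε : 0 < ε) :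
    ∃ r, r ∉ quasispectrum ℝ y ∧ 0 < r ∧ r < ‖y‖ ∧ ‖y‖ - r ≤ ε := by
  have hlt : max 0 (‖y‖ - ε) < ‖y‖ := max_lt (norm_pos_iff.mpr hy₀) (sub_lt_self _ hε)
  obtain ⟨s, hs, hsy⟩ := exists_between hlt
  obtain ⟨hs₀, hsε⟩ := max_lt_iff.mp hs
  obtain ⟨r, hr, hrσ⟩ := Set.not_subset.mp (hA.not_Icc_subset (.of_nonneg hy) hs₀.le hsy)
  have hry : r ≠ ‖y‖ := fun h => hrσ (h ▸ norm_mem_quasispectrum hy)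
  exact ⟨r, hrσ, hs₀.trans_le hr.1, hr.2.lt_of_ne hry, by linarith [hr.1]⟩

lemma NoIntervalSpectrum.exists_isStarProjection (hA : NoIntervalSpectrum A) {y : A}
    (hy : 0 ≤ y) (hy₀ : y ≠ 0) {ε : ℝ} (hε : 0 < ε) :
    ∃ q : A, IsStarProjection q ∧ q ≠ 0 ∧ (∃ z, y * z = q) ∧ ‖y * q - ‖y‖ • q‖ ≤ ε := by
  obtain ⟨r, hr, hr₀, hry, hrε⟩ := hA.exists_notMem_quasispectrum hy hy₀ hε
  have hys : IsSelfAdjoint y := .of_nonneg hy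
  exact ⟨spectralProjection y r, isStarProjection_spectralProjection hr hr₀,
    spectralProjection_ne_zero hys hr hr₀ (norm_mem_quasispectrum hy) hry,
    exists_mul_eq_spectralProjection hys hr hr₀,
    (norm_mul_spectralProjection_sub_le hys hr hr₀ hry.le).trans hrε⟩

lemma NoIntervalSpectrum.eq_norm_smul (hA : NoIntervalSpectrum A) {p : A}
    (h : ∀ q : A, IsStarProjection q → q ≠ 0 → p * q = q → q = p) {y : A} (hy : 0 ≤ y)
    (hl : p * y = y) (hr : y * p = y) : y = ‖y‖ • p := by
  rcases eq_or_ne y 0 with rfl | hy₀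
  · rw [norm_zero, zero_smul]
  refine eq_of_sub_eq_zero (norm_le_zero_iff.mp (le_of_forall_pos_le_add fun ε hε => ?_))
  obtain ⟨q, hq, hq₀, ⟨z, hz⟩, hqε⟩ := hA.exists_isStarProjection hy hy₀ hε
  have hqp : q = p := h q hq hq₀ (by rw [← hz, ← mul_assoc, hl])
  rwa [hqp, hr, ← zero_add ε] at hqε

end Order

lemma NoIntervalSpectrum.isMinimalProjection (hA : NoIntervalSpectrum A) {p : A}
    (hp : IsStarProjection p) (hp₀ : p ≠ 0)
    (h : ∀ q : A, IsStarProjection q → q ≠ 0 → p * q = q → q = p) : IsMinimalProjection p := by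
  let _ := CStarAlgebra.spectralOrder A
  have _ := CStarAlgebra.spectralOrderedRing A
  have hpp : p * p = p := hp.isIdempotentElem
  refine IsMinimalProjection.of_exists_smul hp hp₀ fun a => ?_
  have ha : a ∈ Submodule.span ℂ {a : A | 0 ≤ a} :=
    CStarAlgebra.span_nonneg (A := A) ▸ Submodule.mem_top
  induction ha using Submodule.span_induction with
  | mem a ha =>
    have hpap : 0 ≤ p * a * p := by
      simpa only [hp.isSelfAdjoint.star_eq] using star_left_conjugate_nonneg ha p
    refine ⟨(‖p * a * p‖ : ℝ), ?_⟩
    rw [Complex.coe_smul]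
    exact hA.eq_norm_smul h hpap (by rw [← mul_assoc, ← mul_assoc, hpp]) (by rw [mul_assoc, hpp])
  | zero => exact ⟨0, by rw [mul_zero, zero_mul, zero_smul]⟩
  | add x y _ _ hx hy =>
    obtain ⟨c, hc⟩ := hx
    obtain ⟨d, hd⟩ := hy
    exact ⟨c + d, by rw [mul_add, add_mul, hc, hd, add_smul]⟩
  | smul c x _ hx =>
    obtain ⟨d, hd⟩ := hx
    exact ⟨c * d, by rw [mul_smul_comm, smul_mul_assoc, hd, smul_smul]⟩

lemma mem_quasispectrum_of_approx {x : A} {t : ℝ}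
    (h : ∀ ε > 0, ∃ q : A, ‖q‖ = 1 ∧ ‖x * q - t • q‖ ≤ ε) : t ∈ quasispectrum ℝ x := by
  rw [Unitization.quasispectrum_eq_spectrum_inr' ℝ ℂ, spectrum.mem_iff]
  rintro ⟨u, hu⟩
  set M := ‖(↑u⁻¹ : Unitization ℂ A)‖
  have hM₀ : 0 ≤ M := norm_nonneg _
  obtain ⟨q, hq, hqε⟩ := h (1 / (2 * (M + 1))) (by positivity)
  have huq : (u : Unitization ℂ A) * (q : Unitization ℂ A) =
      -((x * q - t • q : A) : Unitization ℂ A) := by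
    rw [hu, sub_mul, Algebra.algebraMap_eq_smul_one, smul_mul_assoc, one_mul,
      Unitization.inr_sub, Unitization.inr_mul, Unitization.inr_smul, neg_sub]
  have hq_eq : (q : Unitization ℂ A) = ↑u⁻¹ * -((x * q - t • q : A) : Unitization ℂ A) := by
    rw [← huq, ← mul_assoc, Units.inv_mul, one_mul]
  have hlt : 1 < (1 : ℝ) := calc
    1 = ‖(q : Unitization ℂ A)‖ := by rw [Unitization.norm_inr, hq]
    _ ≤ M * ‖x * q - t • q‖ := by
      rw [hq_eq, ← Unitization.norm_inr (𝕜 := ℂ) (x * q - t • q), ← norm_neg (Unitization.inr _)]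
      exact norm_mul_le _ _
    _ ≤ M * (1 / (2 * (M + 1))) := by gcongr
    _ < 1 := by
      rw [mul_one_div, div_lt_one (by positivity)]
      linarith
  exact lt_irrefl 1 hlt

end Projections

section Splitting

variable {A : Type u} [NonUnitalCStarAlgebra A]

/-- The `n`-th dyadic approximation of the element with spectrum `[0, 1]` that arises by halving the
projection `p` repeatedly into `L p` and `p - L p`: the value of the approximation on each of the
`2 ^ n` subprojections obtained is the corresponding dyadic number. -/
noncomputable def dyadicApprox (L : A → A) : ℕ → A → A
  | 0, _ => 0
  | n + 1, p => (2⁻¹ : ℝ) • (dyadicApprox L n (L p) + dyadicApprox L n (p - L p) + (p - L p))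

lemma dyadicApprox_succ (L : A → A) (n : ℕ) (p : A) : dyadicApprox L (n + 1) p =
    (2⁻¹ : ℝ) • (dyadicApprox L n (L p) + dyadicApprox L n (p - L p) + (p - L p)) := rfl

/-- The limit of the dyadic approximations `dyadicApprox L n p`. -/
noncomputable def dyadicLimit (L : A → A) (p : A) : A :=
  Filter.limUnder Filter.atTop fun n => dyadicApprox L n p

/-- `P` consists of nonzero projections, and `L` splits each `p ∈ P` into the two members `L p` and
`p - L p` of `P`. -/
structure IsSplitting (L : A → A) (P : Set A) : Prop where
  isStarProjection : ∀ p ∈ P, IsStarProjection p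
  ne_zero : ∀ p ∈ P, p ≠ 0
  left_mem : ∀ p ∈ P, L p ∈ P
  right_mem : ∀ p ∈ P, p - L p ∈ P

namespace IsSplitting

variable [PartialOrder A] [StarOrderedRing A] {L : A → A} {P : Set A} {p : A}

lemma nonneg (h : IsSplitting L P) (hp : p ∈ P) : 0 ≤ p := (h.isStarProjection p hp).nonneg

lemma left_le (h : IsSplitting L P) (hp : p ∈ P) : L p ≤ p :=
  sub_nonneg.mp (h.nonneg (h.right_mem p hp))

lemma mul_left (h : IsSplitting L P) (hp : p ∈ P) : p * L p = L p :=
  ((h.isStarProjection _ (h.left_mem p hp)).le_iff_mul_eq_right (h.isStarProjection p hp)).mp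
    (h.left_le hp)

lemma left_mul (h : IsSplitting L P) (hp : p ∈ P) : L p * p = L p :=
  ((h.isStarProjection _ (h.left_mem p hp)).le_iff_mul_eq_left (h.isStarProjection p hp)).mp
    (h.left_le hp)

lemma right_mul_left (h : IsSplitting L P) (hp : p ∈ P) : (p - L p) * L p = 0 := by
  rw [sub_mul, h.mul_left hp, (h.isStarProjection _ (h.left_mem p hp)).isIdempotentElem.eq,
    sub_self]

lemma left_mul_right (h : IsSplitting L P) (hp : p ∈ P) : L p * (p - L p) = 0 := by
  rw [mul_sub, h.left_mul hp, (h.isStarProjection _ (h.left_mem p hp)).isIdempotentElem.eq,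
    sub_self]

lemma dyadicApprox_mem_Icc (h : IsSplitting L P) (n : ℕ) (hp : p ∈ P) :
    dyadicApprox L n p ∈ Set.Icc 0 p := by
  induction n generalizing p with
  | zero => exact ⟨le_rfl, h.nonneg hp⟩
  | succ n ih =>
    have hl := ih (h.left_mem p hp)
    have hr := ih (h.right_mem p hp)
    refine ⟨smul_nonneg (by norm_num) (add_nonneg (add_nonneg hl.1 hr.1)
      (h.nonneg (h.right_mem p hp))), ?_⟩
    calc dyadicApprox L (n + 1) p ≤ (2⁻¹ : ℝ) • (L p + (p - L p) + p) :=
        smul_le_smul_of_nonneg_left (add_le_add (add_le_add hl.2 hr.2)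
          (sub_le_self p (h.nonneg (h.left_mem p hp)))) (by norm_num)
      _ = p := by rw [add_sub_cancel, ← two_smul ℝ p, inv_smul_smul₀ two_ne_zero]

lemma dyadicApprox_succ_sub_mem_Icc (h : IsSplitting L P) (n : ℕ) (hp : p ∈ P) :
    dyadicApprox L (n + 1) p - dyadicApprox L n p ∈ Set.Icc 0 ((2⁻¹ : ℝ) ^ n • p) := by
  induction n generalizing p with
  | zero =>
    simpa only [pow_zero, one_smul, sub_zero, dyadicApprox] using h.dyadicApprox_mem_Icc 1 hp
  | succ n ih =>
    have hl := ih (h.left_mem p hp)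
    have hr := ih (h.right_mem p hp)
    have hdiff : dyadicApprox L (n + 2) p - dyadicApprox L (n + 1) p = (2⁻¹ : ℝ) •
        ((dyadicApprox L (n + 1) (L p) - dyadicApprox L n (L p)) +
          (dyadicApprox L (n + 1) (p - L p) - dyadicApprox L n (p - L p))) := by
      rw [dyadicApprox_succ L _ p, dyadicApprox_succ L _ p, ← smul_sub, add_sub_add_right_eq_sub,
        add_sub_add_comm]
    have hbound : (2⁻¹ : ℝ) ^ (n + 1) • p = (2⁻¹ : ℝ) •
        ((2⁻¹ : ℝ) ^ n • L p + (2⁻¹ : ℝ) ^ n • (p - L p)) := by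
      rw [← smul_add, add_sub_cancel, smul_smul, ← pow_succ']
    rw [hdiff, hbound]
    exact ⟨smul_nonneg (by norm_num) (add_nonneg hl.1 hr.1),
      smul_le_smul_of_nonneg_left (add_le_add hl.2 hr.2) (by norm_num)⟩

lemma tendsto_dyadicLimit (h : IsSplitting L P) (hp : p ∈ P) :
    Filter.Tendsto (fun n => dyadicApprox L n p) Filter.atTop (nhds (dyadicLimit L p)) := by
  refine CauchySeq.tendsto_limUnder (cauchySeq_of_le_geometric 2⁻¹ 1 (by norm_num) fun n => ?_)
  have hmem := h.dyadicApprox_succ_sub_mem_Icc n hp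
  rw [dist_comm, dist_eq_norm, one_mul]
  refine (CStarAlgebra.norm_le_norm_of_nonneg_of_le hmem.1 hmem.2).trans_eq ?_
  rw [norm_smul, norm_eq_one_of_isStarProjection (h.isStarProjection p hp) (h.ne_zero p hp),
    mul_one, Real.norm_of_nonneg (by positivity)]

lemma dyadicLimit_mem_Icc (h : IsSplitting L P) (hp : p ∈ P) : dyadicLimit L p ∈ Set.Icc 0 p :=
  isClosed_Icc.mem_of_tendsto (h.tendsto_dyadicLimit hp)
    (Filter.Eventually.of_forall fun n => h.dyadicApprox_mem_Icc n hp)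

lemma dyadicLimit_mul (h : IsSplitting L P) (hp : p ∈ P) : dyadicLimit L p * p = dyadicLimit L p :=
  have hmem := h.dyadicLimit_mem_Icc hp
  ((h.isStarProjection p hp).mul_right_and_mul_left_of_nonneg_of_le hmem.1 hmem.2).1

lemma dyadicLimit_eq (h : IsSplitting L P) (hp : p ∈ P) :
    dyadicLimit L p = (2⁻¹ : ℝ) • (dyadicLimit L (L p) + dyadicLimit L (p - L p) + (p - L p)) :=
  tendsto_nhds_unique ((h.tendsto_dyadicLimit hp).comp (Filter.tendsto_add_atTop_nat 1))
    ((((h.tendsto_dyadicLimit (h.left_mem p hp)).add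
      (h.tendsto_dyadicLimit (h.right_mem p hp))).add_const _).const_smul _)

lemma dyadicLimit_mul_of_left_mul (h : IsSplitting L P) (hp : p ∈ P) {q : A} (hq : L p * q = q) :
    dyadicLimit L p * q = (2⁻¹ : ℝ) • (dyadicLimit L (L p) * q) := by
  have hrq : (p - L p) * q = 0 := by rw [← hq, ← mul_assoc, h.right_mul_left hp, zero_mul]
  rw [h.dyadicLimit_eq hp, smul_mul_assoc, add_mul, add_mul, hrq,
    ← h.dyadicLimit_mul (h.right_mem p hp), mul_assoc _ _ q, hrq, mul_zero, add_zero, add_zero]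

lemma dyadicLimit_mul_of_right_mul (h : IsSplitting L P) (hp : p ∈ P) {q : A}
    (hq : (p - L p) * q = q) :
    dyadicLimit L p * q = (2⁻¹ : ℝ) • (dyadicLimit L (p - L p) * q + q) := by
  have hlq : L p * q = 0 := by rw [← hq, ← mul_assoc, h.left_mul_right hp, zero_mul]
  rw [h.dyadicLimit_eq hp, smul_mul_assoc, add_mul, add_mul, hq,
    ← h.dyadicLimit_mul (h.left_mem p hp), mul_assoc _ _ q, hlq, mul_zero, zero_add]

/-- The subprojection `q` is found by following the binary expansion of `t`. -/
lemma exists_norm_dyadicLimit_mul_sub_le (h : IsSplitting L P) (n : ℕ) (hp : p ∈ P) {t : ℝ}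
    (ht : t ∈ Set.Icc (0 : ℝ) 1) :
    ∃ q ∈ P, p * q = q ∧ ‖dyadicLimit L p * q - t • q‖ ≤ 2 * (2⁻¹ : ℝ) ^ n := by
  have halve {n : ℕ} (x : A) (hx : ‖x‖ ≤ 2 * (2⁻¹ : ℝ) ^ n) :
      ‖(2⁻¹ : ℝ) • x‖ ≤ 2 * (2⁻¹ : ℝ) ^ (n + 1) := by
    rw [norm_smul, Real.norm_of_nonneg (by norm_num), pow_succ]
    linarith
  induction n generalizing p t with
  | zero =>
    have hnorm := norm_eq_one_of_isStarProjection (h.isStarProjection p hp) (h.ne_zero p hp)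
    have hmem := h.dyadicLimit_mem_Icc hp
    refine ⟨p, hp, (h.isStarProjection p hp).isIdempotentElem, ?_⟩
    rw [h.dyadicLimit_mul hp]
    refine (norm_sub_le _ _).trans ?_
    rw [norm_smul, hnorm, Real.norm_of_nonneg ht.1]
    linarith [ht.2, CStarAlgebra.norm_le_norm_of_nonneg_of_le hmem.1 hmem.2]
  | succ n ih =>
    rcases le_total t 2⁻¹ with ht' | ht'
    · obtain ⟨q, hq, hq_mul, hq_le⟩ := ih (h.left_mem p hp) (t := 2 * t)
        ⟨by linarith [ht.1], by linarith⟩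
      refine ⟨q, hq, by rw [← hq_mul, ← mul_assoc, h.mul_left hp], ?_⟩
      have hdiff : dyadicLimit L p * q - t • q =
          (2⁻¹ : ℝ) • (dyadicLimit L (L p) * q - (2 * t) • q) := by
        rw [h.dyadicLimit_mul_of_left_mul hp hq_mul]
        module
      exact hdiff ▸ halve _ hq_le
    · obtain ⟨q, hq, hq_mul, hq_le⟩ := ih (h.right_mem p hp) (t := 2 * t - 1)
        ⟨by linarith, by linarith [ht.2]⟩
      refine ⟨q, hq, by rw [← hq_mul, ← mul_assoc, mul_sub, h.mul_left hp,
        (h.isStarProjection p hp).isIdempotentElem.eq], ?_⟩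
      have hdiff : dyadicLimit L p * q - t • q =
          (2⁻¹ : ℝ) • (dyadicLimit L (p - L p) * q - (2 * t - 1) • q) := by
        rw [h.dyadicLimit_mul_of_right_mul hp hq_mul]
        module
      exact hdiff ▸ halve _ hq_le

lemma quasispectrum_dyadicLimit_superset (h : IsSplitting L P) (hp : p ∈ P) :
    Set.Icc (0 : ℝ) 1 ⊆ quasispectrum ℝ (dyadicLimit L p) := by
  refine fun t ht => mem_quasispectrum_of_approx fun ε hε => ?_
  obtain ⟨n, hn⟩ := exists_pow_lt_of_lt_one (half_pos hε) (by norm_num : (2⁻¹ : ℝ) < 1)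
  obtain ⟨q, hq, -, hq_le⟩ := h.exists_norm_dyadicLimit_mul_sub_le n hp ht
  exact ⟨q, norm_eq_one_of_isStarProjection (h.isStarProjection q hq) (h.ne_zero q hq),
    hq_le.trans (by linarith)⟩

lemma not_noIntervalSpectrum (h : IsSplitting L P) (hP : P.Nonempty) : ¬ NoIntervalSpectrum A := by
  obtain ⟨p, hp⟩ := hP
  exact fun hA => hA _ (.of_nonneg (h.dyadicLimit_mem_Icc hp).1)
    (h.quasispectrum_dyadicLimit_superset hp)

end IsSplitting

lemma NoIntervalSpectrum.exists_isSplitting (hA : NoIntervalSpectrum A)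
    (hmin : ∀ p : A, ¬ IsMinimalProjection p) :
    ∃ L, IsSplitting L {p : A | IsStarProjection p ∧ p ≠ 0} := by
  have hsplit (p : A) : ∃ q, IsStarProjection p ∧ p ≠ 0 →
      (IsStarProjection q ∧ q ≠ 0) ∧ (IsStarProjection (p - q) ∧ p - q ≠ 0) := by
    by_contra! hp
    obtain ⟨⟨hp_proj, hp₀⟩, -⟩ := hp 0
    refine hmin p (hA.isMinimalProjection hp_proj hp₀ fun q hq hq₀ hpq => ?_)
    exact (sub_eq_zero.mp ((hp q).2 ⟨hq, hq₀⟩ (hq.sub_of_mul_eq_right hp_proj hpq))).symm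
  choose L hL using hsplit
  exact ⟨L, fun p hp => hp.1, fun p hp => hp.2, fun p hp => (hL p hp).1, fun p hp => (hL p hp).2⟩

lemma NoIntervalSpectrum.exists_isMinimalProjection [Nontrivial A] (hA : NoIntervalSpectrum A) :
    ∃ p : A, IsMinimalProjection p := by
  let _ := CStarAlgebra.spectralOrder A
  have _ := CStarAlgebra.spectralOrderedRing A
  by_contra! hmin
  obtain ⟨L, hL⟩ := hA.exists_isSplitting hmin
  obtain ⟨a, ha⟩ := exists_ne (0 : A)
  obtain ⟨p, hp, hp₀, -⟩ := hA.exists_isStarProjection (star_mul_self_nonneg a)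
    (mt (CStarRing.star_mul_self_eq_zero_iff a).mp ha) one_pos
  exact hL.not_noIntervalSpectrum ⟨p, hp, hp₀⟩ hA

end Splitting

/-! ### Closed ideals -/

namespace ClosedIdeal

open scoped CStarAlgebra

variable {A : Type u} [NonUnitalCStarAlgebra A] {B : Type v} [NonUnitalCStarAlgebra B]

/-- The quotient map `a ↦ [a]` as a ⋆-homomorphism. -/
noncomputable def projHom (I : ClosedIdeal A) : A →⋆ₙₐ[ℂ] I.Quotient where
  toFun := I.proj
  map_smul' := I.proj.map_smul
  map_zero' := I.proj.map_zero
  map_add' := I.proj.map_add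
  map_mul' := I.proj_mul
  map_star' := I.proj_star

lemma projHom_apply (I : ClosedIdeal A) (a : A) : I.projHom a = I.proj a := rfl

lemma projHom_surjective (I : ClosedIdeal A) : Function.Surjective I.projHom := I.proj_surjective

lemma proj_eq_zero_iff (I : ClosedIdeal A) {a : A} : I.proj a = 0 ↔ a ∈ I := by
  rw [← map_zero I.proj, proj_eq_proj_iff, sub_zero]

/-- The preimage of a closed ideal under a ⋆-homomorphism. -/
def comap (φ : A →⋆ₙₐ[ℂ] B) (J : ClosedIdeal B) : ClosedIdeal A where
  toSubmodule := J.toSubmodule.comap (φ : A →ₗ[ℂ] B)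
  mul_mem_left' a x hx := show φ (a * x) ∈ J from (map_mul φ a x).symm ▸ J.mul_mem_left' (φ a) hx
  mul_mem_right' a x hx := show φ (x * a) ∈ J from (map_mul φ x a).symm ▸ J.mul_mem_right' (φ a) hx
  star_mem' {x} hx := show φ (star x) ∈ J from (map_star φ x).symm ▸ J.star_mem' hx
  isClosed' := J.isClosed'.preimage (map_continuous φ)

lemma mem_comap {φ : A →⋆ₙₐ[ℂ] B} {J : ClosedIdeal B} {a : A} : a ∈ J.comap φ ↔ φ a ∈ J := Iff.rfl

variable (A) in
/-- The zero ideal. -/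
def zeroIdeal : ClosedIdeal A where
  toSubmodule := ⊥
  mul_mem_left' a x hx := (show x = 0 from hx) ▸ mul_zero a
  mul_mem_right' a x hx := (show x = 0 from hx) ▸ zero_mul a
  star_mem' {x} hx := (show x = 0 from hx) ▸ star_zero A
  isClosed' := isClosed_singleton

/-- The kernel of a ⋆-homomorphism. -/
def ker (φ : A →⋆ₙₐ[ℂ] B) : ClosedIdeal A := (zeroIdeal B).comap φ

lemma mem_ker {φ : A →⋆ₙₐ[ℂ] B} {a : A} : a ∈ ker φ ↔ φ a = 0 := Iff.rfl

lemma ker_projHom (I : ClosedIdeal A) : ker I.projHom = I :=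
  SetLike.ext fun _ => I.proj_eq_zero_iff

section Lift

variable (I : ClosedIdeal A) (φ : A →⋆ₙₐ[ℂ] B)

/-- The ⋆-homomorphism `A / I → B` induced by a ⋆-homomorphism `A → B` vanishing on `I`. -/
noncomputable def lift (h : ∀ a ∈ I, φ a = 0) : I.Quotient →⋆ₙₐ[ℂ] B where
  toFun := I.toSubmodule.liftQ (φ : A →ₗ[ℂ] B) h
  map_smul' := (I.toSubmodule.liftQ (φ : A →ₗ[ℂ] B) h).map_smul
  map_zero' := map_zero φ
  map_add' := (I.toSubmodule.liftQ (φ : A →ₗ[ℂ] B) h).map_add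
  map_mul' := I.proj_surjective.forall₂.mpr (map_mul φ)
  map_star' := I.proj_surjective.forall.mpr (map_star φ)

lemma lift_injective (h : ∀ a, a ∈ I ↔ φ a = 0) :
    Function.Injective (I.lift φ fun a => (h a).mp) := by
  rw [injective_iff_map_eq_zero, I.proj_surjective.forall]
  exact fun a ha => I.proj_eq_zero_iff.mpr ((h a).mpr ha)

/-- The isomorphism `A / I ≃ B` induced by a surjective ⋆-homomorphism `A → B` with kernel `I`. -/
noncomputable def quotientEquiv (h : ∀ a, a ∈ I ↔ φ a = 0) (hφ : Function.Surjective φ) :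
    I.Quotient ≃⋆ₐ[ℂ] B :=
  StarAlgEquiv.ofBijective (I.lift φ fun a => (h a).mp)
    ⟨I.lift_injective φ h, fun b => (hφ b).imp' I.proj fun _ => id⟩

lemma quotientEquiv_proj (h : ∀ a, a ∈ I ↔ φ a = 0) (hφ : Function.Surjective φ) (a : A) :
    I.quotientEquiv φ h hφ (I.proj a) = φ a := rfl

end Lift

/-- The closed ideal generated by a family of closed ideals. -/
def closedSup {ι : Sort*} (F : ι → ClosedIdeal A) : ClosedIdeal A where
  toSubmodule := (⨆ i, (F i).toSubmodule).topologicalClosure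
  mul_mem_left' a x hx := by
    have : (⨆ i, (F i).toSubmodule) ≤ (⨆ i, (F i).toSubmodule).comap (LinearMap.mulLeft ℂ a) :=
      iSup_le fun i x hx => le_iSup (fun i => (F i).toSubmodule) i ((F i).mul_mem_left' a hx)
    exact map_mem_closure (continuous_const_mul a) hx this
  mul_mem_right' a x hx := by
    have : (⨆ i, (F i).toSubmodule) ≤ (⨆ i, (F i).toSubmodule).comap (LinearMap.mulRight ℂ a) :=
      iSup_le fun i x hx => le_iSup (fun i => (F i).toSubmodule) i ((F i).mul_mem_right' a hx)
    exact map_mem_closure (f := (· * a)) (continuous_mul_const a) hx this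
  star_mem' {x} hx := by
    refine map_mem_closure continuous_star hx fun y hy => ?_
    simp only [SetLike.mem_coe] at hy ⊢
    induction hy using Submodule.iSup_induction' with
    | mem i y hy => exact le_iSup (fun i => (F i).toSubmodule) i ((F i).star_mem' hy)
    | zero => exact (star_zero A).symm ▸ Submodule.zero_mem _
    | add y z _ _ hy hz => exact (star_add y z).symm ▸ Submodule.add_mem _ hy hz
  isClosed' := Submodule.isClosed_topologicalClosure _

lemma subset_closedSup {ι : Sort*} (F : ι → ClosedIdeal A) (i : ι) :
    (F i : Set A) ⊆ closedSup F :=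
  fun _ hx => subset_closure (le_iSup (fun i => (F i).toSubmodule) i hx)

lemma closedSup_subset {ι : Sort*} (F : ι → ClosedIdeal A) {J : ClosedIdeal A}
    (h : ∀ i, (F i : Set A) ⊆ J) : (closedSup F : Set A) ⊆ J :=
  Submodule.topologicalClosure_minimal (⨆ i, (F i).toSubmodule) (t := J.toSubmodule)
    (iSup_le h) J.isClosed'

lemma coe_closedSup_of_directed {ι : Type*} [Nonempty ι] (F : ι → ClosedIdeal A)
    (h : Directed (· ⊆ ·) fun i => (F i : Set A)) :
    (closedSup F : Set A) = closure (⋃ i, (F i : Set A)) := by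
  change closure ((⨆ i, (F i).toSubmodule : Submodule ℂ A) : Set A) = _
  rw [Submodule.coe_iSup_of_directed _ h]
  rfl

/-- The preimage in `A` of the atomic ideal of `A / I`: the step `I_α ↦ I_{α+1}` of the
Cantor–Bendixson sequence. -/
noncomputable def derived (I : ClosedIdeal A) : ClosedIdeal A :=
  (atomicIdeal I.Quotient).comap I.projHom

lemma mem_derived {I : ClosedIdeal A} {a : A} :
    a ∈ I.derived ↔ I.proj a ∈ atomicIdeal I.Quotient := Iff.rfl

lemma subset_derived (I : ClosedIdeal A) : (I : Set A) ⊆ I.derived := fun a ha => by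
  rw [SetLike.mem_coe, mem_derived, I.proj_eq_zero_iff.mpr ha]
  exact zero_mem _

lemma preimage_proj_image {I J : ClosedIdeal A} (h : (I : Set A) ⊆ J) :
    I.proj ⁻¹' (I.proj '' (J : Set A)) = J := by
  refine Set.Subset.antisymm ?_ (Set.subset_preimage_image _ _)
  rintro a ⟨b, hb, hba⟩
  rw [← sub_sub_cancel b a]
  exact sub_mem (S := ClosedIdeal A) hb (h (I.proj_eq_proj_iff.mp hba))

lemma coe_atomicPart_eq_image_iff {I J : ClosedIdeal A} (h : (I : Set A) ⊆ J) :
    (atomicPart I.Quotient : Set I.Quotient) = I.proj '' (J : Set A) ↔ J = I.derived := by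
  rw [coe_atomicPart, ← I.proj_surjective.preimage_injective.eq_iff, preimage_proj_image h,
    eq_comm]
  exact SetLike.coe_set_eq (q := I.derived)

end ClosedIdeal

open scoped CStarAlgebra in
lemma isClosed_range {A : Type u} [NonUnitalCStarAlgebra A] {B : Type v}
    [NonUnitalCStarAlgebra B] (φ : A →⋆ₙₐ[ℂ] B) : IsClosed (Set.range φ) := by
  let ψ := (ClosedIdeal.ker φ).lift φ fun _ => id
  have hψ : Set.range ψ = Set.range φ := ((ClosedIdeal.ker φ).proj_surjective.range_comp ψ).symm
  have hinj : Function.Injective ψ := ClosedIdeal.lift_injective _ φ fun _ => Iff.rfl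
  rw [← hψ]
  exact (NonUnitalStarAlgHom.isometry ψ hinj).isClosedEmbedding.isClosed_range

/-! ### Spectra of elements of the atomic ideal -/

section AtomicSpectrum

variable {A : Type u} [NonUnitalCStarAlgebra A]

lemma IsMinimalProjection.exists_mul_mul_mem_span_singleton {p q : A} (hp : IsMinimalProjection p)
    (hq : IsMinimalProjection q) : ∃ v : A, ∀ a : A, p * a * q ∈ Submodule.span ℂ {v} := by
  by_cases! h : ∀ a : A, p * a * q = 0
  · exact ⟨0, fun a => (h a).symm ▸ zero_mem _⟩
  obtain ⟨a, ha⟩ := h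
  have hxq : p * a * q * q = p * a * q := by rw [mul_assoc, hq.mul_self]
  obtain ⟨d, hd₀, -, hd⟩ := hq.exists_star_mul_self_eq_smul hxq ha
  refine ⟨p * a * q, fun b => ?_⟩
  obtain ⟨c, hc⟩ := hp.exists_mul_mul_eq_smul (b * q * star a)
  have key : d • (p * b * q) = c • (p * a * q) :=
    calc d • (p * b * q) = p * b * (q * (d • q)) := by
          rw [mul_smul_comm, hq.mul_self, mul_smul_comm, mul_assoc]
      _ = p * (b * (q * q) * star a) * (p * p) * a * q := by
          rw [← hd, star_mul, star_mul, hp.star_eq, hq.star_eq]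
          noncomm_ring
      _ = c • (p * a * q) := by
          rw [hq.mul_self, hp.mul_self, hc, smul_mul_assoc, smul_mul_assoc]
  exact Submodule.mem_span_singleton.mpr ⟨d⁻¹ * c, by rw [mul_smul, ← key, inv_smul_smul₀ hd₀]⟩

lemma exists_finiteDimensional_mul_mul_mem {x y : A} (hx : x ∈ atomSpan A) (hy : y ∈ atomSpan A) :
    ∃ W : Submodule ℂ A, FiniteDimensional ℂ W ∧ ∀ a : A, x * a * y ∈ W := by
  induction hx, hy using Submodule.span_induction₂ with
  | mem_mem p q hp hq =>
    obtain ⟨v, hv⟩ := IsMinimalProjection.exists_mul_mul_mem_span_singleton hp hq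
    exact ⟨_, inferInstance, hv⟩
  | zero_left y _ => exact ⟨⊥, inferInstance, fun a => by simp⟩
  | zero_right x _ => exact ⟨⊥, inferInstance, fun a => by simp⟩
  | add_left x x' y _ _ _ hx hx' =>
    obtain ⟨V, _, hV⟩ := hx
    obtain ⟨W, _, hW⟩ := hx'
    refine ⟨V ⊔ W, inferInstance, fun a => ?_⟩
    rw [add_mul, add_mul]
    exact Submodule.add_mem_sup (hV a) (hW a)
  | add_right x y y' _ _ _ hy hy' =>
    obtain ⟨V, _, hV⟩ := hy
    obtain ⟨W, _, hW⟩ := hy'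
    refine ⟨V ⊔ W, inferInstance, fun a => ?_⟩
    rw [mul_add]
    exact Submodule.add_mem_sup (hV a) (hW a)
  | smul_left c x y _ _ h =>
    obtain ⟨W, _, hW⟩ := h
    refine ⟨W, inferInstance, fun a => ?_⟩
    rw [smul_mul_assoc, smul_mul_assoc]
    exact W.smul_mem c (hW a)
  | smul_right c x y _ _ h =>
    obtain ⟨W, _, hW⟩ := h
    exact ⟨W, inferInstance, fun a => mul_smul_comm c (x * a) y ▸ W.smul_mem c (hW a)⟩

lemma continuous_max_mul_eval (P : Polynomial ℝ) :
    Continuous fun x : ℝ => max 0 (x - 2⁻¹) * P.eval x := by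
  fun_prop

/-- The linear map `P ↦ max(0, b - 1/2) P(b)`, embedding the polynomials into the functional
calculus of an element `b` with large spectrum, away from the spectral value zero. -/
noncomputable def truncatedAEval (b : A) : Polynomial ℝ →ₗ[ℝ] A where
  toFun P := cfcₙ (fun x => max 0 (x - 2⁻¹) * P.eval x) b
  map_add' P Q := by
    rw [← cfcₙ_add _ _ b (continuous_max_mul_eval P).continuousOn (by simp)
      (continuous_max_mul_eval Q).continuousOn (by simp)]
    simp only [Polynomial.eval_add, mul_add]
  map_smul' c P := by
    rw [RingHom.id_apply,
      ← cfcₙ_const_mul c _ b (continuous_max_mul_eval P).continuousOn (by simp)]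
    simp only [Polynomial.eval_smul, smul_eq_mul, mul_left_comm]

lemma truncatedAEval_injective {b : A} (hb : IsSelfAdjoint b)
    (hσ : Set.Icc (0 : ℝ) 1 ⊆ quasispectrum ℝ b) : Function.Injective (truncatedAEval b) := by
  rw [injective_iff_map_eq_zero]
  intro P hP
  refine P.eq_zero_of_infinite_isRoot
    ((Set.Ioc_infinite (show (2⁻¹ : ℝ) < 1 by norm_num)).mono fun x hx => ?_)
  have hle := norm_apply_le_norm_cfcₙ (fun x => max 0 (x - 2⁻¹) * P.eval x) b
    (hσ ⟨(by norm_num : (0 : ℝ) ≤ 2⁻¹).trans hx.1.le, hx.2⟩)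
    (continuous_max_mul_eval P).continuousOn (by simp) hb
  rw [show cfcₙ _ b = 0 from hP, norm_zero, norm_le_zero_iff, max_eq_right (sub_pos.mpr hx.1).le]
    at hle
  exact (mul_eq_zero.mp hle).resolve_left (sub_pos.mpr hx.1).ne'

lemma exists_cfcₙ_ne_zero_mul_mul_eq_zero {b y : A} (hb : IsSelfAdjoint b)
    (hσ : Set.Icc (0 : ℝ) 1 ⊆ quasispectrum ℝ b) {W : Submodule ℂ A} [FiniteDimensional ℂ W]
    (hW : ∀ a : A, y * a * y ∈ W) :
    ∃ f : ℝ → ℝ, Continuous f ∧ (∀ x, |x| < 2⁻¹ → f x = 0) ∧ cfcₙ f b ≠ 0 ∧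
      y * cfcₙ f b * y = 0 := by
  let Λ : Polynomial ℝ →ₗ[ℝ] W.restrictScalars ℝ :=
    ((LinearMap.mulLeftRight ℝ (y, y)).comp (truncatedAEval b)).codRestrict _ fun P => hW _
  have : FiniteDimensional ℝ (W.restrictScalars ℝ) := inferInstanceAs (FiniteDimensional ℝ W)
  have hΛ : ¬ Function.Injective Λ := fun h =>
    Polynomial.not_finite (R := ℝ) (Module.Finite.of_injective Λ h)
  rw [injective_iff_map_eq_zero] at hΛ
  push Not at hΛ
  obtain ⟨P, hP, hP₀⟩ := hΛ
  refine ⟨_, continuous_max_mul_eval P, fun x hx => ?_, ?_, congrArg Subtype.val hP⟩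
  · rw [max_eq_left (by linarith [le_abs_self x]), zero_mul]
  · exact (map_ne_zero_iff _ (truncatedAEval_injective hb hσ)).mpr hP₀

lemma sq_mul_norm_cfcₙ_le {b : A} (hb : IsSelfAdjoint b) {f : ℝ → ℝ} (hf : Continuous f) {δ : ℝ}
    (hδ : 0 < δ) (hfδ : ∀ x, |x| < δ → f x = 0) :
    δ ^ 2 * ‖cfcₙ f b‖ ≤ ‖b * cfcₙ f b * b‖ := by
  have hf₀ : f 0 = 0 := hfδ 0 (by rwa [abs_zero])
  obtain ⟨⟨x, hx, hxf⟩, -⟩ := IsGreatest.norm_cfcₙ f b hf.continuousOn hf₀ hb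
  have hmul : b * cfcₙ f b * b = cfcₙ (fun x => x * f x * x) b := by
    rw [cfcₙ_mul (fun x => x * f x) (fun x => x) b (by fun_prop) (by simp),
      cfcₙ_mul (fun x => x) f b continuousOn_id rfl hf.continuousOn hf₀, cfcₙ_id' ℝ b hb]
  have hle : ‖x * f x * x‖ ≤ ‖b * cfcₙ f b * b‖ :=
    hmul ▸ norm_apply_le_norm_cfcₙ (fun x => x * f x * x) b hx (by fun_prop) (by simp) hb
  refine le_trans ?_ hle
  rw [← hxf, norm_mul, norm_mul, mul_right_comm, ← pow_two, Real.norm_eq_abs x]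
  rcases lt_or_ge |x| δ with h | h
  · simp [hfδ x h]
  · gcongr

lemma norm_mul_mul_le_of_mul_mul_eq_zero {b y c : A} (h : y * c * y = 0) :
    ‖b * c * b‖ ≤ ‖b - y‖ * (‖b‖ + ‖y‖) * ‖c‖ := by
  calc ‖b * c * b‖ = ‖(b - y) * c * b + y * c * (b - y)‖ := by
        simp only [sub_mul, mul_sub, h, sub_zero, sub_add_cancel]
    _ ≤ ‖(b - y) * c * b‖ + ‖y * c * (b - y)‖ := norm_add_le _ _
    _ ≤ ‖b - y‖ * ‖c‖ * ‖b‖ + ‖y‖ * ‖c‖ * ‖b - y‖ := by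
        gcongr <;> exact norm_mul₃_le
    _ = ‖b - y‖ * (‖b‖ + ‖y‖) * ‖c‖ := by ring

open Filter Topology in
lemma not_Icc_subset_of_mem_atomicIdeal {b : A} (hmem : b ∈ atomicIdeal A)
    (hb : IsSelfAdjoint b) : ¬ Set.Icc (0 : ℝ) 1 ⊆ quasispectrum ℝ b := by
  intro hσ
  have htendsto : Tendsto (fun y => ‖b - y‖ * (‖b‖ + ‖y‖)) (𝓝 b) (𝓝 0) := by
    have : Continuous fun y => ‖b - y‖ * (‖b‖ + ‖y‖) := by fun_prop
    simpa using this.tendsto b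
  obtain ⟨y, hy, hby⟩ := ((mem_closure_iff_frequently.mp hmem).and_eventually
    (htendsto.eventually_lt_const (show (0 : ℝ) < 2⁻¹ ^ 2 by norm_num))).exists
  obtain ⟨W, _, hW⟩ := exists_finiteDimensional_mul_mul_mem hy hy
  obtain ⟨f, hf, hfδ, hfb, hyfy⟩ := exists_cfcₙ_ne_zero_mul_mul_eq_zero hb hσ hW
  have hlower := sq_mul_norm_cfcₙ_le hb hf (by norm_num) hfδ
  have hupper := norm_mul_mul_le_of_mul_mul_eq_zero (b := b) hyfy
  exact hby.not_ge (le_of_mul_le_mul_right (hlower.trans hupper) (norm_pos_iff.mpr hfb))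

end AtomicSpectrum

/-! ### Cantor–Bendixson sequences -/

namespace ClosedIdeal

variable {A : Type u} [NonUnitalCStarAlgebra A] {I : ClosedIdeal A}
  {B : NonUnitalStarSubalgebra ℂ A}

/-- A closed ideal as a ⋆-subalgebra, so that it can be intersected with other ⋆-subalgebras. -/
def toStarSubalgebra (I : ClosedIdeal A) : NonUnitalStarSubalgebra ℂ A where
  toSubmodule := I.toSubmodule
  mul_mem' := mul_mem (S := ClosedIdeal A) (s := I)
  star_mem' := star_mem (S := ClosedIdeal A) (s := I)

lemma injective_projHom_comp_subtype (hBI : ∀ x ∈ B, x ∈ I → x = 0) :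
    Function.Injective (I.projHom.comp (NonUnitalStarSubalgebraClass.subtype B)) := by
  rw [injective_iff_map_eq_zero]
  exact fun x hx => Subtype.ext (hBI x x.2 (I.proj_eq_zero_iff.mp hx))

lemma norm_le_norm_sub [IsClosed (B : Set A)] (hBI : ∀ x ∈ B, x ∈ I → x = 0) {x y : A}
    (hx : x ∈ B) (hy : y ∈ I) : ‖x‖ ≤ ‖x - y‖ :=
  calc ‖x‖ = ‖I.proj x‖ :=
        (NonUnitalStarAlgHom.norm_map _ (injective_projHom_comp_subtype hBI) ⟨x, hx⟩).symm
    _ = ‖I.proj (x - y)‖ := by rw [map_sub, I.proj_eq_zero_iff.mpr hy, sub_zero]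
    _ ≤ ‖x - y‖ := I.norm_proj_le _

lemma noIntervalSpectrum_of_subset_derived [IsClosed (B : Set A)]
    (hBI : ∀ x ∈ B, x ∈ I → x = 0) (hB : (B : Set A) ⊆ I.derived) : NoIntervalSpectrum B := by
  intro b hb hσ
  let φ := I.projHom.comp (NonUnitalStarSubalgebraClass.subtype B)
  have hmem : φ b ∈ atomicIdeal I.Quotient := hB b.2
  exact not_Icc_subset_of_mem_atomicIdeal hmem (hb.map φ)
    (hσ.trans (quasispectrum_subset_of_injective φ (injective_projHom_comp_subtype hBI) hb))

lemma isMinimalProjection_of_inf [IsClosed (B : Set A)]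
    [IsClosed ((B ⊓ I.toStarSubalgebra : NonUnitalStarSubalgebra ℂ A) : Set A)]
    {p : (B ⊓ I.toStarSubalgebra : NonUnitalStarSubalgebra ℂ A)} (hp : IsMinimalProjection p) :
    IsMinimalProjection (⟨p, p.2.1⟩ : B) := by
  have hpp : (p : A) * p = p := congrArg Subtype.val hp.mul_self
  have hps : star (p : A) = p := congrArg Subtype.val hp.star_eq
  refine IsMinimalProjection.of_exists_smul ⟨Subtype.ext hpp, Subtype.ext hps⟩
    (fun h => hp.ne_zero (Subtype.ext (congrArg (fun x : B => (x : A)) h))) fun a => ?_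
  obtain ⟨c, hc⟩ := hp.exists_mul_mul_eq_smul
    ⟨p * a, mul_mem p.2.1 a.2, I.mul_mem_right' _ p.2.2⟩
  have hc : (p : A) * (p * a) * p = c • (p : A) := congrArg Subtype.val hc
  rw [← mul_assoc, hpp] at hc
  exact ⟨c, Subtype.ext hc⟩

lemma exists_isMinimalProjection_of_mem_derived [hBc : IsClosed (B : Set A)]
    (hBI : ∀ x ∈ B, x ∈ I → x = 0) {z : A} (hz : z ∈ B) (hz₀ : z ≠ 0) (hzI : z ∈ I.derived) :
    ∃ p : B, IsMinimalProjection p := by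
  let F := B ⊓ I.derived.toStarSubalgebra
  have : IsClosed (F : Set A) := hBc.inter I.derived.isClosed'
  have hF : NoIntervalSpectrum F :=
    noIntervalSpectrum_of_subset_derived (fun x hx => hBI x hx.1) fun _ hx => hx.2
  have : Nontrivial F := ⟨⟨z, hz, hzI⟩, 0, fun h => hz₀ (congrArg Subtype.val h)⟩
  obtain ⟨p, hp⟩ := hF.exists_isMinimalProjection
  exact ⟨_, isMinimalProjection_of_inf hp⟩

end ClosedIdeal

namespace IsCantorBendixsonSequence

variable {A : Type u} [NonUnitalCStarAlgebra A] {ht ht' : Ordinal.{u}}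
  {I J : Ordinal.{u} → ClosedIdeal A}

lemma mono (h : IsCantorBendixsonSequence A ht I) {α β : Ordinal.{u}} (hαβ : α ≤ β) (hβ : β ≤ ht) :
    (I α : Set A) ⊆ I β := by
  rcases hαβ.eq_or_lt with rfl | hlt
  · exact subset_rfl
  · exact (h.strictMono α β hlt hβ).subset

lemma eq_zeroIdeal (h : IsCantorBendixsonSequence A ht I) : I 0 = ClosedIdeal.zeroIdeal A :=
  SetLike.coe_injective h.zero

lemma add_one_eq_derived (h : IsCantorBendixsonSequence A ht I) {α : Ordinal.{u}} (hα : α < ht) :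
    I (α + 1) = (I α).derived :=
  (ClosedIdeal.coe_atomicPart_eq_image_iff (h.mono (by simp) (Order.add_one_le_of_lt hα))).mp
    (h.succ α hα)

lemma eq_of_le (h : IsCantorBendixsonSequence A ht I) (h' : IsCantorBendixsonSequence A ht' J)
    (α : Ordinal.{u}) (hα : α ≤ ht) (hα' : α ≤ ht') : I α = J α := by
  induction α using Ordinal.limitRecOn with
  | zero => rw [h.eq_zeroIdeal, h'.eq_zeroIdeal]
  | add_one α ih =>
    rw [Order.add_one_le_iff] at hα hα'
    rw [h.add_one_eq_derived hα, h'.add_one_eq_derived hα', ih hα.le hα'.le]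
  | limit α hlim ih =>
    refine SetLike.coe_injective ?_
    rw [h.limit α hα hlim, h'.limit α hα' hlim]
    refine congrArg closure (Set.iUnion₂_congr fun β hβ => ?_)
    rw [ih β hβ (hβ.le.trans hα) (hβ.le.trans hα')]

lemma height_le (h : IsCantorBendixsonSequence A ht I) (h' : IsCantorBendixsonSequence A ht' J) :
    ht' ≤ ht := by
  by_contra! hlt
  have hssubset := h'.strictMono ht ht' hlt le_rfl
  rw [← h.eq_of_le h' ht le_rfl hlt.le, h.height] at hssubset
  exact hssubset.2 (Set.subset_univ _)

lemma unique (h : IsCantorBendixsonSequence A ht I) (h' : IsCantorBendixsonSequence A ht' J) :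
    ht' = ht ∧ ∀ α ≤ ht, J α = I α := by
  have heq : ht' = ht := le_antisymm (h.height_le h') (h'.height_le h)
  exact ⟨heq, fun α hα => (h.eq_of_le h' α hα (heq ▸ hα)).symm⟩

variable {B : NonUnitalStarSubalgebra ℂ A} [IsClosed (B : Set A)]

lemma eq_zero_of_mem_limit (h : IsCantorBendixsonSequence A ht I) {α : Ordinal.{u}} (hα : α ≤ ht)
    (hlim : Order.IsSuccLimit α) (hB : ∀ β < α, ∀ x ∈ B, x ∈ I β → x = 0) {z : A} (hz : z ∈ B)
    (hzI : z ∈ I α) : z = 0 := by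
  by_contra hz₀
  rw [← SetLike.mem_coe, h.limit α hα hlim] at hzI
  obtain ⟨c, hc, hzc⟩ := Metric.mem_closure_iff.mp hzI ‖z‖ (norm_pos_iff.mpr hz₀)
  obtain ⟨β, hβ, hcβ⟩ := Set.mem_iUnion₂.mp hc
  rw [dist_eq_norm] at hzc
  exact hzc.not_ge (ClosedIdeal.norm_le_norm_sub (hB β hβ) hz hcβ)

lemma exists_first_nonzero (h : IsCantorBendixsonSequence A ht I) (hB : B ≠ ⊥) :
    ∃ β < ht, (∀ x ∈ B, x ∈ I β → x = 0) ∧ ∃ z ∈ B, z ≠ 0 ∧ z ∈ I (β + 1) := by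
  let S : Set Ordinal.{u} := {α | α ≤ ht ∧ ∃ z ∈ B, z ≠ 0 ∧ z ∈ I α}
  have hS : S.Nonempty := by
    obtain ⟨z, hz, hz₀⟩ : ∃ z ∈ B, z ≠ 0 := by
      by_contra! hB₀
      exact hB (eq_bot_iff.mpr fun z hz => NonUnitalStarAlgebra.mem_bot.mpr (hB₀ z hz))
    exact ⟨ht, le_rfl, z, hz, hz₀, h.height.superset trivial⟩
  obtain ⟨hα, z, hzB, hz₀, hzI⟩ := csInf_mem hS
  have hmin : ∀ β < sInf S, ∀ x ∈ B, x ∈ I β → x = 0 := by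
    intro β hβ x hx hxI
    by_contra hx₀
    exact notMem_of_lt_csInf' hβ ⟨hβ.le.trans hα, x, hx, hx₀, hxI⟩
  rcases Ordinal.zero_or_succ_or_isSuccLimit (sInf S) with h₀ | ⟨β, hβ⟩ | hlim
  · rw [h₀, h.eq_zeroIdeal] at hzI
    exact absurd hzI hz₀
  · rw [← hβ] at hα hzI hmin
    exact ⟨β, Order.add_one_le_iff.mp hα, hmin β (by simp), z, hzB, hz₀, hzI⟩
  · exact absurd (h.eq_zero_of_mem_limit hα hlim hmin hzB hzI) hz₀

lemma isScattered (h : IsCantorBendixsonSequence A ht I) : IsScattered A := by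
  intro B _ hB
  obtain ⟨β, hβ, hmin, z, hzB, hz₀, hzI⟩ := h.exists_first_nonzero hB
  rw [h.add_one_eq_derived hβ] at hzI
  exact atomicPart_ne_bot_iff.mpr
    (ClosedIdeal.exists_isMinimalProjection_of_mem_derived hmin hzB hz₀ hzI)

end IsCantorBendixsonSequence

section Existence

variable {A : Type u} [NonUnitalCStarAlgebra A]

variable (A) in
/-- The transfinite sequence of ideals obtained by iterating `ClosedIdeal.derived`. It increases
until it reaches `A`, where the Cantor–Bendixson sequence of a scattered algebra ends. -/
noncomputable def derivedSeq (α : Ordinal.{u}) : ClosedIdeal A :=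
  ClosedIdeal.closedSup fun β : Set.Iio α => (derivedSeq β.1).derived
termination_by α
decreasing_by exact β.2

lemma derived_subset_derivedSeq {α β : Ordinal.{u}} (h : β < α) :
    ((derivedSeq A β).derived : Set A) ⊆ derivedSeq A α := by
  conv_rhs => rw [derivedSeq]
  exact ClosedIdeal.subset_closedSup (fun β : Set.Iio α => (derivedSeq A β.1).derived) ⟨β, h⟩

lemma derivedSeq_subset {α : Ordinal.{u}} {J : ClosedIdeal A}
    (h : ∀ β < α, ((derivedSeq A β).derived : Set A) ⊆ J) : (derivedSeq A α : Set A) ⊆ J := by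
  rw [derivedSeq]
  exact ClosedIdeal.closedSup_subset _ fun β => h β β.2

lemma derivedSeq_mono {α β : Ordinal.{u}} (h : α ≤ β) :
    (derivedSeq A α : Set A) ⊆ derivedSeq A β :=
  derivedSeq_subset fun _ hγ => derived_subset_derivedSeq (hγ.trans_le h)

lemma derivedSeq_add_one (α : Ordinal.{u}) : derivedSeq A (α + 1) = (derivedSeq A α).derived := by
  refine SetLike.coe_injective (Set.Subset.antisymm (derivedSeq_subset fun β hβ => ?_)
    (derived_subset_derivedSeq (by simp)))
  rcases (Order.lt_add_one_iff.mp hβ).eq_or_lt with rfl | h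
  · exact subset_rfl
  · exact (derived_subset_derivedSeq h).trans (ClosedIdeal.subset_derived _)

lemma derivedSeq_zero : derivedSeq A 0 = ClosedIdeal.zeroIdeal A :=
  SetLike.coe_injective (Set.Subset.antisymm
    (derivedSeq_subset fun _ hβ => absurd hβ not_lt_zero)
    (Set.singleton_subset_iff.mpr (zero_mem _)))

lemma derivedSeq_limit {α : Ordinal.{u}} (hα : Order.IsSuccLimit α) :
    (derivedSeq A α : Set A) = closure (⋃ β < α, (derivedSeq A β : Set A)) := by
  refine Set.Subset.antisymm ?_ (closure_minimal
    (Set.iUnion₂_subset fun β hβ => derivedSeq_mono hβ.le) (derivedSeq A α).isClosed')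
  have : Nonempty (Set.Iio α) := ⟨⟨0, hα.bot_lt⟩⟩
  have hmono : Monotone fun β : Set.Iio α => ((derivedSeq A β.1).derived : Set A) := by
    intro β γ h
    simp only [← derivedSeq_add_one]
    exact derivedSeq_mono (add_le_add_left (Subtype.coe_le_coe.mpr h) 1)
  conv_lhs => rw [derivedSeq]
  rw [ClosedIdeal.coe_closedSup_of_directed _ hmono.directed_le]
  refine closure_mono (Set.iUnion_subset fun β => ?_)
  rw [← derivedSeq_add_one]
  exact Set.subset_biUnion_of_mem (u := fun β => (derivedSeq A β : Set A))
    (hα.succ_lt (Set.mem_Iio.mp β.2))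

namespace NoIntervalSpectrum

lemma ssubset_derived (hA : NoIntervalSpectrum A) {I : ClosedIdeal A}
    (hI : (I : Set A) ≠ Set.univ) : (I : Set A) ⊂ I.derived := by
  refine ⟨I.subset_derived, fun hsub => ?_⟩
  obtain ⟨a, ha⟩ := (Set.ne_univ_iff_exists_notMem _).mp hI
  have : Nontrivial I.Quotient := ⟨I.proj a, 0, mt I.proj_eq_zero_iff.mp ha⟩
  obtain ⟨p, hp⟩ := (hA.of_surjective I.projHom I.projHom_surjective).exists_isMinimalProjection
  obtain ⟨b, rfl⟩ := I.proj_surjective p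
  exact hp.ne_zero (I.proj_eq_zero_iff.mpr (hsub hp.mem_atomicIdeal))

lemma derivedSeq_ssubset (hA : NoIntervalSpectrum A) {α β : Ordinal.{u}} (h : α < β)
    (hα : (derivedSeq A α : Set A) ≠ Set.univ) : (derivedSeq A α : Set A) ⊂ derivedSeq A β :=
  (hA.ssubset_derived hα).trans_subset (derived_subset_derivedSeq h)

lemma exists_derivedSeq_eq_univ (hA : NoIntervalSpectrum A) :
    ∃ α : Ordinal.{u}, (derivedSeq A α : Set A) = Set.univ := by
  by_contra! h
  have hmono : StrictMono fun α => (derivedSeq A α : Set A) := fun α _ hαβ =>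
    hA.derivedSeq_ssubset hαβ (h α)
  exact not_injective_of_ordinal _ hmono.injective

lemma exists_isCantorBendixsonSequence (hA : NoIntervalSpectrum A) :
    ∃ (ht : Ordinal.{u}) (I : Ordinal.{u} → ClosedIdeal A), IsCantorBendixsonSequence A ht I :=
  ⟨sInf {α | (derivedSeq A α : Set A) = Set.univ}, derivedSeq A,
    { zero := congrArg SetLike.coe derivedSeq_zero
      height := csInf_mem hA.exists_derivedSeq_eq_univ
      strictMono := fun _ _ h hβ =>
        hA.derivedSeq_ssubset h fun h' => notMem_of_lt_csInf' (h.trans_le hβ) h'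
      limit := fun _ _ hβ => derivedSeq_limit hβ
      succ := fun α _ => (ClosedIdeal.coe_atomicPart_eq_image_iff (derivedSeq_mono (by simp))).mpr
        (derivedSeq_add_one α) }⟩

end NoIntervalSpectrum

end Existence

/-! ### Matrix units -/

/-- A system of matrix units `e i j` of a C⋆-algebra, indexed by a type `ι`, together with the
matrix coefficients they define. -/
structure MatrixUnits (ι : Type*) (K : Type*) [NonUnitalCStarAlgebra K] where
  e : ι → ι → K
  coeff : ι → ι → K →ₗ[ℂ] ℂ
  ne_zero : ∀ i j, e i j ≠ 0
  e_mul_e : ∀ i j k, e i j * e j k = e i k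
  e_mul_e_of_ne : ∀ i {j j'} k, j ≠ j' → e i j * e j' k = 0
  star_e : ∀ i j, star (e i j) = e j i
  e_mul_mul_e : ∀ i i' j j' k, e i i' * k * e j j' = coeff i' j k • e i j'

namespace MatrixUnits

variable {ι : Type*} {K : Type*} [NonUnitalCStarAlgebra K] (E : MatrixUnits ι K)

variable {E} in
lemma smul_injective {c d : ℂ} {i j : ι} (h : c • E.e i j = d • E.e i j) : c = d :=
  smul_left_injective ℂ (E.ne_zero i j) h

lemma coeff_star (k : K) (i j : ι) : E.coeff i j (star k) = star (E.coeff j i k) := by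
  refine smul_injective (E := E) (i := i) (j := j) ?_
  calc E.coeff i j (star k) • E.e i j
      = star (E.e j j * k * E.e i i) := by
        rw [← E.e_mul_mul_e, star_mul, star_mul, E.star_e, E.star_e, mul_assoc]
    _ = star (E.coeff j i k) • E.e i j := by rw [E.e_mul_mul_e, star_smul, E.star_e]

lemma coeff_mul_e_mul (k l : K) (i j m : ι) :
    E.coeff i j (k * E.e m m * l) = E.coeff i m k * E.coeff m j l := by
  refine smul_injective (E := E) (i := i) (j := j) ?_
  calc E.coeff i j (k * E.e m m * l) • E.e i j
      = E.e i i * (k * (E.e m m * E.e m m) * l) * E.e j j := by rw [E.e_mul_e, E.e_mul_mul_e]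
    _ = (E.e i i * k * E.e m m) * (E.e m m * l * E.e j j) := by noncomm_ring
    _ = (E.coeff i m k * E.coeff m j l) • E.e i j := by
      rw [E.e_mul_mul_e, E.e_mul_mul_e, smul_mul_assoc, mul_smul_comm, E.e_mul_e, smul_smul]

lemma coeff_e (i j : ι) : E.coeff i j (E.e i j) = 1 := by
  refine smul_injective (E := E) (i := i) (j := j) ?_
  rw [← E.e_mul_mul_e, E.e_mul_e, E.e_mul_e, one_smul]

/-- The projection onto the span of the basis vectors with index in `s`. -/
noncomputable def finProj (s : Finset ι) : K := ∑ i ∈ s, E.e i i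

lemma star_finProj (s : Finset ι) : star (E.finProj s) = E.finProj s := by
  simp only [finProj, star_sum, E.star_e]

lemma finProj_mul_e {s : Finset ι} {i : ι} (hi : i ∈ s) (j : ι) :
    E.finProj s * E.e i j = E.e i j := by
  rw [finProj, Finset.sum_mul,
    Finset.sum_eq_single_of_mem i hi fun k _ hk => E.e_mul_e_of_ne k j hk, E.e_mul_e]

lemma e_mul_finProj {s : Finset ι} (i : ι) {j : ι} (hj : j ∈ s) :
    E.e i j * E.finProj s = E.e i j := by
  rw [← star_inj, star_mul, star_finProj, E.star_e, E.finProj_mul_e hj]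

lemma finProj_mul_self (s : Finset ι) : E.finProj s * E.finProj s = E.finProj s := by
  conv_lhs => rw [finProj, Finset.sum_mul]
  exact Finset.sum_congr rfl fun i hi => E.e_mul_finProj i hi

lemma norm_finProj_le (s : Finset ι) : ‖E.finProj s‖ ≤ 1 := by
  rcases eq_or_ne (E.finProj s) 0 with h | h
  · simp [h]
  · exact (norm_eq_one_of_isStarProjection ⟨E.finProj_mul_self s, E.star_finProj s⟩ h).le

lemma finProj_mul_mul_finProj (k : K) (s : Finset ι) : E.finProj s * k * E.finProj s =
    ∑ i ∈ s, ∑ j ∈ s, E.coeff i j k • E.e i j := by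
  simp only [finProj, Finset.sum_mul, Finset.mul_sum, E.e_mul_mul_e]
  exact Finset.sum_comm

lemma coeff_mul_finProj_mul (k l : K) (s : Finset ι) (i j : ι) :
    E.coeff i j (k * E.finProj s * l) = ∑ m ∈ s, E.coeff i m k * E.coeff m j l := by
  simp only [finProj, Finset.mul_sum, Finset.sum_mul, map_sum, E.coeff_mul_e_mul]

lemma coeff_finProj_mul_mul_finProj (k : K) {s : Finset ι} {i j : ι} (hi : i ∈ s) (hj : j ∈ s) :
    E.coeff i j (E.finProj s * k * E.finProj s) = E.coeff i j k := by
  refine smul_injective (E := E) (i := i) (j := j) ?_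
  calc E.coeff i j (E.finProj s * k * E.finProj s) • E.e i j
      = (E.e i i * E.finProj s) * k * (E.finProj s * E.e j j) := by
        rw [← E.e_mul_mul_e]; noncomm_ring
    _ = E.coeff i j k • E.e i j := by
        rw [E.e_mul_finProj i hi, E.finProj_mul_e hj, E.e_mul_mul_e]

end MatrixUnits

/-- A system of matrix units spanning a dense subspace. This is encoded by requiring that the
finite projections `finProj s` form an approximate unit. -/
structure CompleteMatrixUnits (ι : Type*) (K : Type*) [NonUnitalCStarAlgebra K] extends
    MatrixUnits ι K where
  tendsto_finProj_mul : ∀ k : K,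
    Filter.Tendsto (fun s => toMatrixUnits.finProj s * k) Filter.atTop (nhds k)

lemma CompleteMatrixUnits.tendsto_finProj_mul_mul_finProj {ι : Type*} {K : Type*}
    [NonUnitalCStarAlgebra K] (E : CompleteMatrixUnits ι K) (k : K) :
    Filter.Tendsto (fun s => E.finProj s * k * E.finProj s) Filter.atTop (nhds k) := by
  have hright : Filter.Tendsto (fun s => k * E.finProj s) Filter.atTop (nhds k) := by
    simpa only [Function.comp_def, star_mul, star_star, E.star_finProj] using
      (continuous_star.tendsto _).comp (E.tendsto_finProj_mul (star k))
  have hzero : Filter.Tendsto (fun s => E.finProj s * (k * E.finProj s - k))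
      Filter.atTop (nhds 0) := by
    refine squeeze_zero_norm (fun s => ?_) (tendsto_iff_norm_sub_tendsto_zero.mp hright)
    exact (norm_mul_le _ _).trans (mul_le_of_le_one_left (norm_nonneg _) (E.norm_finProj_le s))
  refine (by simpa only [zero_add] using hzero.add (E.tendsto_finProj_mul k) :
    Filter.Tendsto (fun s => E.finProj s * (k * E.finProj s - k) + E.finProj s * k)
      Filter.atTop (nhds k)).congr fun s => ?_
  noncomm_ring

section CompactOperators

open InnerProductSpace

lemma isCompactOperator_rankOne {𝕜 E F : Type*} [RCLike 𝕜] [NormedAddCommGroup E]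
    [InnerProductSpace 𝕜 E] [NormedAddCommGroup F] [InnerProductSpace 𝕜 F] (x : E) (y : F) :
    IsCompactOperator (rankOne 𝕜 x y) :=
  (isCompactOperator_of_locallyCompactSpace_dom (innerSL 𝕜 y)).clm_comp
    (ContinuousLinearMap.toSpanSingleton 𝕜 x)

lemma tendsto_comp_of_isCompactOperator {α 𝕜 E F : Type*} [RCLike 𝕜] [NormedAddCommGroup E]
    [NormedSpace 𝕜 E] [NormedAddCommGroup F] [NormedSpace 𝕜 F] {l : Filter α}
    {P : α → F →L[𝕜] F} (hP : ∀ a, ‖P a‖ ≤ 1)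
    (hP_tendsto : ∀ y, Filter.Tendsto (fun a => P a y) l (nhds y)) {k : E →L[𝕜] F}
    (hk : IsCompactOperator k) : Filter.Tendsto (fun a => (P a).comp k) l (nhds k) := by
  rw [Metric.tendsto_nhds]
  intro ε hε
  have hbdd : TotallyBounded (k '' Metric.closedBall 0 1) :=
    ((IsCompactOperator.isCompact_closure_image_closedBall
      (f := (k : E →ₗ[𝕜] F)) hk 1).totallyBounded).subset subset_closure
  obtain ⟨t, ht, hcover⟩ := Metric.totallyBounded_iff.mp hbdd (ε / 4) (by positivity)
  have hnear : ∀ᶠ a in l, ∀ y ∈ t, dist (P a y) y < ε / 4 :=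
    (Filter.eventually_all_finite ht).mpr fun y _ =>
      Metric.tendsto_nhds.mp (hP_tendsto y) _ (by positivity)
  filter_upwards [hnear] with a ha
  have hle : ‖(P a).comp k - k‖ ≤ 3 * (ε / 4) := by
    refine ContinuousLinearMap.opNorm_le_of_unit_norm (𝕜 := 𝕜) (by positivity) fun x hx => ?_
    obtain ⟨y, hy, hxy⟩ := Set.mem_iUnion₂.mp (hcover ⟨x, by simp [hx], rfl⟩)
    have hxy : dist (k x) y < ε / 4 := hxy
    have hPxy : dist (P a (k x)) (P a y) ≤ dist (k x) y :=
      ((P a).dist_le_opNorm _ _).trans (mul_le_of_le_one_left dist_nonneg (hP a))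
    calc ‖((P a).comp k - k) x‖ = dist (P a (k x)) (k x) := (dist_eq_norm _ _).symm
      _ ≤ dist (P a (k x)) (P a y) + dist (P a y) y + dist y (k x) := dist_triangle4 _ _ _ _
      _ ≤ 3 * (ε / 4) := by linarith [ha y hy, dist_comm y (k x)]
  rw [dist_eq_norm]
  linarith

variable {ι H : Type*} [NormedAddCommGroup H] [InnerProductSpace ℂ H] [CompleteSpace H]

/-- The matrix units of `𝓚(H)` with respect to a Hilbert basis of `H`. -/
noncomputable def MatrixUnits.ofHilbertBasis (b : HilbertBasis ι ℂ H) :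
    MatrixUnits ι (compactOperators H) where
  e i j := ⟨rankOne ℂ (b i) (b j), isCompactOperator_rankOne _ _⟩
  coeff i j :=
    { toFun := fun k => inner ℂ (b i) (k.1 (b j))
      map_add' := fun _ _ => inner_add_right _ _ _
      map_smul' := fun _ _ => inner_smul_right _ _ _ }
  ne_zero i j h := rankOne_ne_zero (b.orthonormal.ne_zero i) (b.orthonormal.ne_zero j)
    (congrArg Subtype.val h)
  e_mul_e i j k := Subtype.ext <| (rankOne_comp_rankOne _ _ _ _).trans <| by
    rw [inner_self_eq_norm_sq_to_K, b.orthonormal.norm_eq_one]; simp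
  e_mul_e_of_ne i j j' k h := Subtype.ext <| (rankOne_comp_rankOne _ _ _ _).trans <| by
    rw [b.orthonormal.inner_eq_zero h, zero_smul]; rfl
  star_e i j := Subtype.ext (adjoint_rankOne _ _)
  e_mul_mul_e i i' j j' k := Subtype.ext <| by
    change ((rankOne ℂ (b i) (b i')).comp k.1).comp (rankOne ℂ (b j) (b j')) = _
    rw [ContinuousLinearMap.comp_assoc, comp_rankOne]
    exact rankOne_comp_rankOne _ _ _ _

lemma MatrixUnits.ofHilbertBasis_finProj_apply (b : HilbertBasis ι ℂ H) (s : Finset ι) (x : H) :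
    ((ofHilbertBasis b).finProj s).1 x = ∑ i ∈ s, b.repr x i • b i := by
  have hcoe : ((ofHilbertBasis b).finProj s).1 = ∑ i ∈ s, rankOne ℂ (b i) (b i) :=
    map_sum (NonUnitalStarSubalgebraClass.subtype (compactOperators H)) _ _
  simp only [hcoe, sum_apply, rankOne_apply, b.repr_apply_apply]

/-- The matrix units of `𝓚(H)` with respect to a Hilbert basis of `H`, as a complete system. -/
noncomputable def CompleteMatrixUnits.ofHilbertBasis (b : HilbertBasis ι ℂ H) :
    CompleteMatrixUnits ι (compactOperators H) where
  toMatrixUnits := MatrixUnits.ofHilbertBasis b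
  tendsto_finProj_mul k := tendsto_subtype_rng.mpr <|
    tendsto_comp_of_isCompactOperator (P := fun s => ((MatrixUnits.ofHilbertBasis b).finProj s).1)
      (MatrixUnits.ofHilbertBasis b).norm_finProj_le
      (fun x => (b.hasSum_repr x).congr fun s => by rw [MatrixUnits.ofHilbertBasis_finProj_apply])
      k.2

variable (H) in
lemma exists_nonempty_completeMatrixUnits_compactOperators [Nontrivial H] :
    ∃ w : Set H, Nonempty w ∧ Nonempty (CompleteMatrixUnits w (compactOperators H)) := by
  obtain ⟨w, b, -⟩ := exists_hilbertBasis ℂ H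
  refine ⟨w, ?_, ⟨.ofHilbertBasis b⟩⟩
  by_contra hw
  rw [not_nonempty_iff] at hw
  have := b.repr.injective.subsingleton
  exact not_subsingleton H this

end CompactOperators

/-! ### Elementary tensors and functoriality -/

namespace CStarTensor

section Tmul

variable {A B : Type*} [NonUnitalCStarAlgebra A] [NonUnitalCStarAlgebra B]

lemma norm_tmul (a : A) (b : B) : ‖tmul a b‖ = maxNorm (a ⊗ₜ[ℂ] b) := norm_ofAlg _

lemma norm_tmul_le (a : A) (b : B) : ‖tmul a b‖ ≤ ‖a‖ * ‖b‖ := by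
  rw [norm_tmul]
  exact ciSup_le fun p => p.tmul_le' a b

variable (A B) in
/-- The elementary tensors as a bilinear map. -/
noncomputable def tmulLin : A →ₗ[ℂ] B →ₗ[ℂ] CStarTensor A B :=
  (TensorProduct.mk ℂ A B).compr₂ (ofAlg (A := A) (B := B)).toLinearMap

lemma add_tmul (a a' : A) (b : B) : tmul (a + a') b = tmul a b + tmul a' b :=
  (tmulLin A B).map_add₂ a a' b

lemma smul_tmul (c : ℂ) (a : A) (b : B) : tmul (c • a) b = c • tmul a b :=
  (tmulLin A B).map_smul₂ c a b

lemma zero_tmul (b : B) : tmul (0 : A) b = 0 := (tmulLin A B).map_zero₂ b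

lemma tmul_smul (c : ℂ) (a : A) (b : B) : tmul a (c • b) = c • tmul a b :=
  (tmulLin A B a).map_smul c b

variable (A) in
/-- The map `a ↦ a ⊗ b`. -/
noncomputable def tmulRight (b : B) : A →L[ℂ] CStarTensor A B :=
  ((tmulLin A B).flip b).mkContinuous ‖b‖ fun a => (norm_tmul_le a b).trans_eq (mul_comm _ _)

lemma tmulRight_apply (b : B) (a : A) : tmulRight A b a = tmul a b := rfl

/-- The map `b ↦ a ⊗ b`. -/
noncomputable def tmulLeft (a : A) : B →L[ℂ] CStarTensor A B :=
  (tmulLin A B a).mkContinuous ‖a‖ fun b => norm_tmul_le a b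

lemma tmulLeft_apply (a : A) (b : B) : tmulLeft a b = tmul a b := rfl

end Tmul

section Map

variable {A B K : Type*} [NonUnitalCStarAlgebra A] [NonUnitalCStarAlgebra B]
  [NonUnitalCStarAlgebra K] (φ : A →⋆ₙₐ[ℂ] B)

variable (K) in
/-- The map `φ ⊗ id` on the algebraic tensor products. -/
noncomputable def algMap : A ⊗[ℂ] K →ₗ[ℂ] B ⊗[ℂ] K :=
  TensorProduct.map (φ : A →ₗ[ℂ] B) LinearMap.id

lemma algMap_tmul (a : A) (k : K) : algMap K φ (a ⊗ₜ k) = φ a ⊗ₜ k := rfl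

lemma algMap_mul (x y : A ⊗[ℂ] K) : algMap K φ (x * y) = algMap K φ x * algMap K φ y := by
  induction x with
  | zero => simp
  | add x x' hx hx' => rw [add_mul, map_add, map_add, add_mul, hx, hx']
  | tmul a k =>
    induction y with
    | zero => simp
    | add y y' hy hy' => rw [mul_add, map_add, map_add, mul_add, hy, hy']
    | tmul b l => simp only [Algebra.TensorProduct.tmul_mul_tmul, algMap_tmul, map_mul]

lemma algMap_star (x : A ⊗[ℂ] K) : algMap K φ (star x) = star (algMap K φ x) := by
  induction x with
  | zero => simp
  | add x x' hx hx' => rw [star_add, map_add, map_add, star_add, hx, hx']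
  | tmul a k => simp only [TensorProduct.star_tmul, algMap_tmul, map_star]

/-- The pullback of a C⋆-seminorm along `φ ⊗ id`. -/
noncomputable def seminormComp (p : CStarSeminorm B K) : CStarSeminorm A K where
  __ := p.toSeminorm.comp (algMap K φ)
  mul_le' x y := (congrArg p.toSeminorm (algMap_mul φ x y)).trans_le (p.mul_le' _ _)
  star_mul_self' x := by
    have h : algMap K φ (star x * x) = star (algMap K φ x) * algMap K φ x := by
      rw [algMap_mul, algMap_star]
    exact (congrArg p.toSeminorm h).trans (p.star_mul_self' _)
  tmul_le' a k := (p.tmul_le' (φ a) k).trans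
    (mul_le_mul_of_nonneg_right (NonUnitalStarAlgHom.norm_apply_le φ a) (norm_nonneg k))

lemma maxNorm_algMap_le (x : A ⊗[ℂ] K) : maxNorm (algMap K φ x) ≤ maxNorm x :=
  ciSup_le fun p => (seminormComp φ p).le_maxNorm x

/-- The extension of `φ ⊗ id` to the completions, as a continuous linear map. -/
noncomputable def mapL : CStarTensor A K →L[ℂ] CStarTensor B K :=
  LinearMap.extendOfNorm (((ofAlg (A := B) (B := K)).toLinearMap ∘ₗ algMap K φ :
    A ⊗[ℂ] K →ₗ[ℂ] CStarTensor B K) : AlgTensor A K →ₗ[ℂ] CStarTensor B K)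
    (ofAlg (A := A) (B := K)).toLinearMap

lemma mapL_ofAlg (x : AlgTensor A K) :
    mapL φ (ofAlg x) = ofAlg (algMap K φ x : AlgTensor B K) := by
  refine LinearMap.extendOfNorm_eq (e := (ofAlg (A := A) (B := K)).toLinearMap)
    denseRange_ofAlg ⟨1, fun x => ?_⟩ x
  rw [one_mul]
  calc ‖ofAlg (algMap K φ x : AlgTensor B K)‖ = maxNorm (algMap K φ x) := norm_ofAlg _
    _ ≤ maxNorm x := maxNorm_algMap_le φ x
    _ = ‖ofAlg x‖ := (norm_ofAlg x).symm

variable (K) in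
/-- The ⋆-homomorphism `φ ⊗ id`. -/
noncomputable def map : CStarTensor A K →⋆ₙₐ[ℂ] CStarTensor B K where
  toFun := mapL φ
  map_smul' := map_smul (mapL φ)
  map_zero' := map_zero (mapL φ)
  map_add' := map_add (mapL φ)
  map_mul' x y := by
    induction x using induction_on with
    | hp => exact isClosed_eq (by fun_prop) (by fun_prop)
    | ih x =>
      induction y using induction_on with
      | hp => exact isClosed_eq (by fun_prop) (by fun_prop)
      | ih y =>
        rw [← ofAlg_mul, mapL_ofAlg, mapL_ofAlg, mapL_ofAlg]
        exact (congrArg ofAlg (algMap_mul φ x y)).trans (ofAlg_mul (A := B) (B := K) _ _)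
  map_star' x := by
    induction x using induction_on with
    | hp => exact isClosed_eq (by fun_prop) (by fun_prop)
    | ih x =>
      rw [← ofAlg_star, mapL_ofAlg, mapL_ofAlg]
      exact (congrArg ofAlg (algMap_star φ x)).trans (ofAlg_star (A := B) (B := K) _)

lemma map_tmul (a : A) (k : K) : map K φ (tmul a k) = tmul (φ a) k :=
  mapL_ofAlg φ (a ⊗ₜ[ℂ] k : A ⊗[ℂ] K)

end Map

end CStarTensor

/-! ### The norm of elementary tensors with matrix units -/

namespace CStarSeminorm

variable {A B α : Type*} [NonUnitalCStarAlgebra A] [NonUnitalCStarAlgebra B] {C : α → Type*}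
  [∀ s, NonUnitalCStarAlgebra (C s)] {Φ : ∀ s, A ⊗[ℂ] B →ₗ[ℂ] C s} {l : Filter α}

lemma tendsto_map_mul_sub_of_tmul
    (h : ∀ a a' b b', Filter.Tendsto (fun s => ‖Φ s (a ⊗ₜ b * a' ⊗ₜ b') -
      Φ s (a ⊗ₜ b) * Φ s (a' ⊗ₜ b')‖) l (nhds 0)) (x y : A ⊗[ℂ] B) :
    Filter.Tendsto (fun s => ‖Φ s (x * y) - Φ s x * Φ s y‖) l (nhds 0) := by
  have add_of_eq : ∀ {f g k : ∀ s, C s}, (∀ s, f s = g s + k s) →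
      Filter.Tendsto (fun s => ‖g s‖) l (nhds 0) → Filter.Tendsto (fun s => ‖k s‖) l (nhds 0) →
      Filter.Tendsto (fun s => ‖f s‖) l (nhds 0) := fun hf hg hk =>
    squeeze_zero (fun _ => norm_nonneg _) (fun s => hf s ▸ norm_add_le _ _)
      (by simpa only [add_zero] using hg.add hk)
  induction x with
  | zero => simp [tendsto_const_nhds]
  | add x x' hx hx' =>
    exact add_of_eq (fun s => by simp only [add_mul, map_add]; abel) hx hx'
  | tmul a b =>
    induction y with
    | zero => simp [tendsto_const_nhds]
    | add y y' hy hy' =>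
      exact add_of_eq (fun s => by simp only [mul_add, map_add]; abel) hy hy'
    | tmul a' b' => exact h a a' b b'

lemma exists_forall_norm_map_le (hΦ : ∀ s a b, ‖Φ s (a ⊗ₜ b)‖ ≤ ‖a‖ * ‖b‖) (x : A ⊗[ℂ] B) :
    ∃ c, ∀ s, ‖Φ s x‖ ≤ c := by
  induction x with
  | zero => exact ⟨0, fun s => by simp⟩
  | tmul a b => exact ⟨_, fun s => hΦ s a b⟩
  | add x y hx hy =>
    obtain ⟨c, hc⟩ := hx
    obtain ⟨d, hd⟩ := hy
    exact ⟨c + d, fun s => map_add (Φ s) x y ▸ norm_add_le_of_le (hc s) (hd s)⟩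

lemma tendsto_norm_map_ultrafilter (hΦ : ∀ s a b, ‖Φ s (a ⊗ₜ b)‖ ≤ ‖a‖ * ‖b‖)
    (U : Ultrafilter α) (x : A ⊗[ℂ] B) : Filter.Tendsto (fun s => ‖Φ s x‖) U
      (nhds (Filter.limUnder (U : Filter α) fun s => ‖Φ s x‖)) := by
  obtain ⟨c, hc⟩ := exists_forall_norm_map_le hΦ x
  obtain ⟨r, -, hr⟩ := (isCompact_Icc (a := 0) (b := c)).ultrafilter_le_nhds
    (U.map fun s => ‖Φ s x‖) (Filter.tendsto_principal.mpr <|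
      Filter.Eventually.of_forall fun s => ⟨norm_nonneg _, hc s⟩)
  exact tendsto_nhds_limUnder ⟨r, hr⟩

/-- The C⋆-seminorm `x ↦ lim ‖Φ s x‖` defined by a family of linear maps into C⋆-algebras that
preserve adjoints and are multiplicative in the limit, where the limit is taken along an
ultrafilter. -/
noncomputable def ultralimit (U : Ultrafilter α) (hΦ : ∀ s a b, ‖Φ s (a ⊗ₜ b)‖ ≤ ‖a‖ * ‖b‖)
    (hstar : ∀ s x, Φ s (star x) = star (Φ s x))
    (hmul : ∀ x y, Filter.Tendsto (fun s => ‖Φ s (x * y) - Φ s x * Φ s y‖) U (nhds 0)) :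
    CStarSeminorm A B :=
  have hlim := tendsto_norm_map_ultrafilter hΦ U
  { Seminorm.of (fun x => Filter.limUnder (U : Filter α) fun s => ‖Φ s x‖)
      (fun x y => le_of_tendsto_of_tendsto' (hlim (x + y)) ((hlim x).add (hlim y)) fun s =>
        map_add (Φ s) x y ▸ norm_add_le _ _)
      (fun c x => tendsto_nhds_unique (hlim (c • x)) (((hlim x).const_mul ‖c‖).congr fun s => by
        rw [map_smul, norm_smul])) with
    mul_le' := fun x y => by
      have hsum := (hmul x y).add ((hlim x).mul (hlim y))
      rw [zero_add] at hsum
      refine le_of_tendsto_of_tendsto' (hlim (x * y)) hsum fun s => ?_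
      calc ‖Φ s (x * y)‖ ≤ ‖Φ s (x * y) - Φ s x * Φ s y‖ + ‖Φ s x * Φ s y‖ := by
            simpa only [sub_add_cancel] using
              norm_add_le (Φ s (x * y) - Φ s x * Φ s y) (Φ s x * Φ s y)
        _ ≤ _ := by gcongr; exact norm_mul_le _ _
    star_mul_self' := fun x => by
      have hdiff : Filter.Tendsto (fun s => ‖Φ s (star x * x)‖ - ‖Φ s x‖ * ‖Φ s x‖) U
          (nhds 0) := by
        refine squeeze_zero_norm (fun s => ?_) (hmul (star x) x)
        rw [← CStarRing.norm_star_mul_self, hstar]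
        exact abs_norm_sub_norm_le _ _
      have hsum := hdiff.add ((hlim x).mul (hlim x))
      rw [zero_add] at hsum
      exact tendsto_nhds_unique (hlim (star x * x)) (hsum.congr fun s => sub_add_cancel _ _)
    tmul_le' := fun a b => le_of_tendsto' (hlim _) fun s => hΦ s a b }

lemma tendsto_ultralimit {U : Ultrafilter α} (hΦ : ∀ s a b, ‖Φ s (a ⊗ₜ b)‖ ≤ ‖a‖ * ‖b‖)
    (hstar : ∀ s x, Φ s (star x) = star (Φ s x))
    (hmul : ∀ x y, Filter.Tendsto (fun s => ‖Φ s (x * y) - Φ s x * Φ s y‖) U (nhds 0))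
    (x : A ⊗[ℂ] B) : Filter.Tendsto (fun s => ‖Φ s x‖) U
      (nhds ((ultralimit U hΦ hstar hmul).toSeminorm x)) :=
  tendsto_norm_map_ultrafilter hΦ U x

end CStarSeminorm

namespace MatrixUnits

variable {ι K : Type*} [NonUnitalCStarAlgebra K] (E : MatrixUnits ι K) (s : Finset ι)

/-- The corner `P K P` of `K` cut out by `P = finProj s`, encoded as `{k | P k = k ∧ k P = k}`. -/
noncomputable def corner : NonUnitalStarSubalgebra ℂ K where
  carrier := {k | E.finProj s * k = k ∧ k * E.finProj s = k}
  add_mem' hx hy := ⟨by rw [mul_add, hx.1, hy.1], by rw [add_mul, hx.2, hy.2]⟩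
  zero_mem' := ⟨mul_zero _, zero_mul _⟩
  mul_mem' hx hy := ⟨by rw [← mul_assoc, hx.1], by rw [mul_assoc, hy.2]⟩
  smul_mem' c x hx := ⟨by rw [mul_smul_comm, hx.1], by rw [smul_mul_assoc, hx.2]⟩
  star_mem' {x} hx :=
    ⟨by rw [← E.star_finProj, ← star_mul, hx.2], by rw [← E.star_finProj, ← star_mul, hx.1]⟩

instance isClosed_corner : IsClosed (E.corner s : Set K) :=
  (isClosed_eq (continuous_const_mul _) continuous_id).inter
    (isClosed_eq (continuous_mul_const _) continuous_id)

lemma finProj_mul_mul_finProj_mem_corner (k : K) :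
    E.finProj s * k * E.finProj s ∈ E.corner s :=
  ⟨by rw [← mul_assoc, ← mul_assoc, E.finProj_mul_self], by rw [mul_assoc, E.finProj_mul_self]⟩

lemma norm_finProj_mul_mul_finProj_le (k : K) : ‖E.finProj s * k * E.finProj s‖ ≤ ‖k‖ :=
  calc ‖E.finProj s * k * E.finProj s‖ ≤ ‖E.finProj s * k‖ :=
        (norm_mul_le _ _).trans (mul_le_of_le_one_right (norm_nonneg _) (E.norm_finProj_le s))
    _ ≤ ‖k‖ := (norm_mul_le _ _).trans (mul_le_of_le_one_left (norm_nonneg _) (E.norm_finProj_le s))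

section Compression

variable (A : Type*) [NonUnitalCStarAlgebra A]

/-- The compression `a ⊗ k ↦ (kᵢⱼ a)ᵢⱼ` of `A ⊗ K` to matrices over `A` with indices in the finite
set `s`. -/
noncomputable def compression : A ⊗[ℂ] K →ₗ[ℂ] CStarMatrix s s A :=
  TensorProduct.lift <| LinearMap.mk₂ ℂ
    (fun a k => CStarMatrix.ofMatrix (Matrix.of fun i j => E.coeff i j k • a))
    (fun a b k => by ext i j; exact smul_add _ _ _) (fun c a k => by ext i j; exact smul_comm _ _ _)
    (fun a k l => by
      ext i j
      exact (congrArg (· • a) (map_add _ k l)).trans (add_smul _ _ _))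
    (fun c a k => by
      ext i j
      exact (congrArg (· • a) (map_smul _ c k)).trans (smul_assoc _ _ _))

variable {A}

lemma compression_tmul_apply (a : A) (k : K) (i j : s) :
    E.compression s A (a ⊗ₜ k) i j = E.coeff i j k • a := rfl

lemma compression_tmul_mul (a b : A) (k l : K) :
    E.compression s A (a ⊗ₜ k) * E.compression s A (b ⊗ₜ l) =
      E.compression s A ((a * b) ⊗ₜ (k * E.finProj s * l)) := by
  ext i j
  simp only [CStarMatrix.mul_apply, compression_tmul_apply, E.coeff_mul_finProj_mul,
    smul_mul_smul_comm, Finset.sum_smul, Finset.sum_coe_sort s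
      fun m => (E.coeff i m k * E.coeff m j l) • (a * b)]

lemma compression_star (x : A ⊗[ℂ] K) :
    E.compression s A (star x) = star (E.compression s A x) := by
  induction x with
  | zero => simp
  | add x y hx hy => rw [star_add, map_add, map_add, star_add, hx, hy]
  | tmul a k =>
    ext i j
    simp only [TensorProduct.star_tmul, CStarMatrix.star_apply, compression_tmul_apply,
      E.coeff_star, star_smul]

lemma compression_tmul_finProj_mul_mul_finProj (a : A) (k : K) :
    E.compression s A (a ⊗ₜ (E.finProj s * k * E.finProj s)) = E.compression s A (a ⊗ₜ k) := by
  ext i j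
  rw [compression_tmul_apply, compression_tmul_apply, E.coeff_finProj_mul_mul_finProj k i.2 j.2]

end Compression

section Unital

variable (A : Type*) [CStarAlgebra A]

/-- The diagonal embedding `a ↦ diag (a, …, a)`, obtained by compressing `a ⊗ finProj s`. -/
noncomputable def diagonalHom : A →⋆ₙₐ[ℂ] CStarMatrix s s A where
  toFun a := E.compression s A (a ⊗ₜ E.finProj s)
  map_smul' c a := by rw [← TensorProduct.smul_tmul', map_smul]; rfl
  map_zero' := by rw [TensorProduct.zero_tmul, map_zero]
  map_add' a b := by rw [TensorProduct.add_tmul, map_add]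
  map_mul' a b := by rw [compression_tmul_mul, E.finProj_mul_self, E.finProj_mul_self]
  map_star' a := by rw [← compression_star, TensorProduct.star_tmul, E.star_finProj]

/-- The embedding `k ↦ (kᵢⱼ)ᵢⱼ` of a corner of `K` into the scalar matrices. -/
noncomputable def scalarHom : E.corner s →⋆ₙₐ[ℂ] CStarMatrix s s A where
  toFun k := E.compression s A (1 ⊗ₜ (k : K))
  map_smul' c k := by
    rw [NonUnitalStarSubalgebra.coe_smul, TensorProduct.tmul_smul, map_smul]; rfl
  map_zero' := by rw [ZeroMemClass.coe_zero, TensorProduct.tmul_zero, map_zero]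
  map_add' k l := by rw [AddMemClass.coe_add, TensorProduct.tmul_add, map_add]
  map_mul' k l := by rw [compression_tmul_mul, one_mul, k.2.2, MulMemClass.coe_mul]
  map_star' k := by
    rw [← compression_star, TensorProduct.star_tmul, star_one, StarMemClass.coe_star]

variable {A} [PartialOrder A] [StarOrderedRing A]

lemma norm_compression_tmul_le (a : A) (k : K) : ‖E.compression s A (a ⊗ₜ k)‖ ≤ ‖a‖ * ‖k‖ := by
  let k' : E.corner s := ⟨_, E.finProj_mul_mul_finProj_mem_corner s k⟩
  have hfactor : E.compression s A (a ⊗ₜ k) = E.diagonalHom s A a * E.scalarHom s A k' :=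
    calc E.compression s A (a ⊗ₜ k) = E.compression s A (a ⊗ₜ (k' : K)) :=
          (E.compression_tmul_finProj_mul_mul_finProj s a k).symm
      _ = E.compression s A ((a * 1) ⊗ₜ (E.finProj s * E.finProj s * k')) := by
          rw [mul_one, E.finProj_mul_self, k'.2.1]
      _ = _ := (E.compression_tmul_mul s a 1 _ _).symm
  calc ‖E.compression s A (a ⊗ₜ k)‖ ≤ ‖E.diagonalHom s A a‖ * ‖E.scalarHom s A k'‖ :=
        hfactor ▸ norm_mul_le _ _
    _ ≤ ‖a‖ * ‖k'‖ := by gcongr <;> exact NonUnitalStarAlgHom.norm_apply_le _ _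
    _ ≤ ‖a‖ * ‖k‖ := by gcongr; exact E.norm_finProj_mul_mul_finProj_le s k

end Unital

end MatrixUnits

namespace CompleteMatrixUnits

variable {ι K : Type*} [NonUnitalCStarAlgebra K] (E : CompleteMatrixUnits ι K)

section Unital

variable {A : Type*} [CStarAlgebra A] [PartialOrder A] [StarOrderedRing A]

lemma tendsto_compression_mul (x y : A ⊗[ℂ] K) : Filter.Tendsto
    (fun s => ‖E.compression s A (x * y) - E.compression s A x * E.compression s A y‖)
      Filter.atTop (nhds 0) := by
  refine CStarSeminorm.tendsto_map_mul_sub_of_tmul (fun a b k l => ?_) x y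
  have hbound : Filter.Tendsto (fun s => ‖a * b‖ * (‖k‖ * ‖l - E.finProj s * l‖)) Filter.atTop
      (nhds 0) := by
    simpa only [sub_self, norm_zero, mul_zero] using
      (((E.tendsto_finProj_mul l).const_sub l).norm.const_mul ‖k‖).const_mul ‖a * b‖
  refine squeeze_zero (fun s => norm_nonneg _) (fun s => ?_) hbound
  calc ‖E.compression s A (a ⊗ₜ k * b ⊗ₜ l) -
        E.compression s A (a ⊗ₜ k) * E.compression s A (b ⊗ₜ l)‖
      = ‖E.compression s A ((a * b) ⊗ₜ (k * (l - E.finProj s * l)))‖ := by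
        rw [Algebra.TensorProduct.tmul_mul_tmul, E.compression_tmul_mul, ← map_sub,
          ← TensorProduct.tmul_sub, mul_sub, mul_assoc]
    _ ≤ ‖a * b‖ * (‖k‖ * ‖l - E.finProj s * l‖) :=
        (E.norm_compression_tmul_le s _ _).trans (by gcongr; exact norm_mul_le _ _)

lemma norm_le_norm_tmul_of_unital (a : A) (i j : ι) : ‖a‖ ≤ ‖CStarTensor.tmul a (E.e i j)‖ := by
  let U := Ultrafilter.of (Filter.atTop : Filter (Finset ι))
  have hΦ (s : Finset ι) (a : A) (k : K) := E.norm_compression_tmul_le s a k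
  have hstar (s : Finset ι) (x : A ⊗[ℂ] K) := E.compression_star s x
  have hmul (x y : A ⊗[ℂ] K) := (E.tendsto_compression_mul x y).mono_left (Ultrafilter.of_le _)
  have hij : ∀ᶠ s in (U : Filter (Finset ι)), i ∈ s ∧ j ∈ s := by
    refine Ultrafilter.of_le _ ?_
    filter_upwards [Filter.eventually_ge_atTop {i}, Filter.eventually_ge_atTop {j}] with s hi hj
    exact ⟨Finset.singleton_subset_iff.mp hi, Finset.singleton_subset_iff.mp hj⟩
  calc ‖a‖ ≤ (CStarSeminorm.ultralimit U hΦ hstar hmul).toSeminorm (a ⊗ₜ E.e i j) := by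
        refine ge_of_tendsto (CStarSeminorm.tendsto_ultralimit hΦ hstar hmul _) ?_
        filter_upwards [hij] with s hs
        have hentry : E.compression s A (a ⊗ₜ E.e i j) ⟨i, hs.1⟩ ⟨j, hs.2⟩ = a := by
          rw [E.compression_tmul_apply, E.coeff_e, one_smul]
        exact (congrArg norm hentry).symm.trans_le CStarMatrix.norm_entry_le_norm
    _ ≤ ‖CStarTensor.tmul a (E.e i j)‖ :=
        (CStarSeminorm.le_maxNorm _ _).trans_eq (CStarTensor.norm_tmul _ _).symm

end Unital

lemma norm_le_norm_tmul {A : Type*} [NonUnitalCStarAlgebra A] (a : A) (i j : ι) :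
    ‖a‖ ≤ ‖CStarTensor.tmul a (E.e i j)‖ := by
  let _ := CStarAlgebra.spectralOrder (Unitization ℂ A)
  have _ := CStarAlgebra.spectralOrderedRing (Unitization ℂ A)
  let φ := Unitization.inrNonUnitalStarAlgHom ℂ A
  calc ‖a‖ = ‖φ a‖ := (Unitization.norm_inr a).symm
    _ ≤ ‖CStarTensor.tmul (φ a) (E.e i j)‖ := E.norm_le_norm_tmul_of_unital _ i j
    _ = ‖CStarTensor.map K φ (CStarTensor.tmul a (E.e i j))‖ := by rw [CStarTensor.map_tmul]
    _ ≤ ‖CStarTensor.tmul a (E.e i j)‖ := NonUnitalStarAlgHom.norm_apply_le _ _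

end CompleteMatrixUnits

/-! ### Ideals of the tensor product with an algebra with matrix units -/

section ApproximateUnit

variable {A : Type*} [NonUnitalCStarAlgebra A] {M : Submodule ℂ A} {a : A}

lemma mem_of_forall_mul_mul_star_mem (hM : IsClosed (M : Set A)) (h : ∀ u, u * a * star u ∈ M) :
    a ∈ M := by
  let _ := CStarAlgebra.spectralOrder A
  have _ := CStarAlgebra.spectralOrderedRing A
  have hl := CStarAlgebra.increasingApproximateUnit A
  have : (CStarAlgebra.approximateUnit A).NeBot := hl.neBot
  have hzero : Filter.Tendsto (fun u : A => (u * a - a) * u) (CStarAlgebra.approximateUnit A)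
      (nhds 0) := by
    refine squeeze_zero_norm' (a := fun u => ‖u * a - a‖) ?_ ?_
    · filter_upwards [hl.eventually_norm] with u hu
      exact (norm_mul_le _ _).trans (mul_le_of_le_one_right (norm_nonneg _) hu)
    · exact tendsto_iff_norm_sub_tendsto_zero.mp (hl.tendsto_mul_right a)
  have hlim : Filter.Tendsto (fun u : A => (u * a - a) * u + a * u)
      (CStarAlgebra.approximateUnit A) (nhds a) := by
    simpa only [zero_add] using hzero.add (hl.tendsto_mul_left a)
  refine hM.mem_of_tendsto hlim ?_
  filter_upwards [hl.eventually_star_eq] with u hu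
  simpa only [sub_mul, sub_add_cancel, hu, SetLike.mem_coe] using h u

lemma mem_of_forall_mul_mul_mem {S : Set A} (hS : Dense (Submodule.span ℂ S : Set A))
    (hM : IsClosed (M : Set A)) (h : ∀ s ∈ S, ∀ t ∈ S, s * a * t ∈ M) : a ∈ M := by
  have hleft : ∀ t ∈ S, ∀ x : A, x * a * t ∈ M := fun t ht x => by
    have hspan : Submodule.span ℂ S ≤
        M.comap (LinearMap.mulRight ℂ t ∘ₗ LinearMap.mulRight ℂ a) :=
      Submodule.span_le.mpr fun s hs => h s hs t ht
    exact (hM.preimage ((continuous_mul_const t).comp (continuous_mul_const a))).closure_subset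
      (closure_mono hspan (hS x))
  refine mem_of_forall_mul_mul_star_mem hM fun u => ?_
  have hspan : Submodule.span ℂ S ≤ M.comap (LinearMap.mulLeft ℂ (u * a)) :=
    Submodule.span_le.mpr fun t ht => hleft t ht u
  exact (hM.preimage (continuous_const_mul (u * a))).closure_subset
    (closure_mono hspan (hS (star u)))

end ApproximateUnit

namespace CStarTensor

open scoped CStarAlgebra

variable {A B K : Type*} [NonUnitalCStarAlgebra A] [NonUnitalCStarAlgebra B]
  [NonUnitalCStarAlgebra K]

lemma eq_top_of_forall_tmul_mem {M : Submodule ℂ (CStarTensor A K)}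
    (hM : IsClosed (M : Set (CStarTensor A K))) (h : ∀ a k, tmul a k ∈ M) : M = ⊤ := by
  rw [eq_top_iff, ← Submodule.dense_iff_topologicalClosure_eq_top.mp dense_span_tmul]
  refine Submodule.topologicalClosure_minimal _ (Submodule.span_le.mpr ?_) hM
  rintro _ ⟨a, k, rfl⟩
  exact h a k

lemma tmul_mem_tensor {I : ClosedIdeal A} {a : A} (ha : a ∈ I) (k : K) : tmul a k ∈ I.tensor K :=
  Submodule.le_topologicalClosure _ (Submodule.subset_span ⟨a, ha, k, rfl⟩)

lemma tensor_subset {I : ClosedIdeal A} {M : Submodule ℂ (CStarTensor A K)}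
    (hM : IsClosed (M : Set (CStarTensor A K))) (h : ∀ a ∈ I, ∀ k, tmul a k ∈ M) :
    (I.tensor K : Set (CStarTensor A K)) ⊆ M := by
  refine Submodule.topologicalClosure_minimal _ (Submodule.span_le.mpr ?_) hM
  rintro _ ⟨a, ha, k, rfl⟩
  exact h a ha k

lemma tensor_mono {I J : ClosedIdeal A} (h : (I : Set A) ⊆ J) :
    (I.tensor K : Set (CStarTensor A K)) ⊆ J.tensor K :=
  tensor_subset (M := (J.tensor K).toSubmodule) (J.tensor K).isClosed' fun _ ha k =>
    tmul_mem_tensor (h ha) k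

lemma tensor_eq_univ {I : ClosedIdeal A} (h : (I : Set A) = Set.univ) :
    (I.tensor K : Set (CStarTensor A K)) = Set.univ :=
  congrArg SetLike.coe <| eq_top_of_forall_tmul_mem (M := (I.tensor K).toSubmodule)
    (I.tensor K).isClosed' fun a k => tmul_mem_tensor (h.symm ▸ Set.mem_univ a : a ∈ (I : Set A)) k

lemma map_surjective {φ : A →⋆ₙₐ[ℂ] B} (hφ : Function.Surjective φ) :
    Function.Surjective (map K φ) := by
  refine LinearMap.range_eq_top (f := (map K φ : CStarTensor A K →ₗ[ℂ] CStarTensor B K)).mp ?_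
  refine eq_top_of_forall_tmul_mem (isClosed_range (map K φ)) fun b k => ?_
  obtain ⟨a, rfl⟩ := hφ b
  exact ⟨tmul a k, map_tmul φ a k⟩

variable {ι : Type*} (E : CompleteMatrixUnits ι K)

lemma isClosed_range_tmulRight_e (i j : ι) :
    IsClosed (Set.range (tmulRight A (E.e i j))) := by
  refine (AntilipschitzWith.isClosedEmbedding (K := 1) ?_
    (tmulRight A (E.e i j)).uniformContinuous).isClosed_range
  refine AddMonoidHomClass.antilipschitz_of_bound _ fun a => ?_
  simpa only [NNReal.coe_one, one_mul, tmulRight_apply] using E.norm_le_norm_tmul a i j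

lemma tmul_mem_of_forall_tmul_e_mem {M : Submodule ℂ (CStarTensor A K)}
    (hM : IsClosed (M : Set (CStarTensor A K))) {a : A} (h : ∀ i j, tmul a (E.e i j) ∈ M) (k : K) :
    tmul a k ∈ M := by
  refine hM.mem_of_tendsto (((tmulLeft a).continuous.tendsto k).comp
    (E.tendsto_finProj_mul_mul_finProj k)) (Filter.Eventually.of_forall fun s => ?_)
  simp only [Function.comp_apply, E.finProj_mul_mul_finProj, map_sum, map_smul, tmulLeft_apply]
  exact Submodule.sum_mem _ fun i _ => Submodule.sum_mem _ fun j _ => M.smul_mem _ (h i j)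

lemma eq_top_of_forall_tmul_e_mem {M : Submodule ℂ (CStarTensor A K)}
    (hM : IsClosed (M : Set (CStarTensor A K))) (h : ∀ a i j, tmul a (E.e i j) ∈ M) : M = ⊤ :=
  eq_top_of_forall_tmul_mem hM fun a => tmul_mem_of_forall_tmul_e_mem E hM (h a)

lemma dense_span_tmul_e :
    Dense (Submodule.span ℂ {x : CStarTensor A K | ∃ a i j, x = tmul a (E.e i j)} :
      Set (CStarTensor A K)) := by
  rw [Submodule.dense_iff_topologicalClosure_eq_top]
  exact eq_top_of_forall_tmul_e_mem E (Submodule.isClosed_topologicalClosure _) fun a i j =>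
    Submodule.le_topologicalClosure _ (Submodule.subset_span ⟨a, i, j, rfl⟩)

lemma exists_tmul_e_mul_mul_tmul_e_eq (x : CStarTensor A K) (u u' : A) (i k l j : ι) :
    ∃ b : A, tmul u (E.e i k) * x * tmul u' (E.e l j) = tmul b (E.e i j) := by
  let R : Submodule ℂ (CStarTensor A K) := LinearMap.range (tmulRight A (E.e i j)).toLinearMap
  let Λ : CStarTensor A K →ₗ[ℂ] CStarTensor A K :=
    LinearMap.mulRight ℂ (tmul u' (E.e l j)) ∘ₗ LinearMap.mulLeft ℂ (tmul u (E.e i k))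
  have hΛ : Continuous Λ := (continuous_mul_const (tmul u' (E.e l j))).comp
    (continuous_const_mul (tmul u (E.e i k)))
  have htop : R.comap Λ = ⊤ := by
    refine eq_top_of_forall_tmul_e_mem E ((isClosed_range_tmulRight_e E i j).preimage hΛ)
      fun a m n => ⟨E.coeff k l (E.e m n) • (u * a * u'), ?_⟩
    change tmul _ _ = tmul u (E.e i k) * tmul a (E.e m n) * tmul u' (E.e l j)
    rw [tmul_mul_tmul, tmul_mul_tmul, E.e_mul_mul_e, tmul_smul, smul_tmul]
  obtain ⟨b, hb⟩ : x ∈ R.comap Λ := htop ▸ Submodule.mem_top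
  exact ⟨b, hb.symm⟩

section CornerHom

variable (i₀ : ι)

/-- The embedding `a ↦ a ⊗ e i₀ i₀` of `A` as a full corner of `A ⊗ K`. -/
noncomputable def cornerHom : A →⋆ₙₐ[ℂ] CStarTensor A K where
  toFun a := tmul a (E.e i₀ i₀)
  map_smul' c a := smul_tmul c a _
  map_zero' := zero_tmul _
  map_add' a b := add_tmul a b _
  map_mul' a b := by rw [tmul_mul_tmul, E.e_mul_e]
  map_star' a := by rw [star_tmul, E.star_e]

lemma cornerHom_apply (a : A) : cornerHom E i₀ a = tmul a (E.e i₀ i₀) := rfl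

lemma cornerHom_injective : Function.Injective (cornerHom (A := A) E i₀) := by
  rw [injective_iff_map_eq_zero]
  intro a ha
  refine norm_le_zero_iff.mp ((E.norm_le_norm_tmul a i₀ i₀).trans_eq ?_)
  rw [← cornerHom_apply, ha, norm_zero]

lemma map_cornerHom (φ : A →⋆ₙₐ[ℂ] B) (a : A) :
    map K φ (cornerHom E i₀ a) = cornerHom E i₀ (φ a) :=
  map_tmul φ a _

lemma exists_cornerHom_mul_mul_cornerHom_eq (u u' : A) (x : CStarTensor A K) :
    ∃ b : A, cornerHom E i₀ u * x * cornerHom E i₀ u' = cornerHom E i₀ b :=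
  exists_tmul_e_mul_mul_tmul_e_eq E x u u' i₀ i₀ i₀ i₀

lemma tmul_e_mem_iff {N : ClosedIdeal (CStarTensor A K)} {a : A} (i j : ι) :
    tmul a (E.e i j) ∈ N ↔ cornerHom E i₀ a ∈ N := by
  have key : ∀ i j i' j', tmul a (E.e i j) ∈ N → tmul a (E.e i' j') ∈ N := by
    intro i j i' j' h
    refine mem_of_forall_mul_mul_star_mem
      (M := N.toSubmodule.comap (tmulRight A (E.e i' j')).toLinearMap)
      (N.isClosed'.preimage (tmulRight A (E.e i' j')).continuous) fun u => ?_
    have hmem : tmul u (E.e i' i) * tmul a (E.e i j) * tmul (star u) (E.e j j') ∈ N :=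
      N.mul_mem_right' _ (N.mul_mem_left' _ h)
    rwa [tmul_mul_tmul, tmul_mul_tmul, E.e_mul_e, E.e_mul_e] at hmem
  exact ⟨key _ _ _ _, key _ _ _ _⟩

lemma eq_tensor_comap_cornerHom (N : ClosedIdeal (CStarTensor A K)) :
    N = (N.comap (cornerHom E i₀)).tensor K := by
  refine SetLike.coe_injective (Set.Subset.antisymm (fun x hx => ?_) ?_)
  · refine mem_of_forall_mul_mul_mem (M := ((N.comap (cornerHom E i₀)).tensor K).toSubmodule)
      (dense_span_tmul_e E) ((N.comap (cornerHom E i₀)).tensor K).isClosed' ?_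
    rintro _ ⟨u, i, k, rfl⟩ _ ⟨u', l, j, rfl⟩
    obtain ⟨b, hb⟩ := exists_tmul_e_mul_mul_tmul_e_eq E x u u' i k l j
    have hN : tmul u (E.e i k) * x * tmul u' (E.e l j) ∈ N :=
      N.mul_mem_right' _ (N.mul_mem_left' _ hx)
    rw [hb] at hN ⊢
    exact tmul_mem_tensor (I := N.comap (cornerHom E i₀)) ((tmul_e_mem_iff E i₀ i j).mp hN) _
  · exact tensor_subset (M := N.toSubmodule) N.isClosed' fun a ha =>
      tmul_mem_of_forall_tmul_e_mem E N.isClosed' fun i j => (tmul_e_mem_iff E i₀ i j).mpr ha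

include E i₀ in
lemma ker_map (φ : A →⋆ₙₐ[ℂ] B) :
    ClosedIdeal.ker (map K φ) = (ClosedIdeal.ker φ).tensor K := by
  have hcomap : (ClosedIdeal.ker (map K φ)).comap (cornerHom E i₀) = ClosedIdeal.ker φ := by
    refine SetLike.ext fun a => ?_
    rw [ClosedIdeal.mem_comap, ClosedIdeal.mem_ker, ClosedIdeal.mem_ker, map_cornerHom,
      map_eq_zero_iff _ (cornerHom_injective E i₀)]
  rw [eq_tensor_comap_cornerHom E i₀ (ClosedIdeal.ker (map K φ)), hcomap]

include E i₀ in
lemma mem_tensor_iff_map_projHom_eq_zero (I : ClosedIdeal A) (x : CStarTensor A K) :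
    x ∈ I.tensor K ↔ map K I.projHom x = 0 := by
  rw [← ClosedIdeal.mem_ker, ker_map E i₀, I.ker_projHom]

lemma cornerHom_mem_tensor_iff {I : ClosedIdeal A} {a : A} :
    cornerHom E i₀ a ∈ I.tensor K ↔ a ∈ I := by
  rw [mem_tensor_iff_map_projHom_eq_zero E i₀, map_cornerHom,
    map_eq_zero_iff _ (cornerHom_injective E i₀), I.projHom_apply, I.proj_eq_zero_iff]

lemma eq_tensor_iff {N : ClosedIdeal (CStarTensor A K)} {I : ClosedIdeal A} :
    N = I.tensor K ↔ ∀ a, cornerHom E i₀ a ∈ N ↔ a ∈ I := by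
  constructor
  · rintro rfl a
    exact cornerHom_mem_tensor_iff E i₀
  · intro h
    rw [eq_tensor_comap_cornerHom E i₀ N]
    congr 1
    exact SetLike.ext h

include E i₀ in
lemma subset_of_tensor_subset {I J : ClosedIdeal A}
    (h : (I.tensor K : Set (CStarTensor A K)) ⊆ J.tensor K) : (I : Set A) ⊆ J := fun _ ha =>
  (cornerHom_mem_tensor_iff E i₀).mp (h ((cornerHom_mem_tensor_iff E i₀).mpr ha))

include E i₀ in
lemma zeroIdeal_tensor :
    (ClosedIdeal.zeroIdeal A).tensor K = ClosedIdeal.zeroIdeal (CStarTensor A K) :=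
  ((eq_tensor_iff E i₀).mpr fun _ => map_eq_zero_iff _ (cornerHom_injective E i₀)).symm

include E i₀ in
lemma closedSup_tensor {κ : Sort*} (F : κ → ClosedIdeal A) :
    (ClosedIdeal.closedSup F).tensor K = ClosedIdeal.closedSup fun i => (F i).tensor K := by
  refine SetLike.coe_injective (Set.Subset.antisymm ?_ ?_)
  · rw [eq_tensor_comap_cornerHom E i₀ (ClosedIdeal.closedSup fun i => (F i).tensor K)]
    refine tensor_mono (ClosedIdeal.closedSup_subset F fun i a ha => ?_)
    exact ClosedIdeal.subset_closedSup (fun i => (F i).tensor K) i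
      ((cornerHom_mem_tensor_iff E i₀).mpr ha)
  · exact ClosedIdeal.closedSup_subset _ fun i => tensor_mono (ClosedIdeal.subset_closedSup F i)

end CornerHom

end CStarTensor

/-! ### The Cantor–Bendixson derivative of an ideal of the tensor product -/

namespace CStarTensor

variable {A K ι : Type*} [NonUnitalCStarAlgebra A] [NonUnitalCStarAlgebra K]
  (E : CompleteMatrixUnits ι K) (i₀ : ι)

lemma isMinimalProjection_cornerHom_iff {p : A} :
    IsMinimalProjection (cornerHom E i₀ p) ↔ IsMinimalProjection p := by
  have hinj := cornerHom_injective (A := A) E i₀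
  constructor
  · intro h
    refine IsMinimalProjection.of_exists_smul ⟨?_, ?_⟩ ?_ fun a => ?_
    · exact hinj (by rw [map_mul, h.mul_self])
    · exact hinj (by rw [map_star, h.star_eq])
    · rintro rfl
      exact h.ne_zero (map_zero _)
    · obtain ⟨c, hc⟩ := h.exists_mul_mul_eq_smul (cornerHom E i₀ a)
      exact ⟨c, hinj (by rw [map_mul, map_mul, hc, map_smul])⟩
  · intro h
    refine IsMinimalProjection.of_exists_smul (h.isStarProjection.map (cornerHom E i₀))
      ((map_ne_zero_iff _ hinj).mpr h.ne_zero) fun x => ?_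
    obtain ⟨b, hb⟩ := exists_cornerHom_mul_mul_cornerHom_eq E i₀ p p x
    obtain ⟨c, hc⟩ := h.exists_mul_mul_eq_smul b
    refine ⟨c, ?_⟩
    calc cornerHom E i₀ p * x * cornerHom E i₀ p
        = cornerHom E i₀ (p * p) * x * cornerHom E i₀ (p * p) := by rw [h.mul_self]
      _ = cornerHom E i₀ p * (cornerHom E i₀ p * x * cornerHom E i₀ p) * cornerHom E i₀ p := by
        rw [map_mul]; noncomm_ring
      _ = c • cornerHom E i₀ p := by rw [hb, ← map_mul, ← map_mul, hc, map_smul]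

lemma cornerHom_mul_mul_star_mem_tensor_atomicIdeal (u : A) {q : CStarTensor A K}
    (hq : IsMinimalProjection q) :
    cornerHom E i₀ u * q * star (cornerHom E i₀ u) ∈ (atomicIdeal A).tensor K := by
  have hmul_star : cornerHom E i₀ u * q * star (cornerHom E i₀ u) =
      (cornerHom E i₀ u * q) * star (cornerHom E i₀ u * q) := by
    rw [star_mul, hq.star_eq, mul_assoc, mul_assoc, ← mul_assoc q, hq.mul_self]
  by_cases h₀ : cornerHom E i₀ u * q = 0
  · rw [h₀, zero_mul]
    exact zero_mem _
  obtain ⟨c, q', hc, hq', hcq'⟩ :=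
    hq.exists_mul_star_self_eq_smul (by rw [mul_assoc, hq.mul_self]) h₀
  obtain ⟨b, hb⟩ := exists_cornerHom_mul_mul_cornerHom_eq E i₀ u (star u) q
  rw [map_star, hmul_star, hcq'] at hb
  obtain rfl : q' = cornerHom E i₀ (c⁻¹ • b) := by rw [map_smul, ← hb, inv_smul_smul₀ hc]
  rw [hmul_star, hcq']
  exact ((atomicIdeal A).tensor K).smul_mem' c
    (tmul_mem_tensor ((isMinimalProjection_cornerHom_iff E i₀).mp hq').mem_atomicIdeal _)

lemma cornerHom_mul_mul_star_mem_tensor_of_mem_atomicIdeal (u : A) {x : CStarTensor A K}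
    (hx : x ∈ atomicIdeal (CStarTensor A K)) :
    cornerHom E i₀ u * x * star (cornerHom E i₀ u) ∈ (atomicIdeal A).tensor K := by
  let Λ : CStarTensor A K →ₗ[ℂ] CStarTensor A K :=
    LinearMap.mulRight ℂ (star (cornerHom E i₀ u)) ∘ₗ LinearMap.mulLeft ℂ (cornerHom E i₀ u)
  have hΛ : Continuous Λ := (continuous_mul_const (star (cornerHom E i₀ u))).comp
    (continuous_const_mul (cornerHom E i₀ u))
  have hspan : atomSpan (CStarTensor A K) ≤ ((atomicIdeal A).tensor K).toSubmodule.comap Λ :=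
    Submodule.span_le.mpr fun q => cornerHom_mul_mul_star_mem_tensor_atomicIdeal E i₀ u
  exact closure_minimal hspan (((atomicIdeal A).tensor K).isClosed'.preimage hΛ) hx

include E i₀ in
lemma atomicIdeal_eq_tensor : atomicIdeal (CStarTensor A K) = (atomicIdeal A).tensor K := by
  refine (eq_tensor_iff E i₀).mpr fun a => ⟨fun ha => ?_, fun ha => ?_⟩
  · refine mem_of_forall_mul_mul_star_mem (M := (atomicIdeal A).toSubmodule)
      (atomicIdeal A).isClosed' fun u => (cornerHom_mem_tensor_iff E i₀).mp ?_
    rw [map_mul, map_mul, map_star]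
    exact cornerHom_mul_mul_star_mem_tensor_of_mem_atomicIdeal E i₀ u ha
  · have hspan : atomSpan A ≤
        ((atomicIdeal (CStarTensor A K)).comap (cornerHom E i₀)).toSubmodule :=
      Submodule.span_le.mpr fun p hp =>
        ((isMinimalProjection_cornerHom_iff E i₀).mpr hp).mem_atomicIdeal
    exact closure_minimal hspan
      ((atomicIdeal (CStarTensor A K)).comap (cornerHom E i₀)).isClosed' ha

include E i₀ in
lemma derived_tensor (I : ClosedIdeal A) : (I.tensor K).derived = I.derived.tensor K := by
  refine (eq_tensor_iff E i₀).mpr fun a => ?_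
  rw [ClosedIdeal.mem_derived, ClosedIdeal.mem_derived,
    ← map_mem_atomicIdeal_iff ((I.tensor K).quotientEquiv (map K I.projHom)
      (mem_tensor_iff_map_projHom_eq_zero E i₀ I) (map_surjective I.projHom_surjective)),
    ClosedIdeal.quotientEquiv_proj, map_cornerHom, atomicIdeal_eq_tensor E i₀,
    cornerHom_mem_tensor_iff, I.projHom_apply]

end CStarTensor

/-! ### Subquotients of the tensor product -/

/-- The inclusion `J → A` of an ideal, as a ⋆-homomorphism. -/
def ClosedIdeal.incl {A : Type*} [NonUnitalCStarAlgebra A] (J : ClosedIdeal A) :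
    J →⋆ₙₐ[ℂ] A where
  toFun := Subtype.val
  map_smul' _ _ := rfl
  map_zero' := rfl
  map_add' _ _ := rfl
  map_mul' _ _ := rfl
  map_star' _ := rfl

lemma ClosedIdeal.ker_incl {A : Type*} [NonUnitalCStarAlgebra A] (J : ClosedIdeal A) :
    ker J.incl = zeroIdeal J :=
  SetLike.ext fun _ => ZeroMemClass.coe_eq_zero

namespace CStarTensor

open scoped CStarAlgebra

variable {A K ι : Type*} [NonUnitalCStarAlgebra A] [NonUnitalCStarAlgebra K]

lemma range_map_incl (J : ClosedIdeal A) : Set.range (map K J.incl) = J.tensor K := by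
  refine Set.Subset.antisymm (Set.range_subset_iff.mpr fun x => ?_) ?_
  · refine Submodule.eq_top_iff'.mp (eq_top_of_forall_tmul_mem
      (M := (J.tensor K).toSubmodule.comap (map K J.incl : CStarTensor J K →ₗ[ℂ] CStarTensor A K))
      ((J.tensor K).isClosed'.preimage (map_continuous (map K J.incl))) fun a k => ?_) x
    exact Submodule.mem_comap.mpr ((map_tmul J.incl a k).symm ▸ tmul_mem_tensor a.2 k)
  · exact tensor_subset
      (M := LinearMap.range (map K J.incl : CStarTensor J K →ₗ[ℂ] CStarTensor A K))
      (isClosed_range (map K J.incl)) fun a ha k => ⟨tmul ⟨a, ha⟩ k, map_tmul J.incl _ k⟩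

variable (E : CompleteMatrixUnits ι K) (i₀ : ι)

include E i₀ in
lemma map_incl_injective (J : ClosedIdeal A) : Function.Injective (map K J.incl) := by
  rw [injective_iff_map_eq_zero]
  intro x hx
  rwa [← ClosedIdeal.mem_ker, ker_map E i₀, J.ker_incl, zeroIdeal_tensor E i₀] at hx

/-- The isomorphism of `J ⊗ K`, the tensor product of the C⋆-algebra `J` with `K`, with the ideal
`J ⊗ K` of `A ⊗ K`. -/
noncomputable def tensorIdealEquiv (J : ClosedIdeal A) : CStarTensor J K ≃⋆ₐ[ℂ] J.tensor K :=
  have hmem (x : CStarTensor J K) : map K J.incl x ∈ J.tensor K :=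
    (range_map_incl J).subset ⟨x, rfl⟩
  StarAlgEquiv.ofBijective
    ({ toFun := fun x => ⟨map K J.incl x, hmem x⟩
       map_smul' := fun c x => Subtype.ext (map_smul (map K J.incl) c x)
       map_zero' := Subtype.ext (map_zero (map K J.incl))
       map_add' := fun x y => Subtype.ext (map_add (map K J.incl) x y)
       map_mul' := fun x y => Subtype.ext (map_mul (map K J.incl) x y)
       map_star' := fun x => Subtype.ext (map_star (map K J.incl) x) } :
      CStarTensor J K →⋆ₙₐ[ℂ] J.tensor K)
    ⟨fun _ _ h => map_incl_injective E i₀ J (congrArg Subtype.val h), fun y => by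
      obtain ⟨x, hx⟩ := (range_map_incl J).superset y.2
      exact ⟨x, Subtype.ext hx⟩⟩

include E i₀ in
lemma comap_map_incl (I J : ClosedIdeal A) :
    (I.tensor K).comap (map K J.incl) = (I.restrict J).tensor K := by
  refine (eq_tensor_iff E i₀).mpr fun a => ?_
  rw [ClosedIdeal.mem_comap, map_cornerHom, cornerHom_mem_tensor_iff]
  rfl

/-- The isomorphism `(J ⊗ K) / (I ⊗ K) ≃ (J / I) ⊗ K`. -/
noncomputable def subquotientEquiv (I J : ClosedIdeal A) :
    (J.tensor K).Subquotient (I.tensor K) ≃⋆ₐ[ℂ] CStarTensor (J.Subquotient I) K :=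
  ((I.tensor K).restrict (J.tensor K)).quotientEquiv
    ((map K (I.restrict J).projHom).comp
      ((tensorIdealEquiv E i₀ J).symm : J.tensor K →⋆ₙₐ[ℂ] CStarTensor J K))
    (fun y => by
      obtain ⟨x, rfl⟩ := (tensorIdealEquiv E i₀ J).surjective y
      have hmap : map K (I.restrict J).projHom ((tensorIdealEquiv E i₀ J).symm
          (tensorIdealEquiv E i₀ J x)) = map K (I.restrict J).projHom x :=
        congrArg _ ((tensorIdealEquiv E i₀ J).symm_apply_apply x)
      refine Iff.trans ?_ (Eq.congr_left hmap).symm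
      rw [← mem_tensor_iff_map_projHom_eq_zero E i₀, ← comap_map_incl E i₀ I J]
      rfl)
    ((map_surjective (I.restrict J).projHom_surjective).comp
      (tensorIdealEquiv E i₀ J).symm.surjective)

end CStarTensor

/-! ### The Cantor–Bendixson sequence of the tensor product -/

open CStarTensor in
lemma IsCantorBendixsonSequence.tensor {A : Type (max u v)} [NonUnitalCStarAlgebra A] {K : Type v}
    [NonUnitalCStarAlgebra K] {ι : Type*} (E : CompleteMatrixUnits ι K) (i₀ : ι)
    {ht : Ordinal.{max u v}} {I : Ordinal.{max u v} → ClosedIdeal A}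
    (h : IsCantorBendixsonSequence A ht I) :
    IsCantorBendixsonSequence (CStarTensor A K) ht (fun α => (I α).tensor K) where
  zero := by
    rw [h.eq_zeroIdeal, zeroIdeal_tensor E i₀]
    rfl
  height := tensor_eq_univ h.height
  strictMono α β hαβ hβ :=
    ⟨tensor_mono (h.strictMono α β hαβ hβ).1,
      fun hle => (h.strictMono α β hαβ hβ).2 (subset_of_tensor_subset E i₀ hle)⟩
  limit β hβ hlim := by
    have : Nonempty (Set.Iio β) := ⟨⟨0, hlim.bot_lt⟩⟩
    have hmono : Monotone fun α : Set.Iio β => (I α : Set A) := fun _ γ hle =>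
      h.mono hle (γ.2.le.trans hβ)
    have hsup : I β = ClosedIdeal.closedSup fun α : Set.Iio β => I α := by
      refine SetLike.coe_injective ?_
      rw [ClosedIdeal.coe_closedSup_of_directed _ hmono.directed_le, h.limit β hβ hlim,
        Set.iUnion_subtype]
      rfl
    have hmono_tensor : Monotone fun α : Set.Iio β =>
        ((I α).tensor K : Set (CStarTensor A K)) := fun _ _ hle => tensor_mono (hmono hle)
    rw [hsup, closedSup_tensor E i₀,
      ClosedIdeal.coe_closedSup_of_directed _ hmono_tensor.directed_le, Set.iUnion_subtype]
    rfl
  succ α hα := by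
    have hsub : (I α : Set A) ⊆ I (α + 1) :=
      h.mono (Order.le_succ α) (Order.add_one_le_of_lt hα)
    rw [ClosedIdeal.coe_atomicPart_eq_image_iff (tensor_mono hsub), h.add_one_eq_derived hα,
      derived_tensor E i₀]

lemma nontrivial_lp {ι : Type*} {F : ι → Type*} [∀ i, NormedAddCommGroup (F i)] (p : ENNReal)
    (i : ι) [Nontrivial (F i)] : Nontrivial (lp F p) := by
  classical
  refine Function.Injective.nontrivial (f := lp.single p i) fun a b h => ?_
  simpa only [lp.single_apply_self] using congrFun (congrArg Subtype.val h) i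

end ScatteredCStar

theorem mainTheorem7_general {A : Type (max u v)} [NonUnitalCStarAlgebra A] (hA : IsScattered A)
    (H : Type v) [NormedAddCommGroup H] [InnerProductSpace ℂ H] [CompleteSpace H] [Nontrivial H] :
    IsScattered (CStarTensor A (compactOperators H)) ∧
    (∃ (ht : Ordinal.{max u v}) (I : Ordinal.{max u v} → ClosedIdeal A),
      IsCantorBendixsonSequence A ht I) ∧
    ∀ (ht : Ordinal.{max u v}) (I : Ordinal.{max u v} → ClosedIdeal A),
      IsCantorBendixsonSequence A ht I →
      IsCantorBendixsonSequence (CStarTensor A (compactOperators H)) ht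
        (fun α => (I α).tensor (compactOperators H)) ∧
      (∀ (ht' : Ordinal.{max u v})
        (J : Ordinal.{max u v} → ClosedIdeal (CStarTensor A (compactOperators H))),
        IsCantorBendixsonSequence (CStarTensor A (compactOperators H)) ht' J →
          ht' = ht ∧ ∀ α ≤ ht, J α = (I α).tensor (compactOperators H)) ∧
      ∀ α < ht,
        Nonempty (((I (α + 1)).tensor (compactOperators H)).Subquotient
            ((I α).tensor (compactOperators H)) ≃⋆ₐ[ℂ]
          CStarTensor ((I (α + 1)).Subquotient (I α)) (compactOperators H)) := by
  obtain ⟨ι, ⟨i₀⟩, ⟨E⟩⟩ := exists_nonempty_completeMatrixUnits_compactOperators H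
  obtain ⟨ht, I, hI⟩ := hA.noIntervalSpectrum.exists_isCantorBendixsonSequence
  refine ⟨(hI.tensor E i₀).isScattered, ⟨ht, I, hI⟩, fun ht I hI => ⟨hI.tensor E i₀, ?_, ?_⟩⟩
  · exact fun ht' J hJ => (hI.tensor E i₀).unique hJ
  · exact fun α _ => ⟨CStarTensor.subquotientEquiv E i₀ (I α) (I (α + 1))⟩

theorem mainTheorem7 {A : Type u} [NonUnitalCStarAlgebra A] (hA : IsScattered A) :
    IsScattered (CStarTensor A KEllTwo) ∧
    (∃ (ht : Ordinal.{u}) (I : Ordinal.{u} → ClosedIdeal A), IsCantorBendixsonSequence A ht I) ∧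
    ∀ (ht : Ordinal.{u}) (I : Ordinal.{u} → ClosedIdeal A), IsCantorBendixsonSequence A ht I →
      IsCantorBendixsonSequence (CStarTensor A KEllTwo) ht (fun α => (I α).tensor KEllTwo) ∧
      (∀ (ht' : Ordinal.{u}) (J : Ordinal.{u} → ClosedIdeal (CStarTensor A KEllTwo)),
        IsCantorBendixsonSequence (CStarTensor A KEllTwo) ht' J →
          ht' = ht ∧ ∀ α ≤ ht, J α = (I α).tensor KEllTwo) ∧
      ∀ α < ht,
        Nonempty (((I (α + 1)).tensor KEllTwo).Subquotient ((I α).tensor KEllTwo) ≃⋆ₐ[ℂ]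
          CStarTensor ((I (α + 1)).Subquotient (I α)) KEllTwo) := by
  have : Nontrivial (lp (fun _ : ℕ => ℂ) 2) := nontrivial_lp 2 0
  exact mainTheorem7_general.{u, 0} hA (lp (fun _ : ℕ => ℂ) 2)
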